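/- **Setting.** Let $Q_n$ be the quiver with vertices $p,q_1,\dots,q_n$, one arrow $q_i\to p$ for each $i$ and dimension vector $d_p=2$, $d_{q_i}=1$; let $P_n$ be the quiver with vertices $p_1,p_2,q_1,\dots,q_n$, one arrow $q_i\to p_j$ for all $i,j$ and dimension vector $(1,\dots,1)$. A weight is $\theta\in\mathbb Q^{\text{vertices}}$. A representation $V$ over an algebraically closed field is $\theta$-semistable if $\sum_q\theta_qd_q=0$ and $\theta(V')=\sum_q\theta_q\dim V'_q\le 0$ for all subrepresentations $V'$, and $\theta$-stable if moreover $\theta(V')=0$ only for $V'=0,V$. Let $Q=Q_n$ or $Q=P_n$ and let $Y$ be a scheme. A representation of $Q$ over $Y$ is considered as a tuple $s=(s_1,\dots,s_n)$ of sections $s_k=(s_{k,0}:s_{k,1})$ of $\mathbb P^1_Y\to Y$ (for $Q_n$ the map at $q_k\to p$ is given by the vector $(s_{k,0},s_{k,1})$, for $P_n$ the maps at $q_k\to p_1,p_2$ are $s_{k,0},s_{k,1}$); it is $\theta$-stable if all its fibres at geometric points are. For $P_n$ add the sections $s_0=(0:1)$, $s_\infty=(1:0)$. For a geometric point $y$ let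 $\Theta(s(y))$ be the set of weights $\theta$ for which $s(y)$ is $\theta$-semistable, normalised by $\sum_i\theta_{q_i}=2$ for $Q_n$, respectively $\theta_{p_1}+\theta_{p_2}=-1$ for $P_n$. For two tuples $s,s'$ let $U(s,s')\subseteq Y$ be the set of points over which $\Theta(s(y))\cap\Theta(s'(y))$ has nonempty interior in the hyperplane of normalised weights in $\{\sum_q\theta_qd_q=0\}$. For $Q_n$ let $i\ne j$ in $\{1,\dots,n\}$, for $P_n$ let $i=0,j=\infty$. Let $U_{i,j}=\{y: s_i(y)\ne s_j(y),\ s'_i(y)\neq s'_j(y)\}$, and for $k\in\{1,\dots,n\}$ let $U_{i,j,k}$ be the set of $y$ where $s_i(y),s_j(y),s_k(y)$ are distinct or $s'_i(y),s'_j(y),s'_k(y)$ are distinct. Locally on $U_{i,j}$ choose homogeneous coordinates $x_0,x_1$ and $x'_0,x'_1$ of $\mathbb P^1$ such that $s_i=(0:1),s_j=(1:0)$ with respect to $x$ and $s'_i=(0:1),s'_j=(1:0)$ with respect to $x'$. We say that $s,s'$ are *related* if for all such $i,j$ and coordinates, and all $k,l\in\{1,\dots,n\}$, $$s_{k,0}\,s_{l,1}\,s'_{k,1}\,s'_{l,0}=s_{k,1}\,s_{l,0}\,s'_{k,0}\,s'_{l,1}.\tag{1}$$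 The *degeneration scheme* $Z(s,s')\subseteq Y$ is the closed subscheme defined, for all such $i,j$ (or with $i,j$ exchanged), by the equation $s'_k=s'_j$ on the locus where $s_i,s_j,s_k$ are distinct and $s'_i\ne s'_j$, $s'_k\neq s'_i$, and by the equation $s_l=s_i$ on the locus where $s'_i,s'_j,s'_l$ are distinct and $s_i\ne s_j$, $s_l\ne s_j$. **Proposition.** Let $s$ be $\theta$-stable and $s'$ be $\theta'$-stable for some weights $\theta,\theta'$ (for example generic ones), and let $s,s'$ be related. Then the sets $U_{i,j}$, $U_{i,j,k}$ and $U=U(s,s')$ are open, the sets $U_{i,j}\cap U_{i,j,k}$ cover $Y$, coordinates as above exist locally on $U_{i,j}$, and the closed subscheme $Z=Z(s,s')$ exists and has support $Y\setminus U$. There is a closed subscheme $C\subset(\mathbb P^1)^2_Y$ such that: (a) Over each $U_{i,j}$, $C$ is defined by the equations $$s_{k,0}\,s'_{k,1}\,x_1x'_0=s_{k,1}\,s'_{k,0}\,x_0x'_1\tag{2}$$ for all $k\in\{1,\dots,n\}$, and over $U_{i,j}\cap U_{i,j,k}$ by the single equation (2) for this $k$. (b) $C$ is flat over $Y$ with geometrically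 reduced fibres, and $C$ is reduced if $Y$ is. $C$ contains all pairs of sections $(s_l,s'_l)$ (including $l=0,\infty$ for $P_n$). Over $U$ both projections $C_U\to\mathbb P^1_U$ are isomorphisms. A morphism $T\to Y$ factors through the subscheme $Z$ if and only if $C_T=C\times_YT$ is a chain of two $\mathbb P^1$'s intersecting transversally, i.e. there are sections $\tau,\tau'$ of $\mathbb P^1_T$ such that $C_T$ is the scheme-theoretic union of closed subschemes $D,D'$, where the first projection maps $D$ isomorphically to $\mathbb P^1_T$ and the second contracts $D$ to $\tau'$, the second projection maps $D'$ isomorphically to $\mathbb P^1_T$ and the first contracts $D'$ to $\tau$, and $D\cap D'\cong T$. (c) Let $\tau,\tau'$ be such sections for $T=Z$. The two projections $C_U\to\mathbb P^1_U$ induce mutually inverse isomorphisms $\Phi,\Phi^{-1}\colon\mathbb P^1_U\leftrightarrows\mathbb P^1_U$ over $U$ such that $\Phi$ maps $s_l$ to $s'_l$ for all $l$, and $\Phi$ is locally on $U$ given by an isomorphism of quiver representations $s|_U\cong s'|_U$. The first projection $C\to\mathbb P^1_Y$ is an isomorphism over the complement of $\tau(Z)$, so that $C$ induces a morphism $\mathbb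 P^1_Y\setminus\tau(Z)\to\mathbb P^1_Y$; it restricts to $\Phi$ over $U$ and is constant with value $\tau'$ over $Z$. Symmetrically $C$ induces a morphism $\mathbb P^1_Y\setminus\tau'(Z)\to\mathbb P^1_Y$ that restricts to $\Phi^{-1}$ over $U$ and is constant with value $\tau$ over $Z$. -/

import Mathlib

open CategoryTheory CategoryTheory.Limits AlgebraicGeometry

universe u

noncomputable section

namespace QuiverCurve

/-! ### Quiver representations over a commutative ring and King stability -/

/-- The representation space `R(Q, d)` over a commutative ring `R`: free representations with
fixed bases, i.e. a matrix for every arrow. -/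
def RepSpace (Q : Type) [Quiver.{0} Q] (d : Q → ℕ) (R : Type u) : Type u :=
  ∀ ⦃a b : Q⦄, (a ⟶ b) → Matrix (Fin (d b)) (Fin (d a)) R

/-- `h ∈ ∏ GL(d_q)` is an isomorphism from the representation `M` to the representation `N`. -/
def IsRepIso {Q : Type} [Quiver.{0} Q] {d : Q → ℕ} {R : Type u} [CommRing R]
    (h : ∀ q, GL (Fin (d q)) R) (M N : RepSpace Q d R) : Prop :=
  ∀ ⦃a b : Q⦄ (α : a ⟶ b),
    (h b : Matrix (Fin (d b)) (Fin (d b)) R) * M α =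
      N α * (h a : Matrix (Fin (d a)) (Fin (d a)) R)

/-- The subspaces `W q ⊆ k ^ d q` form a subrepresentation of `M`. -/
def IsSubrep {Q : Type} [Quiver.{0} Q] {d : Q → ℕ} {k : Type u} [Field k]
    (M : RepSpace Q d k) (W : ∀ q, Submodule k (Fin (d q) → k)) : Prop :=
  ∀ ⦃a b : Q⦄ (α : a ⟶ b), ∀ x ∈ W a, Matrix.mulVec (M α) x ∈ W b

/-- The number `θ(W) = ∑ θ_q dim W_q`. -/
def weightOf {Q : Type} [Fintype Q] {d : Q → ℕ} {k : Type u} [Field k]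
    (θ : Q → ℚ) (W : ∀ q, Submodule k (Fin (d q) → k)) : ℚ :=
  ∑ q, θ q * (Module.finrank k (W q) : ℚ)

def IsSemistable {Q : Type} [Fintype Q] [Quiver.{0} Q] {d : Q → ℕ} {k : Type u} [Field k]
    (θ : Q → ℚ) (M : RepSpace Q d k) : Prop :=
  ∑ q, θ q * (d q : ℚ) = 0 ∧ ∀ W, IsSubrep M W → weightOf θ W ≤ 0

def IsStable {Q : Type} [Fintype Q] [Quiver.{0} Q] {d : Q → ℕ} {k : Type u} [Field k]
    (θ : Q → ℚ) (M : RepSpace Q d k) : Prop :=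
  IsSemistable θ M ∧
    ∀ W, IsSubrep M W → weightOf θ W = 0 → (∀ q, W q = ⊥) ∨ (∀ q, W q = ⊤)

/-! ### The quivers `Q_n` and `P_n` -/

/-- The two families of bipartite quivers, `Q_n` and `P_n`. -/
inductive Kind : Type
  | Q
  | P

/-- The number of sinks: `Q_n` has the one sink `p`, `P_n` has the two sinks `p_1, p_2`. -/
def Kind.hubs : Kind → ℕ
  | .Q => 1
  | .P => 2

/-- The dimension at each sink: `2` for `Q_n`, `1` for `P_n`. -/
def Kind.hubDim : Kind → ℕ
  | .Q => 2
  | .P => 1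

/-- The vertices: the sinks (left summand) and the sources `q_1, …, q_n` (right summand). -/
def Vertex (K : Kind) (n : ℕ) : Type := Fin K.hubs ⊕ Fin n

instance (K : Kind) (n : ℕ) : Fintype (Vertex K n) :=
  inferInstanceAs (Fintype (Fin K.hubs ⊕ Fin n))

def Vertex.hub {K : Kind} {n : ℕ} (j : Fin K.hubs) : Vertex K n := Sum.inl j

def Vertex.q {K : Kind} {n : ℕ} (i : Fin n) : Vertex K n := Sum.inr i

/-- There is exactly one arrow from each source to each sink, and no other arrow. -/
inductive Arrow (K : Kind) (n : ℕ) : Vertex K n → Vertex K n → Type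
  | mk (i : Fin n) (j : Fin K.hubs) : Arrow K n (Vertex.q i) (Vertex.hub j)

instance (K : Kind) (n : ℕ) : Quiver.{0} (Vertex K n) := ⟨Arrow K n⟩

/-- The dimension vector. -/
def dimVec (K : Kind) (n : ℕ) : Vertex K n → ℕ
  | .inl _ => K.hubDim
  | .inr _ => 1

/-- The coordinate of a vector `(v_0, v_1)` that belongs to the row `r` at the sink `j`: for `Q_n`
it is the row (one sink of dimension two), for `P_n` the sink (two sinks of dimension one). -/
def entry : (K : Kind) → Fin K.hubs → Fin K.hubDim → Fin 2
  | .Q, _, r => r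
  | .P, j, _ => j

/-- The representation of `Q_n` or `P_n` given by `n` vectors `v_1, …, v_n` of length two:
for `Q_n` the arrow `α_i` is the column `v_i`, for `P_n` the arrow `α_{i,1}` is the scalar
`v_{i,0}` and `α_{i,2}` the scalar `v_{i,1}`. -/
def repOf (K : Kind) {n : ℕ} {R : Type u} (v : Fin n → Fin 2 → R) :
    RepSpace (Vertex K n) (dimVec K n) R :=
  fun _ _ α => match α with
    | Arrow.mk i j => fun r _ => v i (entry K j r)

/-- The linear map on `R²` given at the sinks by an element of `∏ GL(d_q)`: the matrix at `p`
for `Q_n`, the diagonal matrix of the two scalars at `p_1, p_2` for `P_n`. -/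
def hubMatrix {R : Type u} [CommRing R] {n : ℕ} : (K : Kind) →
    (∀ q : Vertex K n, GL (Fin (dimVec K n q)) R) → Matrix (Fin 2) (Fin 2) R
  | .Q, h => fun (r c : Fin 2) => (h (Vertex.hub (K := .Q) (0 : Fin 1))).val r c
  | .P, h => Matrix.diagonal fun j : Fin 2 =>
      (h (Vertex.hub (K := .P) j)).val (0 : Fin 1) (0 : Fin 1)

/-- The normalisation of weights: `∑ θ_i = 2` for `Q_n` and `η_1 + η_2 = -1` for `P_n`. -/
def IsNormalised {n : ℕ} : (K : Kind) → (Vertex K n → ℚ) → Prop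
  | .Q, θ => ∑ i : Fin n, θ (Vertex.q i) = 2
  | .P, θ => ∑ j : Fin 2, θ (Vertex.hub (K := .P) j) = -1

/-- The affine hyperplane in the weight space `H` spanned by the hypersimplex `Δ(2,n)` for `Q_n`
and by `Δ¹ × Δ^{n-1}` for `P_n`, with its subspace topology. -/
abbrev WeightSlice (K : Kind) (n : ℕ) : Type :=
  {θ : Vertex K n → ℚ // ∑ q, θ q * (dimVec K n q : ℚ) = 0 ∧ IsNormalised K θ}

/-! ### The projective line and homogeneous coordinates -/

/-- The standard grading of `ℤ[X_0, X_1]`. -/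
instance gradingP1 :
    GradedRing (MvPolynomial.homogeneousSubmodule (Fin 2) (ULift.{u} ℤ)) :=
  MvPolynomial.gradedAlgebra

/-- `ℙ¹` over the integers. -/
def P1 : Scheme.{u} := Proj (MvPolynomial.homogeneousSubmodule (Fin 2) (ULift.{u} ℤ))

/-- `X_i ↦ a_i`. -/
def coordHom {T : Scheme.{u}} (a : Fin 2 → Γ(T, ⊤)) :
    MvPolynomial (Fin 2) (ULift.{u} ℤ) →+* Γ(T, ⊤) :=
  MvPolynomial.eval₂Hom ((Int.castRingHom Γ(T, ⊤)).comp ULift.ringEquiv.toRingHom) a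

lemma map_irrelevant_coordHom {T : Scheme.{u}} (a : Fin 2 → Γ(T, ⊤))
    (h : Ideal.span (Set.range a) = ⊤) :
    (HomogeneousIdeal.irrelevant
      (MvPolynomial.homogeneousSubmodule (Fin 2) (ULift.{u} ℤ))).toIdeal.map (coordHom a) = ⊤ := by
  rw [eq_top_iff, ← h, Ideal.span_le]
  rintro _ ⟨i, rfl⟩
  have hX : (MvPolynomial.X i : MvPolynomial (Fin 2) (ULift.{u} ℤ)) ∈
      (HomogeneousIdeal.irrelevant
        (MvPolynomial.homogeneousSubmodule (Fin 2) (ULift.{u} ℤ))).toIdeal := by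
    exact HomogeneousIdeal.mem_irrelevant_of_mem _ one_pos
      (MvPolynomial.isHomogeneous_X (ULift.{u} ℤ) i)
  have := Ideal.mem_map_of_mem (coordHom a) hX
  simpa [coordHom] using this

/-- The morphism `(a_0 : a_1) : T ⟶ ℙ¹` for global functions `a_0, a_1` that generate the unit
ideal. -/
def homogPoint {T : Scheme.{u}} (a : Fin 2 → Γ(T, ⊤)) (h : Ideal.span (Set.range a) = ⊤) :
    T ⟶ P1.{u} :=
  Proj.fromOfGlobalSections _ (coordHom a) (map_irrelevant_coordHom a h)

/-- `f = (a_0 : a_1)`. -/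
def HasCoords {T : Scheme.{u}} (f : T ⟶ P1.{u}) (a : Fin 2 → Γ(T, ⊤)) : Prop :=
  ∃ h : Ideal.span (Set.range a) = ⊤, f = homogPoint a h

/-- `ℙ¹_Y`. -/
def PLine (Y : Scheme.{u}) : Scheme.{u} := pullback (terminal.from Y) (terminal.from P1.{u})

def PLine.proj (Y : Scheme.{u}) : PLine Y ⟶ Y := pullback.fst _ _

def PLine.toP1 (Y : Scheme.{u}) : PLine Y ⟶ P1.{u} := pullback.snd _ _

/-- The morphism `T ⟶ ℙ¹_Y` with components `T ⟶ Y` and `T ⟶ ℙ¹`. -/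
def PLine.lift {T Y : Scheme.{u}} (t : T ⟶ Y) (f : T ⟶ P1.{u}) : T ⟶ PLine Y :=
  pullback.lift t f (by ext)

lemma PLine.lift_proj {T Y : Scheme.{u}} (t : T ⟶ Y) (f : T ⟶ P1.{u}) :
    PLine.lift t f ≫ PLine.proj Y = t := pullback.lift_fst _ _ _

lemma PLine.lift_toP1 {T Y : Scheme.{u}} (t : T ⟶ Y) (f : T ⟶ P1.{u}) :
    PLine.lift t f ≫ PLine.toP1 Y = f := pullback.lift_snd _ _ _

/-- `(ℙ¹)²_Y`. -/
def PSq (Y : Scheme.{u}) : Scheme.{u} := pullback (PLine.proj Y) (PLine.proj Y)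

def PSq.fst (Y : Scheme.{u}) : PSq Y ⟶ PLine Y := pullback.fst _ _

def PSq.snd (Y : Scheme.{u}) : PSq Y ⟶ PLine Y := pullback.snd _ _

/-- The morphism `T ⟶ (ℙ¹)²_Y` with components `T ⟶ Y` and `T ⟶ ℙ¹`, `T ⟶ ℙ¹`. -/
def PSq.lift {T Y : Scheme.{u}} (t : T ⟶ Y) (f f' : T ⟶ P1.{u}) : T ⟶ PSq Y :=
  pullback.lift (PLine.lift t f) (PLine.lift t f') (by simp only [PLine.lift_proj])

/-- Sections of `ℙ¹_Y ⟶ Y`. -/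
structure Sec (Y : Scheme.{u}) where
  hom : Y ⟶ PLine Y
  hom_proj : hom ≫ PLine.proj Y = 𝟙 Y

def Sec.toP1 {Y : Scheme.{u}} (s : Sec Y) : Y ⟶ P1.{u} := s.hom ≫ PLine.toP1 Y

def Sec.ofPoint {Y : Scheme.{u}} (f : Y ⟶ P1.{u}) : Sec Y := ⟨PLine.lift (𝟙 Y) f, PLine.lift_proj _ _⟩

/-- The base change of a section along `t : T ⟶ Y`. -/
def Sec.baseChange {T Y : Scheme.{u}} (s : Sec Y) (t : T ⟶ Y) : Sec T := Sec.ofPoint (t ≫ s.toP1)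

/-- The constant section `(0 : 1)`. -/
def Sec.zero (Y : Scheme.{u}) : Sec Y :=
  Sec.ofPoint (homogPoint ![0, 1] (Ideal.eq_top_of_isUnit_mem _ (Ideal.subset_span ⟨1, rfl⟩)
    (by simp)))

/-- The constant section `(1 : 0)`. -/
def Sec.infty (Y : Scheme.{u}) : Sec Y :=
  Sec.ofPoint (homogPoint ![1, 0] (Ideal.eq_top_of_isUnit_mem _ (Ideal.subset_span ⟨0, rfl⟩)
    (by simp)))

/-! ### Families of representations as tuples of sections of `ℙ¹_Y` -/

/-- The indices of sections: `1, …, n`, for `P_n` together with `0` and `∞`. -/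
inductive Mark (n : ℕ) : Kind → Type
  | pt {K : Kind} (i : Fin n) : Mark n K
  | zero : Mark n .P
  | infty : Mark n .P

/-- For `P_n` the sections `s_0 = (0 : 1)` and `s_∞ = (1 : 0)` are added. -/
def extend {Y : Scheme.{u}} {n : ℕ} (s : Fin n → Sec Y) {K : Kind} : Mark n K → Sec Y
  | .pt i => s i
  | .zero => Sec.zero Y
  | .infty => Sec.infty Y

/-- The pairs `i, j`: for `Q_n` any two distinct indices, for `P_n` only `i = 0, j = ∞`. -/
def Adm {n : ℕ} : {K : Kind} → Mark n K → Mark n K → Prop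
  | .Q, i, j => i ≠ j
  | .P, i, j => i = .zero ∧ j = .infty

/-- `v` is a tuple of vectors that represents the fibre of `s` at a geometric point `y`. -/
def IsFibre {Y : Scheme.{u}} {n : ℕ} (s : Fin n → Sec Y) {k : Type u} [Field k]
    (y : Spec (CommRingCat.of k) ⟶ Y) (v : Fin n → Fin 2 → k) : Prop :=
  ∀ i, HasCoords (y ≫ (s i).toP1) fun r => (Scheme.ΓSpecIso (CommRingCat.of k)).inv (v i r)

/-- The representation over `Y` given by the sections `s_1, …, s_n` is `θ`-stable: its fibres at
all geometric points are `θ`-stable. -/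
def IsStableFamily (K : Kind) {n : ℕ} {Y : Scheme.{u}} (θ : Vertex K n → ℚ)
    (s : Fin n → Sec Y) : Prop :=
  ∀ (k : Type u) [Field k] [IsAlgClosed k] (y : Spec (CommRingCat.of k) ⟶ Y),
    ∃ v : Fin n → Fin 2 → k, IsFibre s y v ∧ IsStable θ (repOf K v)

/-- The polytope `Θ(s(y))` of normalised weights for which the fibre at a geometric point is
semistable. -/
def polytope (K : Kind) {n : ℕ} {Y : Scheme.{u}} (s : Fin n → Sec Y) {k : Type u} [Field k]
    (y : Spec (CommRingCat.of k) ⟶ Y) : Set (WeightSlice K n) :=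
  {θ | ∃ v : Fin n → Fin 2 → k, IsFibre s y v ∧ IsSemistable θ.1 (repOf K v)}

/-- A geometric point over `y`. -/
def geomPoint {Y : Scheme.{u}} (y : Y) :
    Spec (CommRingCat.of (AlgebraicClosure (Y.residueField y))) ⟶ Y :=
  Spec.map (CommRingCat.ofHom
    (algebraMap (Y.residueField y) (AlgebraicClosure (Y.residueField y)))) ≫
    Y.fromSpecResidueField y

/-- `U(s, s')`: the points where the two polytopes have overlapping interiors. -/
def overlapLocus (K : Kind) {n : ℕ} {Y : Scheme.{u}} (s s' : Fin n → Sec Y) : Set Y :=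
  {y | (interior (polytope K s (geomPoint y) ∩ polytope K s' (geomPoint y))).Nonempty}

/-- The points where the sections `i, j, k` of a tuple are pairwise distinct. -/
def distinctLocus {Y : Scheme.{u}} {I : Type} (s : I → Sec Y) (i j k : I) : Set Y :=
  {y | (s i).hom y ≠ (s j).hom y ∧ (s i).hom y ≠ (s k).hom y ∧ (s j).hom y ≠ (s k).hom y}

/-- `U_{i,j}`. -/
def pairLocus {Y : Scheme.{u}} {I : Type} (s s' : I → Sec Y) (i j : I) : Set Y :=
  {y | (s i).hom y ≠ (s j).hom y ∧ (s' i).hom y ≠ (s' j).hom y}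

/-- `U_{i,j,k}`. -/
def tripleLocus {Y : Scheme.{u}} {I : Type} (s s' : I → Sec Y) (i j k : I) : Set Y :=
  distinctLocus s i j k ∪ distinctLocus s' i j k

/-- Homogeneous coordinates `x_0, x_1` of `ℙ¹_T` (the old coordinates multiplied by `g`) for which
`s_i = (0 : 1)` and `s_j = (1 : 0)`, and homogeneous coordinates `(a_{k,0} : a_{k,1})` of the
sections `s_k` with respect to them. They exist only if `T ⟶ Y` lands where `s_i ≠ s_j`. -/
structure AdaptedCoords {Y : Scheme.{u}} {n : ℕ} (s : Fin n → Sec Y) {K : Kind} {T : Scheme.{u}}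
    (t : T ⟶ Y) (i j : Mark n K) where
  g : GL (Fin 2) Γ(T, ⊤)
  at_i : HasCoords (t ≫ (extend s i).toP1)
    (((g⁻¹ : GL (Fin 2) Γ(T, ⊤)) : Matrix (Fin 2) (Fin 2) Γ(T, ⊤)).mulVec ![0, 1])
  at_j : HasCoords (t ≫ (extend s j).toP1)
    (((g⁻¹ : GL (Fin 2) Γ(T, ⊤)) : Matrix (Fin 2) (Fin 2) Γ(T, ⊤)).mulVec ![1, 0])
  a : Fin n → Fin 2 → Γ(T, ⊤)
  at_k : ∀ k, HasCoords (t ≫ (s k).toP1)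
    (((g⁻¹ : GL (Fin 2) Γ(T, ⊤)) : Matrix (Fin 2) (Fin 2) Γ(T, ⊤)).mulVec (a k))

/-- `x` are homogeneous coordinates of `f : T ⟶ ℙ¹` with respect to the coordinates `c`. -/
def AdaptedCoords.Represents {Y : Scheme.{u}} {n : ℕ} {s : Fin n → Sec Y} {K : Kind}
    {T : Scheme.{u}} {t : T ⟶ Y} {i j : Mark n K} (c : AdaptedCoords s t i j)
    (f : T ⟶ P1.{u}) (x : Fin 2 → Γ(T, ⊤)) : Prop :=
  HasCoords f
    (((c.g⁻¹ : GL (Fin 2) Γ(T, ⊤)) : Matrix (Fin 2) (Fin 2) Γ(T, ⊤)).mulVec x)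

/-- The tuples `s, s'` are related by the equations
`s_{k,0} s_{l,1} s'_{k,1} s'_{l,0} = s_{k,1} s_{l,0} s'_{k,0} s'_{l,1}`, over every open subset,
for all admissible `i, j` and all choices of coordinates. -/
def AreRelated (K : Kind) {n : ℕ} {Y : Scheme.{u}} (s s' : Fin n → Sec Y) : Prop :=
  ∀ (V : Y.Opens) (i j : Mark n K), Adm i j →
    ∀ (c : AdaptedCoords s V.ι i j) (c' : AdaptedCoords s' V.ι i j) (k l : Fin n),
      c.a k 0 * c.a l 1 * c'.a k 1 * c'.a l 0 = c.a k 1 * c.a l 0 * c'.a k 0 * c'.a l 1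

/-- The `k`-th equation of the curve, `s_{k,0} s'_{k,1} x_1 x'_0 = s_{k,1} s'_{k,0} x_0 x'_1`. -/
def CurveEq {Y : Scheme.{u}} {n : ℕ} {s s' : Fin n → Sec Y} {K : Kind} {T : Scheme.{u}}
    {t : T ⟶ Y} {i j : Mark n K} (c : AdaptedCoords s t i j) (c' : AdaptedCoords s' t i j)
    (k : Fin n) (x x' : Fin 2 → Γ(T, ⊤)) : Prop :=
  c.a k 0 * c'.a k 1 * x 1 * x' 0 = c.a k 1 * c'.a k 0 * x 0 * x' 1

/-- `ζ : Z ⟶ Y` is the scheme `Z(s, s')`: it is locally defined by each of the equations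
`s'_k = (1 : 0)`, for `k` with `s_k ≠ (0 : 1), (1 : 0)` and `s'_k ≠ (0 : 1)`, and
`s_l = (0 : 1)`, for `l` with `s'_l ≠ (0 : 1), (1 : 0)` and `s_l ≠ (1 : 0)`, in coordinates with
`s_i = s'_i = (0 : 1)` and `s_j = s'_j = (1 : 0)`. The roles of `i` and `j` may be exchanged. -/
def IsDegenerationScheme (K : Kind) {n : ℕ} {Y Z : Scheme.{u}} (s s' : Fin n → Sec Y)
    (ζ : Z ⟶ Y) : Prop :=
  IsClosedImmersion ζ ∧
  ∀ i j : Mark n K, (Adm i j ∨ Adm j i) → ∀ (k : Fin n) (T : Scheme.{u}) (t : T ⟶ Y),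
    ((∀ x : T, t x ∈ pairLocus (extend s) (extend s') i j ∧
        t x ∈ distinctLocus (extend s) i j (.pt k) ∧ (s' k).hom (t x) ≠ (extend s' i).hom (t x)) →
      ((∃ z : T ⟶ Z, z ≫ ζ = t) ↔ t ≫ (s' k).hom = t ≫ (extend s' j).hom)) ∧
    ((∀ x : T, t x ∈ pairLocus (extend s) (extend s') i j ∧
        t x ∈ distinctLocus (extend s') i j (.pt k) ∧ (s k).hom (t x) ≠ (extend s j).hom (t x)) →
      ((∃ z : T ⟶ Z, z ≫ ζ = t) ↔ t ≫ (s k).hom = t ≫ (extend s i).hom))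

/-! ### Curves in `(ℙ¹)²_Y` -/

/-- The structure morphism to `Y` of a scheme over `(ℙ¹)²_Y`. -/
def toBase {C Y : Scheme.{u}} (ι : C ⟶ PSq Y) : C ⟶ Y := ι ≫ PSq.fst Y ≫ PLine.proj Y

/-- The first projection `C_T ⟶ ℙ¹_T` of the base change `C_T = C ×_Y T`. -/
def proj₁ {C T Y : Scheme.{u}} (ι : C ⟶ PSq Y) (t : T ⟶ Y) : pullback (toBase ι) t ⟶ PLine T :=
  PLine.lift (pullback.snd _ _) (pullback.fst _ _ ≫ ι ≫ PSq.fst Y ≫ PLine.toP1 Y)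

/-- The second projection `C_T ⟶ ℙ¹_T` of the base change `C_T = C ×_Y T`. -/
def proj₂ {C T Y : Scheme.{u}} (ι : C ⟶ PSq Y) (t : T ⟶ Y) : pullback (toBase ι) t ⟶ PLine T :=
  PLine.lift (pullback.snd _ _) (pullback.fst _ _ ≫ ι ≫ PSq.snd Y ≫ PLine.toP1 Y)

/-- A scheme `X` over `T` with two projections `p, p'` to `ℙ¹_T` is a chain of two `ℙ¹`s that
intersect transversally: it is the scheme-theoretic union of closed subschemes `D, D'` where
`p` maps `D` isomorphically to `ℙ¹_T` and `p'` contracts `D` to the section `τ'`, while `p'` maps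
`D'` isomorphically to `ℙ¹_T` and `p` contracts `D'` to the section `τ`; the scheme-theoretic
intersection of `D` and `D'` is a single section, i.e. isomorphic to `T`. -/
def IsChain {X T : Scheme.{u}} (p p' : X ⟶ PLine T) (τ τ' : Sec T) : Prop :=
  ∃ (D D' : Scheme.{u}) (δ : D ⟶ X) (δ' : D' ⟶ X),
    IsClosedImmersion δ ∧ IsClosedImmersion δ' ∧
    IsIso (δ ≫ p) ∧ δ ≫ p' = δ ≫ p ≫ PLine.proj T ≫ τ'.hom ∧
    IsIso (δ' ≫ p') ∧ δ' ≫ p = δ' ≫ p' ≫ PLine.proj T ≫ τ.hom ∧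
    IsIso (pullback.fst δ δ' ≫ δ ≫ p ≫ PLine.proj T) ∧
    δ.ker ⊓ δ'.ker = ⊥

/-- The correspondence `p, q : C ⟶ ℙ¹_Y` induces a morphism `φ` ("`q ∘ p⁻¹`") from `ℙ¹_Y` minus the
closed subset `τ(Z)` to `ℙ¹_Y` that over `Z` is constant with value the section `κ` and over `U`
is the restriction of `Φ`. -/
def InducesMorphism {C Y Z : Scheme.{u}} (p q : C ⟶ PLine Y) (ζ : Z ⟶ Y) (τ κ : Sec Z)
    (U : Y.Opens) (Φ : PLine (U : Scheme.{u}) ⟶ PLine (U : Scheme.{u})) : Prop :=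
  ∃ W : (PLine Y).Opens, (W : Set (PLine Y)) = (Set.range (PLine.lift ζ τ.toP1))ᶜ ∧
    IsIso (p ∣_ W) ∧
    ∃ φ : (W : Scheme.{u}) ⟶ PLine Y, (p ∣_ W) ≫ φ = (p ⁻¹ᵁ W).ι ≫ q ∧
      (∀ (T : Scheme.{u}) (w : T ⟶ W) (z : T ⟶ Z), w ≫ W.ι ≫ PLine.proj Y = z ≫ ζ →
        w ≫ φ = PLine.lift (z ≫ ζ) (z ≫ κ.toP1)) ∧
      (∀ (T : Scheme.{u}) (w : T ⟶ W) (u : T ⟶ U), w ≫ W.ι ≫ PLine.proj Y = u ≫ U.ι →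
        w ≫ φ = PLine.lift (u ≫ U.ι)
          (PLine.lift u (w ≫ W.ι ≫ PLine.toP1 Y) ≫ Φ ≫ PLine.toP1 U))

/-- The automorphism `Φ` of `ℙ¹_U` comes from an isomorphism `s|_U ≅ s'|_U` of representations:
locally on `U`, for vectors `a_k, a'_k` representing `s_k, s'_k`, there is an isomorphism
`h ∈ ∏ GL(d_q)` of quiver representations from `(a_k)` to `(a'_k)` for which `Φ` is the
projective map given by the matrix of `h` at the sinks. -/
def InducesRepIso (K : Kind) {n : ℕ} {Y : Scheme.{u}} (s s' : Fin n → Sec Y) (U : Y.Opens)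
    (Φ : PLine (U : Scheme.{u}) ⟶ PLine (U : Scheme.{u})) : Prop :=
  ∀ y ∈ U, ∃ (V : Y.Opens) (hV : V ≤ U) (a a' : Fin n → Fin 2 → Γ(V, ⊤))
    (h : ∀ q : Vertex K n, GL (Fin (dimVec K n q)) Γ(V, ⊤)), y ∈ V ∧
    (∀ k, HasCoords (V.ι ≫ (s k).toP1) (a k)) ∧
    (∀ k, HasCoords (V.ι ≫ (s' k).toP1) (a' k)) ∧
    IsRepIso h (repOf K a) (repOf K a') ∧
    ∀ (T : Scheme.{u}) (t : T ⟶ V) (f : T ⟶ P1.{u}) (x : Fin 2 → Γ(T, ⊤)), HasCoords f x →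
      HasCoords (PLine.lift (t ≫ Y.homOfLE hV) f ≫ Φ ≫ PLine.toP1 U)
        (((hubMatrix K h).map t.appTop).mulVec x)

end QuiverCurve

end

/-!
Morphisms to `ℙ¹` are handled through homogeneous coordinates: they exist locally
(`exists_local_coords`), and two points are equal if and only if the determinant of their coordinates
vanishes (`HasCoords.eq_iff`). All schemes below are described by their functors of points.

The curve `C` consists of the pairs of points `(f, f')` such that, for all admissible `i, j` and all
`k`, the cross ratio of `s_i, s_j, s_k, f` equals that of `s'_i, s'_j, s'_k, f'`, with denominators
cleared (`crossRel`). In coordinates with `s_i = s'_i = (0 : 1)` and `s_j = s'_j = (1 : 0)` the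
equation for `k` reads `a x_1 x'_0 = b x_0 x'_1`. Where `s_i, s_j, s_k` or `s'_i, s'_j, s'_k` are
distinct, `a` or `b` is invertible (`mem_basicOpen_of_mem_tripleLocus`), so that this single equation
defines a conic. Being related means that all pairs of marked points lie on it. Four pairs of points
on such a conic have equal cross ratios in both projections (`crossPt_of_conic`), hence every point
of the conic satisfies all other equations too (`crossRel_iff_conic`). Stability provides the third
distinct section: two subrepresentations of complementary dimensions that contain all the vectors
would both have weight zero (`IsStable.exists_br_ne_zero`). So the relation is locally on `Y` a
conic `x_0 x'_0 = d x_1 x'_1` in suitable coordinates. Such relations are called correspondences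
here (`Correspondence`), and the assertions on `C` and `Z` hold for all of them
(`Correspondence.exists_scheme`).

A property of points that is locally the vanishing of a function is represented by a closed
subscheme (`exists_closedImmersion_of_local`). This gives `C`, and it gives `Z` as the locus where a
line is contracted, which is locally `d = 0`. The charts of a conic are affine lines and the
hyperbola `u v = d`. The ring `R[u, v] / (u v - d)` has the basis of the powers of `u` and `v`
and embeds into a product of two rings of Laurent polynomials; this shows that `C` is flat over `Y`
with reduced fibres, and for `d = 0` that it is the scheme-theoretic union of the two lines
`x_0 = 0` and `x'_0 = 0` (`IsConicModel.exists_flat_chart`). Conversely, a component of a chain is a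
contracted line. A point `(x_0 : x_1)` for which `(d x_1, x_0)` is unimodular has the unique partner
`(d x_1 : x_0)`, so the first projection is invertible away from the point to which the second line
is contracted (`Correspondence.IsModel.exists_morphism`).

It remains to identify the complement of `Z` with the locus where the polytopes overlap. Where `d` is
invertible, the conic is the graph of a projective transformation. It gives an isomorphism of the
two representations (`exists_repIso_of_notMem`), so their polytopes agree, and a stable weight is an
interior point (`IsStable.interior_nonempty`). At a point of `Z` the marked points lie on two
crossing lines: each `s_l` is equal to `κ` or `s'_l` is equal to `κ'`. The sections of `s` equal to
`κ` and the remaining ones of `s'` give subrepresentations of complementary dimensions of the two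
representations. Their weights add up to zero and are not positive on the common part of the two
polytopes, which therefore lies in a hyperplane (`interior_polytope_inter_eq_empty`).
-/


noncomputable section

namespace QuiverCurve

/-! ### Local arguments on schemes -/

lemma hom_ext_of_local {T S : Scheme.{u}} {f g : T ⟶ S}
    (h : ∀ x : T, ∃ V : T.Opens, x ∈ V ∧ V.ι ≫ f = V.ι ≫ g) : f = g := by
  choose V hV h using h
  refine (T.openCoverOfIsOpenCover V ?_).hom_ext _ _ h
  exact (TopologicalSpace.Opens.ext (Set.eq_univ_of_forall fun x => by
    simpa using ⟨x, hV x⟩) : ⨆ i, V i = ⊤)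

lemma section_ext_of_local {T : Scheme.{u}} {a b : Γ(T, ⊤)}
    (h : ∀ x : T, ∃ V : T.Opens, x ∈ V ∧ V.ι.appTop a = V.ι.appTop b) : a = b := by
  choose V hV h using h
  refine T.sheaf.eq_of_locally_eq' V ⊤ (fun i => homOfLE le_top) ?_ a b fun i => ?_
  · intro x _
    simpa using ⟨x, hV x⟩
  · have e : T.presheaf.map (homOfLE (le_top : V i ≤ ⊤)).op = (V i).ι.appTop ≫ (V i).topIso.hom := by
      rw [Scheme.Opens.ι_appTop, Scheme.Opens.topIso_hom]
      exact T.presheaf.map_comp (homOfLE _).op (eqToHom _).op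
    change T.presheaf.map (homOfLE (le_top : V i ≤ ⊤)).op a =
      T.presheaf.map (homOfLE (le_top : V i ≤ ⊤)).op b
    rw [e, CommRingCat.comp_apply, CommRingCat.comp_apply, h i]

lemma section_ext_of_germ {T : Scheme.{u}} {a b : Γ(T, ⊤)}
    (h : ∀ x : T, T.presheaf.germ ⊤ x trivial a = T.presheaf.germ ⊤ x trivial b) : a = b :=
  TopCat.Presheaf.section_ext T.sheaf _ _ _ fun x _ => h x

/-- The pullback of a vector of global functions. -/
def pb {ι : Type*} {T T' : Scheme.{u}} (t : T' ⟶ T) (a : ι → Γ(T, ⊤)) : ι → Γ(T', ⊤) :=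
  fun r => t.appTop (a r)

@[simp] lemma pb_apply {ι : Type*} {T T' : Scheme.{u}} (t : T' ⟶ T) (a : ι → Γ(T, ⊤)) (r : ι) :
    pb t a r = t.appTop (a r) := rfl

@[simp] lemma pb_id {ι : Type*} {T : Scheme.{u}} (a : ι → Γ(T, ⊤)) : pb (𝟙 T) a = a := by
  funext r; simp

lemma pb_comp {ι : Type*} {T T' T'' : Scheme.{u}} (t : T' ⟶ T) (t' : T'' ⟶ T')
    (a : ι → Γ(T, ⊤)) : pb (t' ≫ t) a = pb t' (pb t a) := by
  funext r; simp only [pb_apply, Scheme.Hom.comp_appTop, CommRingCat.comp_apply]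

/-! ### The charts of the projective line -/

/-- The homogeneous coordinate ring `ℤ[X_0, X_1]` of the projective line. -/
abbrev coordRing : Type u := MvPolynomial (Fin 2) (ULift.{u} ℤ)

/-- The grading of `ℤ[X_0, X_1]` by the total degree. -/
abbrev grading : ℕ → Submodule (ULift.{u} ℤ) coordRing.{u} :=
  MvPolynomial.homogeneousSubmodule (Fin 2) (ULift.{u} ℤ)

lemma X_mem_grading (i : Fin 2) : (MvPolynomial.X i : coordRing.{u}) ∈ grading.{u} 1 :=
  MvPolynomial.isHomogeneous_X _ _

/-- The coordinate ring of the chart `X_i ≠ 0`: the elements of degree zero in the localization of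
`ℤ[X_0, X_1]` at `X_i`. -/
abbrev chartRing (i : Fin 2) : Type u :=
  HomogeneousLocalization.Away grading.{u} (MvPolynomial.X i : coordRing.{u})

/-- The function `X_k / X_i` on the chart `X_i ≠ 0`. -/
def chartFun (i k : Fin 2) : chartRing.{u} i :=
  HomogeneousLocalization.Away.mk grading.{u} (X_mem_grading i) 1 (MvPolynomial.X k)
    (by simpa using X_mem_grading k)

/-- The open immersion of the chart `X_i ≠ 0`. -/
def chartι (i : Fin 2) : Spec (CommRingCat.of (chartRing.{u} i)) ⟶ P1.{u} :=
  Proj.awayι grading.{u} (MvPolynomial.X i) (X_mem_grading i) one_pos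

instance (i : Fin 2) : IsOpenImmersion (chartι.{u} i) := by
  unfold chartι P1; infer_instance

/-- The open subset `X_i ≠ 0`. -/
def chartOpen (i : Fin 2) : P1.{u}.Opens := Proj.basicOpen grading.{u} (MvPolynomial.X i)

lemma opensRange_chartι (i : Fin 2) : (chartι.{u} i).opensRange = chartOpen i :=
  Proj.opensRange_awayι _ _ _ _

lemma isHomogeneous_eval₂ {R B : Type*} [CommRing R] [CommRing B] (f : R →+* B)
    (r : B) (g : Fin 2 → B) {n : ℕ} {p : MvPolynomial (Fin 2) R} (hp : p.IsHomogeneous n) :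
    MvPolynomial.eval₂ f (fun k => r * g k) p = r ^ n * MvPolynomial.eval₂ f g p := by
  rw [MvPolynomial.eval₂_eq, MvPolynomial.eval₂_eq, Finset.mul_sum]
  refine Finset.sum_congr rfl fun d hd => ?_
  have : d.degree = n := by
    have := hp (MvPolynomial.mem_support_iff.mp hd)
    rw [Finsupp.degree_eq_weight_one]
    exact this
  rw [← this, Finsupp.degree_apply]
  simp only [mul_pow, Finset.prod_mul_distrib, Finset.prod_pow_eq_pow_sum]
  ring

/-- The coordinate ring of the chart `X_i ≠ 0` is generated by the functions `X_k / X_i`: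
dehomogenizing a numerator `p` writes a fraction `p / X_i ^ n` as a polynomial in them. -/
lemma chartRing_hom_ext {B : Type u} [CommRing B] {i : Fin 2} {φ ψ : chartRing.{u} i →+* B}
    (h : ∀ k, φ (chartFun i k) = ψ (chartFun i k)) : φ = ψ := by
  have key : ∀ x : chartRing.{u} i, ∃ p : coordRing.{u},
      x = MvPolynomial.eval₂ ((algebraMap ℤ _).comp ULift.ringEquiv.toRingHom) (chartFun i) p := by
    intro x
    obtain ⟨n, p, hp, rfl⟩ := HomogeneousLocalization.Away.mk_surjective grading.{u}
      (X_mem_grading i) x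
    refine ⟨p, ?_⟩
    apply HomogeneousLocalization.val_injective
    rw [HomogeneousLocalization.Away.val_mk]
    have e1 : (MvPolynomial.eval₂ ((algebraMap ℤ (chartRing.{u} i)).comp
        ULift.ringEquiv.toRingHom) (chartFun i) p).val =
        MvPolynomial.eval₂ (algebraMap (ULift.{u} ℤ) (Localization.Away
          (MvPolynomial.X i : coordRing.{u})))
          (fun k => (chartFun i k).val) p := by
      have := MvPolynomial.hom_eval₂ p ((algebraMap ℤ (chartRing.{u} i)).comp
        ULift.ringEquiv.toRingHom) (algebraMap (chartRing.{u} i) (Localization.Away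
          (MvPolynomial.X i : coordRing.{u}))) (chartFun i)
      simp only [HomogeneousLocalization.algebraMap_apply] at this
      rw [this]
      congr 1
      have : ∀ f g : ULift.{u} ℤ →+* (Localization.Away
          (MvPolynomial.X i : coordRing.{u})), f = g := by
        intro f g
        have : f.comp ULift.ringEquiv.symm.toRingHom = g.comp ULift.ringEquiv.symm.toRingHom :=
          Subsingleton.elim _ _
        ext x
        exact DFunLike.congr_fun this x.down
      exact this _ _
    rw [e1]
    have hn : p.IsHomogeneous n := by simpa using hp
    have e2 := isHomogeneous_eval₂ (algebraMap (ULift.{u} ℤ) (Localization.Away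
          (MvPolynomial.X i : coordRing.{u}))) (algebraMap coordRing.{u} _ (MvPolynomial.X i))
          (fun k => (chartFun i k).val) hn
    have e3 : ∀ k, algebraMap coordRing.{u} (Localization.Away
          (MvPolynomial.X i : coordRing.{u})) (MvPolynomial.X i) * (chartFun i k).val =
          algebraMap coordRing.{u} _ (MvPolynomial.X k) := by
      intro k
      rw [chartFun, HomogeneousLocalization.Away.val_mk, Localization.mk_eq_mk']
      simp only [pow_one]
      exact IsLocalization.mk'_spec' _ (MvPolynomial.X k : coordRing.{u})
        (⟨MvPolynomial.X i, 1, by simp⟩ : Submonoid.powers (MvPolynomial.X i : coordRing.{u}))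
    simp only [e3] at e2
    have e4 : MvPolynomial.eval₂ (algebraMap (ULift.{u} ℤ) (Localization.Away
          (MvPolynomial.X i : coordRing.{u})))
          (fun k => algebraMap _ _ (MvPolynomial.X k : coordRing.{u})) p = algebraMap _ _ p := by
      have := MvPolynomial.hom_eval₂ p MvPolynomial.C (algebraMap coordRing.{u} (Localization.Away
          (MvPolynomial.X i : coordRing.{u}))) MvPolynomial.X
      rw [MvPolynomial.eval₂_eta] at this
      rw [this]; rfl
    rw [e4] at e2
    rw [Localization.mk_eq_mk', IsLocalization.mk'_eq_iff_eq_mul, mul_comm, e2, map_pow]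
  ext x
  obtain ⟨p, rfl⟩ := key x
  rw [MvPolynomial.hom_eval₂, MvPolynomial.hom_eval₂]
  congr 1
  · rw [← RingHom.comp_assoc, ← RingHom.comp_assoc]
    congr 1
    exact Subsingleton.elim _ _
  · funext k; exact h k

/-- The ring homomorphism that sends `X_k` to `b_k`, on the ring where `X_i` is inverted. -/
def chartLift {B : Type u} [CommRing B] {i : Fin 2} (b : Fin 2 → B) (h : IsUnit (b i)) :
    Localization.Away (MvPolynomial.X i : coordRing.{u}) →+* B :=
  IsLocalization.Away.lift (MvPolynomial.X i : coordRing.{u})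
    (g := MvPolynomial.eval₂Hom ((Int.castRingHom B).comp ULift.ringEquiv.toRingHom) b)
    (by simpa using h)

/-- The ring homomorphism `X_k / X_i ↦ b_k / b_i`. -/
def chartEval {B : Type u} [CommRing B] {i : Fin 2} (b : Fin 2 → B) (h : IsUnit (b i)) :
    chartRing.{u} i →+* B :=
  (chartLift b h).comp (algebraMap _ _)

lemma chartEval_chartFun {B : Type u} [CommRing B] {i : Fin 2} (b : Fin 2 → B) (h : IsUnit (b i))
    (k : Fin 2) : b i * chartEval b h (chartFun i k) = b k := by
  have : algebraMap coordRing.{u} (Localization.Away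
          (MvPolynomial.X i : coordRing.{u})) (MvPolynomial.X i) * (chartFun i k).val =
          algebraMap coordRing.{u} _ (MvPolynomial.X k) := by
      rw [chartFun, HomogeneousLocalization.Away.val_mk, Localization.mk_eq_mk']
      simp only [pow_one]
      exact IsLocalization.mk'_spec' _ (MvPolynomial.X k : coordRing.{u})
        (⟨MvPolynomial.X i, 1, by simp⟩ : Submonoid.powers (MvPolynomial.X i : coordRing.{u}))
  have := congrArg (IsLocalization.Away.lift (S := Localization.Away
    (MvPolynomial.X i : coordRing.{u})) (MvPolynomial.X i : coordRing.{u})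
    (g := MvPolynomial.eval₂Hom ((Int.castRingHom B).comp ULift.ringEquiv.toRingHom) b)
    (by simpa using h)) this
  rw [map_mul, IsLocalization.Away.lift_eq, IsLocalization.Away.lift_eq] at this
  simpa [chartEval, chartLift] using this

lemma toSpecΓ_SpecMap_injective {T : Scheme.{u}} {R : CommRingCat.{u}} {φ ψ : R ⟶ Γ(T, ⊤)}
    (h : T.toSpecΓ ≫ Spec.map φ = T.toSpecΓ ≫ Spec.map ψ) : φ = ψ := by
  exact (ΓSpec.adjunction.homEquiv T (Opposite.op R)).injective h |> Quiver.Hom.op_inj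

lemma exists_toSpecΓ_SpecMap {T : Scheme.{u}} {R : CommRingCat.{u}} (f : T ⟶ Spec R) :
    ∃ φ : R ⟶ Γ(T, ⊤), f = T.toSpecΓ ≫ Spec.map φ := by
  refine ⟨(Scheme.ΓSpecIso R).inv ≫ f.appTop, ?_⟩
  rw [Spec.map_comp, ← Scheme.toSpecΓ_naturality_assoc, toSpecΓ_SpecMap_ΓSpecIso_inv]
  simp

/-! ### Homogeneous coordinates -/

@[simp] lemma coordHom_X {T : Scheme.{u}} (a : Fin 2 → Γ(T, ⊤)) (i : Fin 2) :
    coordHom a (MvPolynomial.X i) = a i := by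
  simp [coordHom]

lemma exists_mem_basicOpen {T : Scheme.{u}} {ι : Type*} {a : ι → Γ(T, ⊤)}
    (h : Ideal.span (Set.range a) = ⊤) (x : T) : ∃ i, x ∈ T.basicOpen (a i) := by
  by_contra! hx
  have : Ideal.span (Set.range a) ≤ Ideal.comap (T.presheaf.germ ⊤ x trivial).hom
      (IsLocalRing.maximalIdeal _) := by
    rw [Ideal.span_le]
    rintro _ ⟨i, rfl⟩
    have := hx i
    rw [Scheme.mem_basicOpen_top] at this
    simpa using this
  rw [h, top_le_iff, Ideal.comap_eq_top_iff] at this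
  exact (IsLocalRing.maximalIdeal.isMaximal _).ne_top this

lemma span_pb {ι : Type*} {T T' : Scheme.{u}} (t : T' ⟶ T) {a : ι → Γ(T, ⊤)}
    (h : Ideal.span (Set.range a) = ⊤) : Ideal.span (Set.range (pb t a)) = ⊤ := by
  have := congrArg (Ideal.map t.appTop.hom) h
  rw [Ideal.map_span, Ideal.map_top, ← Set.range_comp] at this
  exact this

lemma isUnit_appTop_iff {T T' : Scheme.{u}} (t : T' ⟶ T) (a : Γ(T, ⊤)) :
    IsUnit (t.appTop a) ↔ ∀ x, t x ∈ T.basicOpen a := by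
  have h1 : ∀ x, t x ∈ T.basicOpen a ↔ x ∈ T'.basicOpen (t.appTop a) := fun x => by
    rw [← Scheme.preimage_basicOpen_top]; rfl
  simp only [h1]
  constructor
  · intro h x
    rw [Scheme.mem_basicOpen_top]
    exact h.map _
  · intro h
    refine T'.toRingedSpace.isUnit_of_isUnit_germ ⊤ _ fun x hx => ?_
    have := h x
    rwa [Scheme.mem_basicOpen_top] at this

lemma isUnit_ι_basicOpen {T : Scheme.{u}} (a : Γ(T, ⊤)) :
    IsUnit ((T.basicOpen a).ι.appTop a) := by
  rw [isUnit_appTop_iff]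
  exact fun x => x.2

/-- The restriction of the morphism `(a_0 : a_1)` to the open subscheme where `a_i` is invertible,
expressed by the localization of the ring of global functions at `a_i`. In this form it can be
compared with a homomorphism on the coordinate ring of the chart `X_i ≠ 0`. -/
lemma toBasicOpenOfGlobalSections_ι {T : Scheme.{u}} (a : Fin 2 → Γ(T, ⊤)) (i : Fin 2) :
    ∃ κ : (T.basicOpen (coordHom a (MvPolynomial.X i))).toScheme ⟶
      Spec (.of (Localization.Away (coordHom a (MvPolynomial.X i)))),
      κ ≫ Spec.map (CommRingCat.ofHom (algebraMap Γ(T, ⊤) _)) =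
        (T.basicOpen (coordHom a (MvPolynomial.X i))).ι ≫ T.toSpecΓ ∧
      Proj.toBasicOpenOfGlobalSections grading.{u} (coordHom a) rfl one_pos (X_mem_grading i) ≫
        (Proj.basicOpen grading.{u} (MvPolynomial.X i)).ι =
      κ ≫ Spec.map (CommRingCat.ofHom ((IsLocalization.map
        (M := .powers (MvPolynomial.X i : coordRing.{u}))
        (S := Localization.Away (MvPolynomial.X i : coordRing.{u}))
        (T := .powers (coordHom a (MvPolynomial.X i)))
        (Localization.Away (coordHom a (MvPolynomial.X i))) (coordHom a)
        (by rw [← Submonoid.map_le_iff_le_comap, Submonoid.map_powers])).comp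
          (algebraMap (chartRing.{u} i) _))) ≫ chartι i := by
  refine ⟨(T.isoOfEq (T.toSpecΓ_preimage_basicOpen (coordHom a (MvPolynomial.X i)))).inv ≫
      T.toSpecΓ ∣_ PrimeSpectrum.basicOpen (coordHom a (MvPolynomial.X i)) ≫
        (basicOpenIsoSpecAway (coordHom a (MvPolynomial.X i))).hom, ?_, ?_⟩
  · simp only [Category.assoc, basicOpenIsoSpecAway_hom_SpecMap]
    exact (congrArg (_ ≫ ·) (morphismRestrict_ι _ _)).trans (Scheme.isoOfEq_inv_ι_assoc _ _ _)
  · rw [Proj.toBasicOpenOfGlobalSections]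
    simp only [Category.assoc, Proj.basicOpenIsoSpec_inv_ι]
    rfl

/-- On a scheme over which `a_i` is a unit, the point `(a_0 : a_1)` is the point of the affine
chart `X_i ≠ 0` with coordinate functions `a_k / a_i`. -/
lemma comp_homogPoint_of_isUnit {T T' : Scheme.{u}} (g : T' ⟶ T) (a : Fin 2 → Γ(T, ⊤))
    (ha : Ideal.span (Set.range a) = ⊤) {i : Fin 2} (h : IsUnit (pb g a i)) :
    g ≫ homogPoint a ha =
      T'.toSpecΓ ≫ Spec.map (CommRingCat.ofHom (chartEval (pb g a) h)) ≫ chartι i := by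
  have hx : coordHom a (MvPolynomial.X i) = a i := coordHom_X a i
  have hU : Set.range g ⊆ Set.range (T.basicOpen (coordHom a (MvPolynomial.X i))).ι := by
    rw [Scheme.Opens.range_ι, hx]
    rintro _ ⟨y, rfl⟩
    exact (isUnit_appTop_iff g (a i)).mp h y
  obtain ⟨g', rfl⟩ : ∃ g', g = g' ≫ (T.basicOpen (coordHom a (MvPolynomial.X i))).ι :=
    ⟨_, (IsOpenImmersion.lift_fac (T.basicOpen (coordHom a (MvPolynomial.X i))).ι g hU).symm⟩
  have key : (T.basicOpen (coordHom a (MvPolynomial.X i))).ι ≫ homogPoint a ha =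
      Proj.toBasicOpenOfGlobalSections grading.{u} (coordHom a) rfl one_pos (X_mem_grading i) ≫
        (Proj.basicOpen grading.{u} (MvPolynomial.X i)).ι := by
    rw [← Proj.fromOfGlobalSections_resLE grading.{u} (coordHom a)
      (map_irrelevant_coordHom a ha) one_pos (X_mem_grading i), Scheme.Hom.resLE_comp_ι]
    rfl
  obtain ⟨κ, h1, h2⟩ := toBasicOpenOfGlobalSections_ι a i
  have hu : IsUnit ((CommRingCat.Hom.hom
      (g' ≫ (T.basicOpen (coordHom a (MvPolynomial.X i))).ι).appTop)
        (coordHom a (MvPolynomial.X i))) := by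
    have h' := h
    rw [pb_apply, ← hx] at h'
    exact h'
  have e2 : g' ≫ κ =
      T'.toSpecΓ ≫ Spec.map (CommRingCat.ofHom
        (IsLocalization.Away.lift (S := Localization.Away (coordHom a (MvPolynomial.X i)))
          (coordHom a (MvPolynomial.X i)) hu)) := by
    rw [← cancel_mono (Spec.map (CommRingCat.ofHom (algebraMap Γ(T, ⊤)
      (Localization.Away (coordHom a (MvPolynomial.X i))))))]
    simp only [Category.assoc, h1]
    rw [← Spec.map_comp, ← CommRingCat.ofHom_comp, IsLocalization.Away.lift_comp]
    rw [← Category.assoc, Scheme.toSpecΓ_naturality]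
    rfl
  rw [Category.assoc, key, h2, reassoc_of% e2, ← Spec.map_comp_assoc]
  congr 2
  rw [← CommRingCat.ofHom_comp]
  congr 1
  refine congrArg CommRingCat.ofHom (RingHom.ext fun z => ?_)
  refine DFunLike.congr_fun (f := (IsLocalization.Away.lift (coordHom a (MvPolynomial.X i)) hu).comp
    (IsLocalization.map (M := .powers (MvPolynomial.X i : coordRing.{u}))
        (S := Localization.Away (MvPolynomial.X i : coordRing.{u}))
        (T := .powers (coordHom a (MvPolynomial.X i)))
        (Localization.Away (coordHom a (MvPolynomial.X i))) (coordHom a)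
        (by rw [← Submonoid.map_le_iff_le_comap, Submonoid.map_powers]))) (g := chartLift _ h)
        ?_ z.val
  rw [chartLift]
  apply IsLocalization.ringHom_ext (Submonoid.powers (MvPolynomial.X i : coordRing.{u}))
  rw [RingHom.comp_assoc, IsLocalization.map_comp, ← RingHom.comp_assoc,
    IsLocalization.Away.lift_comp, IsLocalization.Away.lift_comp]
  apply MvPolynomial.ringHom_ext
  · intro r
    simp [coordHom]
  · intro k
    simp [coordHom]

lemma comp_homogPoint {T T' : Scheme.{u}} (t : T' ⟶ T) (a : Fin 2 → Γ(T, ⊤))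
    (ha : Ideal.span (Set.range a) = ⊤) :
    t ≫ homogPoint a ha = homogPoint (pb t a) (span_pb t ha) := by
  refine hom_ext_of_local fun x => ?_
  obtain ⟨i, hi⟩ := exists_mem_basicOpen (span_pb t ha) x
  refine ⟨_, hi, ?_⟩
  have h := isUnit_ι_basicOpen (pb t a i)
  rw [comp_homogPoint_of_isUnit (i := i) _ _ _ h, ← Category.assoc, comp_homogPoint_of_isUnit
    (i := i) _ _ _ (by rw [pb_comp]; exact h)]
  congr! 5

lemma homogPoint_preimage {T : Scheme.{u}} (a : Fin 2 → Γ(T, ⊤))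
    (ha : Ideal.span (Set.range a) = ⊤) (i : Fin 2) :
    homogPoint a ha ⁻¹ᵁ chartOpen i = T.basicOpen (a i) := by
  have e := Proj.fromOfGlobalSections_preimage_basicOpen grading.{u} (coordHom a)
    (map_irrelevant_coordHom a ha) one_pos (X_mem_grading i)
  rw [coordHom_X] at e
  exact e

lemma chartEval_eq_of {B : Type u} [CommRing B] {i : Fin 2} {a b : Fin 2 → B}
    (ha : IsUnit (a i)) (hb : IsUnit (b i)) (h : a 0 * b 1 = a 1 * b 0) :
    chartEval a ha = chartEval b hb := by
  apply chartRing_hom_ext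
  intro k
  have h1 := chartEval_chartFun a ha k
  have h2 := chartEval_chartFun b hb k
  apply ha.mul_left_cancel
  apply hb.mul_left_cancel
  rw [h1, mul_left_comm, h2]
  fin_cases i <;> fin_cases k <;> simp <;>
    first | linear_combination h | linear_combination -h | ring1

lemma eq_of_chartEval_eq {B : Type u} [CommRing B] {i : Fin 2} {a b : Fin 2 → B}
    (ha : IsUnit (a i)) (hb : IsUnit (b i))
    (h : chartEval a ha = chartEval b hb) : a 0 * b 1 = a 1 * b 0 := by
  have h1 := fun k => chartEval_chartFun a ha k
  have h2 := fun k => chartEval_chartFun b hb k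
  rw [← h1 0, ← h1 1, ← h2 0, ← h2 1, h]
  ring

/-- Two pairs of homogeneous coordinates define the same point if and only if their determinant
vanishes. -/
lemma homogPoint_eq_iff {T : Scheme.{u}} {a b : Fin 2 → Γ(T, ⊤)}
    (ha : Ideal.span (Set.range a) = ⊤) (hb : Ideal.span (Set.range b) = ⊤) :
    homogPoint a ha = homogPoint b hb ↔ a 0 * b 1 = a 1 * b 0 := by
  constructor
  · intro h
    refine section_ext_of_local fun x => ?_
    obtain ⟨i, hi⟩ := exists_mem_basicOpen ha x
    refine ⟨_, hi, ?_⟩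
    have hab : T.basicOpen (a i) = T.basicOpen (b i) := by
      rw [← homogPoint_preimage a ha, h, homogPoint_preimage]
    have h1 := isUnit_ι_basicOpen (a i)
    have h2 : IsUnit ((T.basicOpen (a i)).ι.appTop (b i)) := by
      rw [hab]; exact isUnit_ι_basicOpen (b i)
    have := congrArg ((T.basicOpen (a i)).ι ≫ ·) h
    rw [comp_homogPoint_of_isUnit (i := i) _ _ _ h1, comp_homogPoint_of_isUnit (i := i) _ _ _ h2,
      ← Category.assoc, ← Category.assoc, cancel_mono] at this
    have := CommRingCat.hom_ext_iff.mp (toSpecΓ_SpecMap_injective this)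
    have := eq_of_chartEval_eq h1 h2 this
    simpa using this
  · intro h
    refine hom_ext_of_local fun x => ?_
    obtain ⟨i, hi⟩ := exists_mem_basicOpen ha x
    refine ⟨T.basicOpen (a i) ⊓ T.basicOpen (b i), ⟨hi, ?_⟩, ?_⟩
    · obtain ⟨j, hj⟩ := exists_mem_basicOpen hb x
      have hm : x ∈ T.basicOpen (a i * b j) := by
        rw [Scheme.basicOpen_mul]; exact ⟨hi, hj⟩
      have : a i * b j = a j * b i := by
        fin_cases i <;> fin_cases j <;> simp <;> first | linear_combination h | linear_combination -h
      rw [this, Scheme.basicOpen_mul] at hm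
      exact hm.2
    · set V := T.basicOpen (a i) ⊓ T.basicOpen (b i)
      have h1 : IsUnit (V.ι.appTop (a i)) := (isUnit_appTop_iff _ _).mpr fun x => x.2.1
      have h2 : IsUnit (V.ι.appTop (b i)) := (isUnit_appTop_iff _ _).mpr fun x => x.2.2
      rw [comp_homogPoint_of_isUnit (i := i) _ _ _ h1, comp_homogPoint_of_isUnit (i := i) _ _ _ h2,
        chartEval_eq_of (b := pb V.ι b) h1 h2]
      simpa using congrArg V.ι.appTop h

lemma HasCoords.comp {T T' : Scheme.{u}} {f : T ⟶ P1.{u}} {a : Fin 2 → Γ(T, ⊤)}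
    (h : HasCoords f a) (t : T' ⟶ T) : HasCoords (t ≫ f) (pb t a) := by
  obtain ⟨ha, rfl⟩ := h
  exact ⟨_, comp_homogPoint t a ha⟩

lemma HasCoords.eq_iff {T : Scheme.{u}} {f g : T ⟶ P1.{u}} {a b : Fin 2 → Γ(T, ⊤)}
    (h : HasCoords f a) (h' : HasCoords g b) : f = g ↔ a 0 * b 1 = a 1 * b 0 := by
  obtain ⟨ha, rfl⟩ := h
  obtain ⟨hb, rfl⟩ := h'
  exact homogPoint_eq_iff ha hb

lemma HasCoords.preimage {T : Scheme.{u}} {f : T ⟶ P1.{u}} {a : Fin 2 → Γ(T, ⊤)}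
    (h : HasCoords f a) (i : Fin 2) : f ⁻¹ᵁ chartOpen i = T.basicOpen (a i) := by
  obtain ⟨ha, rfl⟩ := h
  exact homogPoint_preimage a ha i

lemma hasCoords_homogPoint {T : Scheme.{u}} (a : Fin 2 → Γ(T, ⊤))
    (ha : Ideal.span (Set.range a) = ⊤) : HasCoords (homogPoint a ha) a := ⟨ha, rfl⟩

lemma HasCoords.of_eq {T : Scheme.{u}} {f : T ⟶ P1.{u}} {a b : Fin 2 → Γ(T, ⊤)}
    (h : HasCoords f a) (hb : Ideal.span (Set.range b) = ⊤) (hab : a 0 * b 1 = a 1 * b 0) :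
    HasCoords f b :=
  ⟨hb, (h.eq_iff (hasCoords_homogPoint b hb)).mpr hab⟩

/-- A morphism into the chart `X_i ≠ 0` has coordinates with `i`-th coordinate `1`. -/
lemma exists_hasCoords_of_chart {T : Scheme.{u}} (f : T ⟶ P1.{u}) (i : Fin 2)
    (h : f ⁻¹ᵁ chartOpen i = ⊤) : ∃ a, a i = 1 ∧ HasCoords f a := by
  have hr : Set.range f ⊆ Set.range (chartι.{u} i) := by
    rintro _ ⟨x, rfl⟩
    have : x ∈ f ⁻¹ᵁ chartOpen i := h ▸ trivial
    rw [← opensRange_chartι] at this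
    exact this
  obtain ⟨φ, hφ⟩ := exists_toSpecΓ_SpecMap (IsOpenImmersion.lift (chartι i) f hr)
  have hf : f = T.toSpecΓ ≫ Spec.map φ ≫ chartι i := by
    rw [← Category.assoc, ← hφ, IsOpenImmersion.lift_fac]
  let a : Fin 2 → Γ(T, ⊤) := fun k => φ.hom (chartFun i k)
  have hai : a i = 1 := by
    have : chartFun.{u} i i = 1 := by
      apply HomogeneousLocalization.val_injective
      rw [chartFun, HomogeneousLocalization.Away.val_mk, HomogeneousLocalization.val_one]
      simp
    simp [a, this]
  have ha : Ideal.span (Set.range a) = ⊤ :=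
    Ideal.eq_top_of_isUnit_mem _ (Ideal.subset_span ⟨i, rfl⟩) (hai ▸ isUnit_one)
  refine ⟨a, hai, ha, ?_⟩
  have hu : IsUnit (pb (𝟙 T) a i) := by rw [pb_id, hai]; exact isUnit_one
  rw [← Category.id_comp (homogPoint a ha), comp_homogPoint_of_isUnit (𝟙 T) a ha hu, hf]
  congr! 3
  ext1
  apply chartRing_hom_ext
  intro k
  have := chartEval_chartFun _ hu k
  rw [congrFun (pb_id a) i, congrFun (pb_id a) k, hai, one_mul] at this
  rw [CommRingCat.hom_ofHom]
  exact this.symm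

lemma iSup_chartOpen : chartOpen.{u} 0 ⊔ chartOpen.{u} 1 = ⊤ := by
  have := Proj.iSup_basicOpen_eq_top' grading.{u}
    (fun i : Fin 2 => (MvPolynomial.X i : coordRing.{u})) (fun i => ⟨1, X_mem_grading i⟩) (by
      rw [eq_top_iff]
      rintro p -
      induction p using MvPolynomial.induction_on with
      | C a =>
        exact Subalgebra.algebraMap_mem _
          (⟨MvPolynomial.C a, MvPolynomial.isHomogeneous_C _ _⟩ : grading.{u} 0)
      | add p q hp hq => exact add_mem hp hq
      | mul_X p i hp => exact mul_mem hp (Algebra.subset_adjoin ⟨i, rfl⟩))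
  refine Eq.trans (le_antisymm ?_ ?_) this
  · exact sup_le (le_iSup (fun i : Fin 2 => Proj.basicOpen grading.{u} (MvPolynomial.X i)) 0)
      (le_iSup (fun i : Fin 2 => Proj.basicOpen grading.{u} (MvPolynomial.X i)) 1)
  · refine iSup_le fun i => ?_
    fin_cases i
    exacts [le_sup_left, le_sup_right]

/-- Every point of the projective line with values in a scheme has homogeneous coordinates locally.
They need not exist globally. -/
lemma exists_local_coords {T : Scheme.{u}} (f : T ⟶ P1.{u}) (x : T) :
    ∃ (V : T.Opens) (a : Fin 2 → Γ(V, ⊤)), x ∈ V ∧ HasCoords (V.ι ≫ f) a := by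
  have hx : f x ∈ chartOpen.{u} 0 ⊔ chartOpen.{u} 1 := iSup_chartOpen ▸ trivial
  have : ∃ i, f x ∈ chartOpen.{u} i := by
    rcases hx with h | h
    exacts [⟨0, h⟩, ⟨1, h⟩]
  obtain ⟨i, hi⟩ := this
  obtain ⟨a, -, ha⟩ := exists_hasCoords_of_chart ((f ⁻¹ᵁ chartOpen i).ι ≫ f) i (by
    rw [Scheme.Hom.comp_preimage]; simp)
  exact ⟨_, a, hi, ha⟩

/-! ### Gluing morphisms and closed subschemes -/

/-- A morphism that is characterised by a natural property, and that exists locally, exists. -/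
lemma exists_hom_of_local {T S : Scheme.{u}}
    (Q : ∀ ⦃T' : Scheme.{u}⦄, (T' ⟶ T) → (T' ⟶ S) → Prop)
    (nat : ∀ ⦃T' T'' : Scheme.{u}⦄ (h : T'' ⟶ T') (g : T' ⟶ T) (f : T' ⟶ S),
      Q g f → Q (h ≫ g) (h ≫ f))
    (uniq : ∀ ⦃T' : Scheme.{u}⦄ (g : T' ⟶ T) (f f' : T' ⟶ S), Q g f → Q g f' → f = f')
    (ex : ∀ x : T, ∃ (V : T.Opens) (f : (V : Scheme.{u}) ⟶ S), x ∈ V ∧ Q V.ι f) :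
    ∃ f : T ⟶ S, ∀ x : T, ∃ V : T.Opens, x ∈ V ∧ Q V.ι (V.ι ≫ f) := by
  choose V f hV hf using ex
  have hc : TopologicalSpace.IsOpenCover V :=
    (TopologicalSpace.Opens.ext (Set.eq_univ_of_forall fun x => by
      simpa using ⟨x, hV x⟩) : ⨆ i, V i = ⊤)
  let 𝒰 := T.openCoverOfIsOpenCover V hc
  have hcomp : ∀ x y : T, pullback.fst (𝒰.f x) (𝒰.f y) ≫ f x =
      pullback.snd (𝒰.f x) (𝒰.f y) ≫ f y := fun x y =>
    uniq (pullback.fst (𝒰.f x) (𝒰.f y) ≫ (V x).ι) _ _ (nat _ _ _ (hf x)) (by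
      have : pullback.fst (𝒰.f x) (𝒰.f y) ≫ (V x).ι = pullback.snd (𝒰.f x) (𝒰.f y) ≫ (V y).ι :=
        pullback.condition
      rw [this]
      exact nat _ _ _ (hf y))
  refine ⟨𝒰.glueMorphisms f hcomp, fun x => ⟨V x, hV x, ?_⟩⟩
  have : (V x).ι ≫ 𝒰.glueMorphisms f hcomp = f x := 𝒰.ι_glueMorphisms f hcomp x
  rw [this]
  exact hf x

lemma le_preimage_restrict {T X : Scheme.{u}} (t : T ⟶ X) (U : X.Opens) :
    ⊤ ≤ ((t ⁻¹ᵁ U).ι ≫ t) ⁻¹ᵁ U := by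
  rw [Scheme.Hom.comp_preimage]
  intro z _
  exact z.2

lemma appLE_comp_appTop {T T' X : Scheme.{u}} (t : T ⟶ X) (g : T' ⟶ T) {U : X.Opens}
    (h : ⊤ ≤ t ⁻¹ᵁ U) :
    t.appLE U ⊤ h ≫ g.appTop =
      (g ≫ t).appLE U ⊤ (fun x _ => h (trivial : g x ∈ (⊤ : T.Opens))) := by
  exact (congrArg (t.appLE U ⊤ h ≫ ·) (Scheme.Hom.appLE_eq_app g (U := ⊤)).symm).trans
    (Scheme.Hom.appLE_comp_appLE g t U ⊤ ⊤ h le_rfl)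

lemma fromSpec_appLE {X : Scheme.{u}} {U : X.Opens} (hU : IsAffineOpen U)
    (h : ⊤ ≤ hU.fromSpec ⁻¹ᵁ U) :
    hU.fromSpec.appLE U ⊤ h = (Scheme.ΓSpecIso Γ(X, U)).inv := by
  rw [Scheme.Hom.appLE, hU.fromSpec_app_self, Category.assoc, ← Functor.map_comp]
  exact (congrArg (_ ≫ ·) ((Spec Γ(X, U)).presheaf.map_id _)).trans (Category.comp_id _)

lemma restrict_appLE_eq_zero_iff {T X : Scheme.{u}} (t : T ⟶ X) (U : X.Opens) (g : Γ(X, U)) :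
    ((t ⁻¹ᵁ U).ι ≫ t).appLE U ⊤ (le_preimage_restrict t U) g = 0 ↔ t.app U g = 0 := by
  have e : ((t ⁻¹ᵁ U).ι ≫ t).appLE U ⊤ (le_preimage_restrict t U) =
      t.app U ≫ T.presheaf.map (eqToHom (t ⁻¹ᵁ U).ι_image_top).op := by
    have h1 := Scheme.Hom.appLE_comp_appLE (t ⁻¹ᵁ U).ι t U (t ⁻¹ᵁ U) ⊤ le_rfl
      (by intro z _; exact z.2)
    rw [← h1, Scheme.Hom.appLE_eq_app]
    exact congrArg (t.app U ≫ ·) ((t ⁻¹ᵁ U).ι_appLE (t ⁻¹ᵁ U) ⊤ (by intro z _; exact z.2))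
  rw [e]
  have hi : Function.Injective (T.presheaf.map (eqToHom (t ⁻¹ᵁ U).ι_image_top).op) :=
    (ConcreteCategory.bijective_of_isIso _).1
  exact ⟨fun h => hi (h.trans (map_zero _).symm), fun h => (congrArg (CommRingCat.Hom.hom
    (T.presheaf.map (eqToHom (t ⁻¹ᵁ U).ι_image_top).op)) h).trans (RingHom.map_zero _)⟩

section ClosedGluing

variable {X : Scheme.{u}} (P : ∀ ⦃T : Scheme.{u}⦄, (T ⟶ X) → Prop)

/-- The functions on `U` that vanish on all `T`-valued points of `U` with the property `P`. -/
def vanishing (U : X.Opens) : Ideal Γ(X, U) where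
  carrier := {g | ∀ (T : Scheme.{u}) (t : T ⟶ X) (h : ⊤ ≤ t ⁻¹ᵁ U), P t → t.appLE U ⊤ h g = 0}
  add_mem' ha hb T t h hP := by rw [map_add, ha T t h hP, hb T t h hP, add_zero]
  zero_mem' T t h hP := map_zero _
  smul_mem' c a ha T t h hP := by rw [smul_eq_mul, map_mul, ha T t h hP, mul_zero]

/-- Over `U`, the property `P` is the vanishing of the function `g`. -/
def CutOutBy (U : X.Opens) (g : Γ(X, U)) : Prop :=
  ∀ (T : Scheme.{u}) (t : T ⟶ X) (h : ⊤ ≤ t ⁻¹ᵁ U), P t ↔ t.appLE U ⊤ h g = 0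

variable {P}

lemma CutOutBy.map {U V : X.Opens} {g : Γ(X, U)} (hg : CutOutBy P U g) (hVU : V ≤ U) :
    CutOutBy P V (X.presheaf.map (homOfLE hVU).op g) := by
  intro T t h
  rw [hg T t (h.trans fun x hx => hVU hx), ← CommRingCat.comp_apply, Scheme.Hom.map_appLE]

/-- On an affine open subset where `P` is the vanishing of one function `g`, the functions that
vanish on all points with the property `P` are the multiples of `g`: the universal point with this
property is the spectrum of the quotient by `g`. -/
lemma vanishing_eq_span {U : X.Opens} (hU : IsAffineOpen U) {g : Γ(X, U)} (hg : CutOutBy P U g) :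
    vanishing P U = Ideal.span {g} := by
  apply le_antisymm
  · intro f hf
    let t : Spec (.of (Γ(X, U) ⧸ Ideal.span {g})) ⟶ X :=
      Spec.map (CommRingCat.ofHom (Ideal.Quotient.mk (Ideal.span {g}))) ≫ hU.fromSpec
    have ht : ⊤ ≤ t ⁻¹ᵁ U := by
      rw [Scheme.Hom.comp_preimage, hU.fromSpec_preimage_self]; rfl
    have e : ∀ f, t.appLE U ⊤ ht f = (Scheme.ΓSpecIso _).inv (Ideal.Quotient.mk _ f) := by
      intro f
      have : t.appLE U ⊤ ht = CommRingCat.ofHom (Ideal.Quotient.mk (Ideal.span {g})) ≫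
          (Scheme.ΓSpecIso _).inv := by
        rw [Scheme.ΓSpecIso_inv_naturality, ← appLE_comp_appTop hU.fromSpec _
          hU.fromSpec_preimage_self.ge, fromSpec_appLE]
        rfl
      rw [this]; rfl
    have hinj : ∀ a, (Scheme.ΓSpecIso (.of (Γ(X, U) ⧸ Ideal.span {g}))).inv a = 0 → a = 0 := by
      intro a ha
      have := congrArg (Scheme.ΓSpecIso (.of (Γ(X, U) ⧸ Ideal.span {g}))).hom ha
      simpa using this
    have hP : P t := by
      rw [hg _ t ht, e, Ideal.Quotient.eq_zero_iff_mem.mpr (Ideal.mem_span_singleton_self g),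
        map_zero]
    have := hf _ t ht hP
    rw [e] at this
    exact Ideal.Quotient.eq_zero_iff_mem.mp (hinj _ this)
  · rw [Ideal.span_singleton_le_iff_mem]
    exact fun T t h hP => (hg T t h).mp hP

variable (nat : ∀ ⦃T T' : Scheme.{u}⦄ (g : T' ⟶ T) (t : T ⟶ X), P t → P (g ≫ t))
  (cut : ∀ x : X, ∃ (V : X.Opens) (g : Γ(X, V)), x ∈ V ∧ CutOutBy P V g)

include nat cut in
/-- The ideals of functions that vanish on all points with the property `P` are compatible with
localization, so they form a quasi-coherent ideal sheaf. -/
lemma vanishing_map_basicOpen {U : X.Opens} (hU : IsAffineOpen U) (f : Γ(X, U)) :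
    (vanishing P U).map (X.presheaf.map (homOfLE (X.basicOpen_le f)).op).hom =
      vanishing P (X.basicOpen f) := by
  apply le_antisymm
  · rw [Ideal.map_le_iff_le_comap]
    intro g hg T t h hP
    have := hg T t (h.trans fun x hx => X.basicOpen_le f hx) hP
    rw [← this]
    change (t.appLE _ ⊤ h) (X.presheaf.map _ g) = _
    rw [← CommRingCat.comp_apply, Scheme.Hom.map_appLE]
  · intro h hh
    -- the points of `U` have basic open neighbourhoods on which `P` is cut out by one function
    have h1 : ∀ x : U, ∃ (r : Γ(X, U)) (g : Γ(X, X.basicOpen r)),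
        x.1 ∈ X.basicOpen r ∧ CutOutBy P _ g := by
      intro x
      obtain ⟨V, g, hxV, hg⟩ := cut x
      obtain ⟨r, hr, hxr⟩ := hU.exists_basicOpen_le ⟨x.1, hxV⟩ x.2
      exact ⟨r, _, hxr, hg.map hr⟩
    choose r g hxr hg using h1
    obtain ⟨s, hs⟩ := hU.isCompact.elim_finite_subcover (fun x : U => (X.basicOpen (r x) : Set X))
      (fun x => (X.basicOpen (r x)).isOpen)
      (fun x hx => Set.mem_iUnion.mpr ⟨⟨x, hx⟩, hxr ⟨x, hx⟩⟩)
    have := hU.isLocalization_basicOpen f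
    obtain ⟨⟨h0, ⟨_, n, rfl⟩⟩, hn⟩ := IsLocalization.surj (Submonoid.powers f) h
    have hn' : X.presheaf.map (homOfLE (X.basicOpen_le f)).op h0 ∈ vanishing P (X.basicOpen f) := by
      change algebraMap Γ(X, U) Γ(X, X.basicOpen f) h0 ∈ _
      rw [← hn]
      exact Ideal.mul_mem_right _ _ hh
    -- after multiplication by a power of `f`, the function is a multiple of the local equation on
    -- each of the finitely many basic open sets of the cover
    have h2 : ∀ x : U, ∃ m : ℕ, ∀ m' ≥ m, X.presheaf.map (homOfLE (X.basicOpen_le (r x))).op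
        (f ^ m' * h0) ∈ Ideal.span {g x} := by
      intro x
      have hA : IsAffineOpen (X.basicOpen (r x)) := hU.basicOpen _
      set f' : Γ(X, X.basicOpen (r x)) := X.presheaf.map (homOfLE (X.basicOpen_le (r x))).op f
      set h' : Γ(X, X.basicOpen (r x)) := X.presheaf.map (homOfLE (X.basicOpen_le (r x))).op h0
      have hle : X.basicOpen f' ≤ X.basicOpen f := by
        rw [Scheme.basicOpen_res]; exact inf_le_right
      have hmem : X.presheaf.map (homOfLE (X.basicOpen_le f')).op h' ∈
          vanishing P (X.basicOpen f') := by
        intro T t hT hP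
        have := hn' T t (hT.trans fun y hy => hle hy) hP
        rw [← this]
        rw [← CommRingCat.comp_apply, ← CommRingCat.comp_apply, ← CommRingCat.comp_apply,
          Scheme.Hom.map_appLE, Scheme.Hom.map_appLE, Scheme.Hom.map_appLE]
      rw [vanishing_eq_span (hA.basicOpen f') ((hg x).map (X.basicOpen_le f'))] at hmem
      have := hA.isLocalization_basicOpen f'
      rw [show ({X.presheaf.map (homOfLE (X.basicOpen_le f')).op (g x)} : Set _) =
        (algebraMap Γ(X, X.basicOpen (r x)) Γ(X, X.basicOpen f')) '' {g x} from
          (Set.image_singleton).symm, ← Ideal.map_span] at hmem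
      have hmem' : algebraMap Γ(X, X.basicOpen (r x)) Γ(X, X.basicOpen f') h' ∈
        Ideal.map (algebraMap Γ(X, X.basicOpen (r x)) Γ(X, X.basicOpen f'))
          (Ideal.span {g x}) := hmem
      rw [IsLocalization.algebraMap_mem_map_algebraMap_iff (Submonoid.powers f')] at hmem'
      obtain ⟨_, ⟨m, rfl⟩, hm⟩ := hmem'
      refine ⟨m, fun m' hm' => ?_⟩
      rw [map_mul, map_pow, ← Nat.sub_add_cancel hm', pow_add, mul_assoc]
      exact Ideal.mul_mem_left _ _ hm
    choose m hm using h2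
    set M := s.sup m
    have hmem : f ^ M * h0 ∈ vanishing P U := by
      intro T t hT hP
      refine section_ext_of_local fun y => ?_
      obtain ⟨x, hx⟩ := Set.mem_iUnion.mp (hs (hT (trivial : y ∈ (⊤ : T.Opens))))
      obtain ⟨hxs, hx⟩ := Set.mem_iUnion.mp hx
      refine ⟨t ⁻¹ᵁ X.basicOpen (r x), hx, ?_⟩
      have hle : ⊤ ≤ ((t ⁻¹ᵁ X.basicOpen (r x)).ι ≫ t) ⁻¹ᵁ X.basicOpen (r x) := fun z _ => z.2
      have e := hm x M (Finset.le_sup hxs)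
      rw [← vanishing_eq_span (hU.basicOpen _) (hg x)] at e
      have := e _ ((t ⁻¹ᵁ X.basicOpen (r x)).ι ≫ t) hle (nat _ _ hP)
      rw [map_zero, ← this, ← CommRingCat.comp_apply, ← CommRingCat.comp_apply,
        Scheme.Hom.map_appLE, appLE_comp_appTop]
    have hfu : IsUnit (algebraMap Γ(X, U) Γ(X, X.basicOpen f) f) :=
      IsLocalization.Away.algebraMap_isUnit f
    have := Ideal.mem_map_of_mem (algebraMap Γ(X, U) Γ(X, X.basicOpen f)) hmem
    rw [map_mul, ← hn, ← mul_assoc, map_pow, mul_comm _ h, mul_assoc] at this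
    have hu : IsUnit ((algebraMap Γ(X, U) Γ(X, X.basicOpen f) f) ^ M *
      algebraMap Γ(X, U) Γ(X, X.basicOpen f) (f ^ n)) := by
      rw [map_pow]; exact (hfu.pow _).mul (hfu.pow _)
    have h3 := (Ideal.mul_unit_mem_iff_mem (x := h) _ hu).mp (by convert! this using 1)
    exact h3

include nat cut in
/-- A natural and Zariski-local property of `T`-valued points of `X` that locally on `X` is the
vanishing of a function is represented by a closed subscheme of `X`. -/
theorem exists_closedImmersion_of_local
    (loc : ∀ ⦃T : Scheme.{u}⦄ (t : T ⟶ X), (∀ x : T, ∃ V : T.Opens, x ∈ V ∧ P (V.ι ≫ t)) → P t) :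
    ∃ (C : Scheme.{u}) (ι : C ⟶ X), IsClosedImmersion ι ∧
      ∀ (T : Scheme.{u}) (t : T ⟶ X), (∃ γ : T ⟶ C, γ ≫ ι = t) ↔ P t := by
  let I : X.IdealSheafData :=
    { ideal := fun U => vanishing P U.1
      map_ideal_basicOpen := fun U f => vanishing_map_basicOpen nat cut U.2 f }
  refine ⟨I.subscheme, I.subschemeι, inferInstance, fun T t => ⟨?_, fun hP => ?_⟩⟩
  · rintro ⟨γ, rfl⟩
    refine nat _ _ (loc _ fun x => ?_)
    obtain ⟨V, g, hxV, hg⟩ := cut (I.subschemeι x)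
    obtain ⟨U, hU, hxU, hUV⟩ := exists_isAffineOpen_mem_and_subset hxV
    refine ⟨I.subschemeι ⁻¹ᵁ U, hxU, ?_⟩
    have hg' := hg.map hUV
    rw [hg' _ _ (le_preimage_restrict _ _), restrict_appLE_eq_zero_iff]
    have := I.ker_subschemeι_app ⟨U, hU⟩
    have hmem : X.presheaf.map (homOfLE hUV).op g ∈ I.ideal ⟨U, hU⟩ := by
      change _ ∈ vanishing P U
      rw [vanishing_eq_span hU hg']
      exact Ideal.mem_span_singleton_self _
    rw [← this] at hmem
    exact hmem
  · refine ⟨IsClosedImmersion.lift I.subschemeι t ?_, IsClosedImmersion.lift_fac _ _ _⟩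
    rw [I.ker_subschemeι]
    refine Scheme.IdealSheafData.le_ofIdeals_iff.mpr fun U g hg => ?_
    change t.app U.1 g = 0
    rw [← restrict_appLE_eq_zero_iff]
    exact hg _ _ _ (nat _ _ hP)

end ClosedGluing

/-! ### Changes of homogeneous coordinates -/

lemma exists_combination {R : Type*} [CommRing R] {a : Fin 2 → R}
    (h : Ideal.span (Set.range a) = ⊤) : ∃ c : Fin 2 → R, c 0 * a 0 + c 1 * a 1 = 1 := by
  have h1 : (1 : R) ∈ Ideal.span (Set.range a) := h ▸ trivial
  rw [Ideal.mem_span_range_iff_exists_fun] at h1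
  obtain ⟨c, hc⟩ := h1
  exact ⟨c, by simpa using hc⟩

lemma span_eq_top_of_combination {R : Type*} [CommRing R] {a : Fin 2 → R} (c : Fin 2 → R)
    (h : c 0 * a 0 + c 1 * a 1 = 1) : Ideal.span (Set.range a) = ⊤ := by
  rw [Ideal.eq_top_iff_one, Ideal.mem_span_range_iff_exists_fun]
  exact ⟨c, by simpa using h⟩

lemma HasCoords.exists_combination {T : Scheme.{u}} {f : T ⟶ P1.{u}} {a : Fin 2 → Γ(T, ⊤)}
    (h : HasCoords f a) : ∃ c : Fin 2 → Γ(T, ⊤), c 0 * a 0 + c 1 * a 1 = 1 :=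
  QuiverCurve.exists_combination h.1

/-- Homogeneous coordinates are unique up to a unit. -/
lemma HasCoords.exists_unit {T : Scheme.{u}} {f : T ⟶ P1.{u}} {a b : Fin 2 → Γ(T, ⊤)}
    (h : HasCoords f a) (h' : HasCoords f b) : ∃ w : Γ(T, ⊤)ˣ, ∀ r, b r = w * a r := by
  have e := (h.eq_iff h').mp rfl
  obtain ⟨c, hc⟩ := h.exists_combination
  obtain ⟨c', hc'⟩ := h'.exists_combination
  have h0 : b 0 = (c 0 * b 0 + c 1 * b 1) * a 0 := by linear_combination -b 0 * hc - c 1 * e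
  have h1 : b 1 = (c 0 * b 0 + c 1 * b 1) * a 1 := by linear_combination -b 1 * hc + c 0 * e
  have hu : IsUnit (c 0 * b 0 + c 1 * b 1) := by
    refine IsUnit.of_mul_eq_one (c' 0 * a 0 + c' 1 * a 1) ?_
    linear_combination hc' - c' 0 * h0 - c' 1 * h1
  obtain ⟨w, hw⟩ := hu
  refine ⟨w, fun r => ?_⟩
  rw [hw]
  fin_cases r
  exacts [h0, h1]

lemma HasCoords.smul {T : Scheme.{u}} {f : T ⟶ P1.{u}} {a : Fin 2 → Γ(T, ⊤)}
    (h : HasCoords f a) (w : Γ(T, ⊤)ˣ) : HasCoords f fun r => w * a r := by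
  obtain ⟨c, hc⟩ := h.exists_combination
  refine h.of_eq (span_eq_top_of_combination (fun r => ↑w⁻¹ * c r) ?_) (by ring)
  linear_combination hc + (c 0 * a 0 + c 1 * a 1) * w.inv_mul

lemma hasCoords_of_local {T : Scheme.{u}} {f : T ⟶ P1.{u}} {a : Fin 2 → Γ(T, ⊤)}
    (ha : Ideal.span (Set.range a) = ⊤)
    (h : ∀ x : T, ∃ V : T.Opens, x ∈ V ∧ HasCoords (V.ι ≫ f) (pb V.ι a)) : HasCoords f a := by
  refine ⟨ha, hom_ext_of_local fun x => ?_⟩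
  obtain ⟨V, hV, h⟩ := h x
  refine ⟨V, hV, ?_⟩
  obtain ⟨h1, h2⟩ := h
  rw [h2, comp_homogPoint]

/-- The pullback of an invertible matrix of functions. -/
abbrev pbGL {T T' : Scheme.{u}} (t : T' ⟶ T) (M : GL (Fin 2) Γ(T, ⊤)) : GL (Fin 2) Γ(T', ⊤) :=
  Matrix.GeneralLinearGroup.map t.appTop.hom M

lemma pbGL_id {T : Scheme.{u}} (M : GL (Fin 2) Γ(T, ⊤)) : pbGL (𝟙 T) M = M := by
  ext i j; simp

lemma pbGL_comp {T T' T'' : Scheme.{u}} (t : T' ⟶ T) (t' : T'' ⟶ T') (M : GL (Fin 2) Γ(T, ⊤)) :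
    pbGL (t' ≫ t) M = pbGL t' (pbGL t M) := by
  ext i j
  rw [pbGL, Scheme.Hom.comp_appTop]
  rfl

lemma pb_mulVec {T T' : Scheme.{u}} (t : T' ⟶ T) (M : GL (Fin 2) Γ(T, ⊤))
    (x : Fin 2 → Γ(T, ⊤)) :
    pb t ((M : Matrix (Fin 2) (Fin 2) Γ(T, ⊤)).mulVec x) =
      (pbGL t M : Matrix (Fin 2) (Fin 2) Γ(T', ⊤)).mulVec (pb t x) := by
  funext r
  simp only [Matrix.mulVec, dotProduct, Fin.sum_univ_two, pb_apply, map_add, map_mul]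
  rfl

lemma span_mulVec {R : Type*} [CommRing R] (M : GL (Fin 2) R) {x : Fin 2 → R}
    (hx : Ideal.span (Set.range x) = ⊤) :
    Ideal.span (Set.range ((M : Matrix (Fin 2) (Fin 2) R).mulVec x)) = ⊤ := by
  obtain ⟨c, hc⟩ := exists_combination hx
  refine span_eq_top_of_combination
    (Matrix.vecMul c ((M⁻¹ : GL (Fin 2) R) : Matrix (Fin 2) (Fin 2) R)) ?_
  have : dotProduct (Matrix.vecMul c ((M⁻¹ : GL (Fin 2) R) : Matrix (Fin 2) (Fin 2) R))
      ((M : Matrix (Fin 2) (Fin 2) R).mulVec x) = dotProduct c x := by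
    rw [Matrix.dotProduct_mulVec, Matrix.vecMul_vecMul, ← Units.val_mul, inv_mul_cancel]
    simp
  simpa [dotProduct, Fin.sum_univ_two, hc] using this

lemma HasCoords.mulVec_unique {T : Scheme.{u}} {f g h : T ⟶ P1.{u}} {x y : Fin 2 → Γ(T, ⊤)}
    {M : GL (Fin 2) Γ(T, ⊤)} (hx : HasCoords f x) (hy : HasCoords f y)
    (hg : HasCoords g ((M : Matrix _ _ _).mulVec x))
    (hh : HasCoords h ((M : Matrix _ _ _).mulVec y)) : g = h := by
  obtain ⟨w, hw⟩ := hx.exists_unit hy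
  rw [hg.eq_iff hh]
  simp only [Matrix.mulVec, dotProduct, Fin.sum_univ_two, hw]
  ring

/-- Homogeneous coordinates exist only locally, so the image of a point under a matrix is glued from
the images of the local coordinates. -/
lemma exists_act {T : Scheme.{u}} (M : GL (Fin 2) Γ(T, ⊤)) (f : T ⟶ P1.{u}) :
    ∃ f' : T ⟶ P1.{u}, ∀ (T' : Scheme.{u}) (g : T' ⟶ T) (x : Fin 2 → Γ(T', ⊤)),
      HasCoords (g ≫ f) x → HasCoords (g ≫ f') ((pbGL g M : Matrix _ _ _).mulVec x) := by
  obtain ⟨f', h⟩ := exists_hom_of_local (T := T) (S := P1.{u})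
    (fun T' g h => ∃ x, HasCoords (g ≫ f) x ∧ HasCoords h ((pbGL g M : Matrix _ _ _).mulVec x))
    (by
      rintro T' T'' h g f' ⟨x, hx, hx'⟩
      refine ⟨pb h x, by simpa using hx.comp h, ?_⟩
      have := hx'.comp h
      rwa [pb_mulVec, ← pbGL_comp] at this)
    (by
      rintro T' g f f' ⟨x, hx, hx'⟩ ⟨y, hy, hy'⟩
      exact hx.mulVec_unique hy hx' hy')
    (by
      intro x
      obtain ⟨V, a, hx, ha⟩ := exists_local_coords f x
      exact ⟨V, _, hx, a, ha, hasCoords_homogPoint _ (span_mulVec _ ha.1)⟩)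
  refine ⟨f', fun T' g x hx => hasCoords_of_local (span_mulVec _ hx.1) fun y => ?_⟩
  obtain ⟨V, hV, a, ha, ha'⟩ := h (g y)
  refine ⟨g ⁻¹ᵁ V, hV, ?_⟩
  have e : (g ⁻¹ᵁ V).ι ≫ g = (g ∣_ V) ≫ V.ι := (morphismRestrict_ι g V).symm
  have h1 := ha.comp (g ∣_ V)
  have h2 := ha'.comp (g ∣_ V)
  have h3 := hx.comp (g ⁻¹ᵁ V).ι
  rw [pb_mulVec] at h2 ⊢
  have e1 : ∀ f : T ⟶ P1.{u}, (g ⁻¹ᵁ V).ι ≫ g ≫ f = (g ∣_ V) ≫ V.ι ≫ f := fun f => by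
    rw [← Category.assoc, e, Category.assoc]
  rw [e1] at h3 ⊢
  have e2 : pbGL (g ∣_ V) (pbGL V.ι M) = pbGL (g ⁻¹ᵁ V).ι (pbGL g M) := by
    rw [← pbGL_comp, ← pbGL_comp, e]
  rw [e2] at h2
  obtain ⟨w, hw⟩ := h1.exists_unit h3
  convert h2.smul w using 1
  funext r
  simp only [Matrix.mulVec, dotProduct, Fin.sum_univ_two, hw]
  ring

/-- The action of an invertible matrix of functions on points of the projective line. -/
def act {T : Scheme.{u}} (M : GL (Fin 2) Γ(T, ⊤)) (f : T ⟶ P1.{u}) : T ⟶ P1.{u} :=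
  (exists_act M f).choose

lemma HasCoords.act {T : Scheme.{u}} {f : T ⟶ P1.{u}} {x : Fin 2 → Γ(T, ⊤)} (h : HasCoords f x)
    (M : GL (Fin 2) Γ(T, ⊤)) : HasCoords (act M f) ((M : Matrix _ _ _).mulVec x) := by
  have := (exists_act M f).choose_spec T (𝟙 T) x (by simpa using h)
  rwa [pbGL_id, Category.id_comp] at this

lemma comp_act {T T' : Scheme.{u}} (g : T' ⟶ T) (M : GL (Fin 2) Γ(T, ⊤)) (f : T ⟶ P1.{u}) :
    g ≫ act M f = act (pbGL g M) (g ≫ f) := by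
  refine hom_ext_of_local fun x => ?_
  obtain ⟨V, a, hx, ha⟩ := exists_local_coords (g ≫ f) x
  refine ⟨V, hx, ?_⟩
  have h1 := (exists_act (pbGL g M) (g ≫ f)).choose_spec V V.ι a ha
  have h2 := (exists_act M f).choose_spec V (V.ι ≫ g) a (by simpa using ha)
  rw [pbGL_comp] at h2
  rw [← Category.assoc]
  exact ha.mulVec_unique ha h2 h1

lemma act_act {T : Scheme.{u}} (M N : GL (Fin 2) Γ(T, ⊤)) (f : T ⟶ P1.{u}) :
    act M (act N f) = act (M * N) f := by
  refine hom_ext_of_local fun x => ?_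
  obtain ⟨V, a, hx, ha⟩ := exists_local_coords f x
  refine ⟨V, hx, ?_⟩
  rw [comp_act, comp_act, comp_act]
  refine ha.mulVec_unique (M := pbGL V.ι (M * N)) ha ?_ (ha.act _)
  have := (ha.act (pbGL V.ι N)).act (pbGL V.ι M)
  rwa [Matrix.mulVec_mulVec, ← Units.val_mul, ← map_mul] at this

lemma act_one {T : Scheme.{u}} (f : T ⟶ P1.{u}) : act 1 f = f := by
  refine hom_ext_of_local fun x => ?_
  obtain ⟨V, a, hx, ha⟩ := exists_local_coords f x
  refine ⟨V, hx, ?_⟩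
  have := ha.act 1
  rw [Units.val_one, Matrix.one_mulVec] at this
  rw [comp_act, pbGL, map_one]
  exact (this.eq_iff ha).mpr (mul_comm _ _)

/-- The action of a matrix as a permutation of the points. -/
def actEquiv {T : Scheme.{u}} (M : GL (Fin 2) Γ(T, ⊤)) : (T ⟶ P1.{u}) ≃ (T ⟶ P1.{u}) where
  toFun := act M
  invFun := act M⁻¹
  left_inv f := by rw [act_act, inv_mul_cancel, act_one]
  right_inv f := by rw [act_act, mul_inv_cancel, act_one]

/-- The constant point `(0 : 1)`. -/
def zeroPt (T : Scheme.{u}) : T ⟶ P1.{u} :=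
  homogPoint ![0, 1] (span_eq_top_of_combination ![0, 1] (by simp))

/-- The constant point `(1 : 0)`. -/
def inftyPt (T : Scheme.{u}) : T ⟶ P1.{u} :=
  homogPoint ![1, 0] (span_eq_top_of_combination ![1, 0] (by simp))

lemma hasCoords_zeroPt (T : Scheme.{u}) : HasCoords (zeroPt T) ![0, 1] := hasCoords_homogPoint _ _

lemma hasCoords_inftyPt (T : Scheme.{u}) : HasCoords (inftyPt T) ![1, 0] := hasCoords_homogPoint _ _

lemma comp_zeroPt {T T' : Scheme.{u}} (g : T' ⟶ T) : g ≫ zeroPt T = zeroPt T' := by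
  rw [((hasCoords_zeroPt T).comp g).eq_iff (hasCoords_zeroPt T')]
  simp

lemma comp_inftyPt {T T' : Scheme.{u}} (g : T' ⟶ T) : g ≫ inftyPt T = inftyPt T' := by
  rw [((hasCoords_inftyPt T).comp g).eq_iff (hasCoords_inftyPt T')]
  simp

lemma HasCoords.eq_zeroPt_iff {T : Scheme.{u}} {f : T ⟶ P1.{u}} {x : Fin 2 → Γ(T, ⊤)}
    (h : HasCoords f x) : f = zeroPt T ↔ x 0 = 0 := by
  rw [h.eq_iff (hasCoords_zeroPt T)]
  simp

lemma HasCoords.eq_inftyPt_iff {T : Scheme.{u}} {f : T ⟶ P1.{u}} {x : Fin 2 → Γ(T, ⊤)}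
    (h : HasCoords f x) : f = inftyPt T ↔ x 1 = 0 := by
  rw [h.eq_iff (hasCoords_inftyPt T)]
  simp [eq_comm]

/-! ### The conic `x_0 x'_0 = d x_1 x'_1` -/

/-- The pair of points `f, f'` lies on the conic `x_0 x'_0 = d x_1 x'_1`. -/
def Conic {T : Scheme.{u}} (d : Γ(T, ⊤)) (f f' : T ⟶ P1.{u}) : Prop :=
  ∀ (T' : Scheme.{u}) (g : T' ⟶ T) (x x' : Fin 2 → Γ(T', ⊤)), HasCoords (g ≫ f) x →
    HasCoords (g ≫ f') x' → x 0 * x' 0 = g.appTop d * (x 1 * x' 1)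

lemma Conic.symm {T : Scheme.{u}} {d : Γ(T, ⊤)} {f f' : T ⟶ P1.{u}} (h : Conic d f f') :
    Conic d f' f := fun T' g x x' hx hx' => by
  have := h T' g x' x hx' hx
  linear_combination this

lemma conic_comm {T : Scheme.{u}} {d : Γ(T, ⊤)} {f f' : T ⟶ P1.{u}} :
    Conic d f f' ↔ Conic d f' f := ⟨Conic.symm, Conic.symm⟩

lemma HasCoords.conic_iff {T : Scheme.{u}} {d : Γ(T, ⊤)} {f f' : T ⟶ P1.{u}}
    {x x' : Fin 2 → Γ(T, ⊤)} (h : HasCoords f x) (h' : HasCoords f' x') :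
    Conic d f f' ↔ x 0 * x' 0 = d * (x 1 * x' 1) := by
  constructor
  · intro H
    simpa using H T (𝟙 T) x x' (by simpa using h) (by simpa using h')
  · intro H T' g y y' hy hy'
    obtain ⟨w, hw⟩ := (h.comp g).exists_unit hy
    obtain ⟨w', hw'⟩ := (h'.comp g).exists_unit hy'
    have := congrArg g.appTop H
    simp only [map_mul] at this
    simp only [hw, hw', pb_apply]
    linear_combination (w : Γ(T', ⊤)) * w' * this

lemma Conic.comp {T T' : Scheme.{u}} {d : Γ(T, ⊤)} {f f' : T ⟶ P1.{u}} (h : Conic d f f')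
    (g : T' ⟶ T) : Conic (g.appTop d) (g ≫ f) (g ≫ f') := fun T'' g' x x' hx hx' => by
  have := h T'' (g' ≫ g) x x' (by simpa using hx) (by simpa using hx')
  rwa [Scheme.Hom.comp_appTop, CommRingCat.comp_apply] at this

/-! ### Correspondences of conic type -/

/-- A property of `T`-valued points over `Y` that on the image of an open immersion `j` is the
vanishing of a function is locally cut out by one function. -/
lemma exists_cutOutBy {X S : Scheme.{u}} {P : ∀ ⦃T : Scheme.{u}⦄, (T ⟶ X) → Prop} (j : S ⟶ X)
    [IsOpenImmersion j] (g : Γ(S, ⊤))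
    (h : ∀ (T : Scheme.{u}) (t : T ⟶ S), P (t ≫ j) ↔ t.appTop g = 0) (x : S) :
    ∃ (V : X.Opens) (g : Γ(X, V)), j x ∈ V ∧ CutOutBy P V g := by
  refine ⟨j ''ᵁ ⊤, (j.appIso ⊤).inv g, ⟨x, trivial, rfl⟩, fun T t ht => ?_⟩
  obtain ⟨t, rfl⟩ : ∃ t', t = t' ≫ j := ⟨_, (IsOpenImmersion.lift_fac j t (by
    rintro _ ⟨y, rfl⟩
    obtain ⟨z, -, hz⟩ := ht (trivial : y ∈ (⊤ : T.Opens))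
    exact ⟨z, hz⟩)).symm⟩
  rw [h, ← appLE_comp_appTop j t (by rw [Scheme.Hom.preimage_image_eq]), ← CommRingCat.comp_apply,
    ← Category.assoc, Scheme.Hom.appIso_inv_appLE]
  rw [show (homOfLE (le_refl (⊤ : S.Opens))) = 𝟙 _ from rfl, op_id, S.presheaf.map_id]
  rfl

lemma exists_local_coords₂ {T : Scheme.{u}} (f f' : T ⟶ P1.{u}) (x : T) :
    ∃ (V : T.Opens) (a a' : Fin 2 → Γ(V, ⊤)), x ∈ V ∧ HasCoords (V.ι ≫ f) a ∧
      HasCoords (V.ι ≫ f') a' := by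
  obtain ⟨V, a, hx, ha⟩ := exists_local_coords f x
  obtain ⟨V', a', hx', ha'⟩ := exists_local_coords f' x
  refine ⟨V ⊓ V', pb (T.homOfLE inf_le_left) a, pb (T.homOfLE inf_le_right) a', ⟨hx, hx'⟩, ?_, ?_⟩
  · simpa using ha.comp (T.homOfLE inf_le_left)
  · simpa using ha'.comp (T.homOfLE inf_le_right)

/-- Coordinates over `t` in which the relation `rel` is the conic `x_0 x'_0 = d x_1 x'_1`. -/
structure Frame {Y : Scheme.{u}}
    (rel : ∀ ⦃T : Scheme.{u}⦄, (T ⟶ Y) → (T ⟶ P1.{u}) → (T ⟶ P1.{u}) → Prop)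
    {T : Scheme.{u}} (t : T ⟶ Y) where
  M : GL (Fin 2) Γ(T, ⊤)
  M' : GL (Fin 2) Γ(T, ⊤)
  d : Γ(T, ⊤)
  spec : ∀ ⦃T' : Scheme.{u}⦄ (g : T' ⟶ T) (f f' : T' ⟶ P1.{u}), rel (g ≫ t) f f' ↔
    Conic (g.appTop d) (act (pbGL g M) f) (act (pbGL g M') f')

/-- A correspondence between two projective lines over `Y`, given by its functor of points, that
locally on `Y` is a conic `x_0 x'_0 = d x_1 x'_1` in suitable coordinates. -/
structure Correspondence (Y : Scheme.{u}) where
  rel : ∀ ⦃T : Scheme.{u}⦄, (T ⟶ Y) → (T ⟶ P1.{u}) → (T ⟶ P1.{u}) → Prop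
  comp : ∀ ⦃T T' : Scheme.{u}⦄ (g : T' ⟶ T) (t : T ⟶ Y) (f f' : T ⟶ P1.{u}), rel t f f' →
    rel (g ≫ t) (g ≫ f) (g ≫ f')
  glue : ∀ ⦃T : Scheme.{u}⦄ (t : T ⟶ Y) (f f' : T ⟶ P1.{u}),
    (∀ x : T, ∃ V : T.Opens, x ∈ V ∧ rel (V.ι ≫ t) (V.ι ≫ f) (V.ι ≫ f')) → rel t f f'
  frame : ∀ y : Y, ∃ V : Y.Opens, y ∈ V ∧ Nonempty (Frame rel V.ι)

namespace Frame

variable {Y : Scheme.{u}}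
  {rel : ∀ ⦃T : Scheme.{u}⦄, (T ⟶ Y) → (T ⟶ P1.{u}) → (T ⟶ P1.{u}) → Prop}

/-- The base change of a frame. -/
def comp {T T' : Scheme.{u}} {t : T ⟶ Y} (F : Frame rel t) (h : T' ⟶ T) : Frame rel (h ≫ t) where
  M := pbGL h F.M
  M' := pbGL h F.M'
  d := h.appTop F.d
  spec T'' g f f' := by
    rw [← Category.assoc, F.spec, pbGL_comp, pbGL_comp, Scheme.Hom.comp_appTop,
      CommRingCat.comp_apply]

/-- The frame with the two projective lines exchanged. -/
def swap {T : Scheme.{u}} {t : T ⟶ Y} (F : Frame rel t) :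
    Frame (fun _ t f f' => rel t f' f) t where
  M := F.M'
  M' := F.M
  d := F.d
  spec T' g f f' := by rw [F.spec, conic_comm]

lemma rel_iff {T : Scheme.{u}} {t : T ⟶ Y} (F : Frame rel t) (f f' : T ⟶ P1.{u}) :
    rel t f f' ↔ Conic F.d (act F.M f) (act F.M' f') := by
  have := F.spec (𝟙 T) f f'
  rw [pbGL_id, pbGL_id, Category.id_comp] at this
  simpa using this

end Frame

namespace Correspondence

variable {Y : Scheme.{u}} (K : Correspondence Y)

/-- The inverse correspondence. -/
def swap : Correspondence Y where
  rel _ t f f' := K.rel t f' f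
  comp _ _ g t f f' h := K.comp g t f' f h
  glue _ t f f' h := K.glue t f' f h
  frame y := let ⟨V, hV, ⟨F⟩⟩ := K.frame y; ⟨V, hV, ⟨F.swap⟩⟩

lemma exists_frame {T : Scheme.{u}} (t : T ⟶ Y) (x : T) :
    ∃ V : T.Opens, x ∈ V ∧ Nonempty (Frame K.rel (V.ι ≫ t)) := by
  obtain ⟨V, hV, ⟨F⟩⟩ := K.frame (t x)
  refine ⟨t ⁻¹ᵁ V, hV, ⟨?_⟩⟩
  rw [← morphismRestrict_ι]
  exact F.comp (t ∣_ V)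

/-- The base change of a correspondence. -/
def pull {T : Scheme.{u}} (t : T ⟶ Y) : Correspondence T where
  rel _ g f f' := K.rel (g ≫ t) f f'
  comp _ _ g t f f' h := by rw [Category.assoc]; exact K.comp g _ f f' h
  glue _ t f f' h := K.glue _ f f' (by simpa using h)
  frame x := by
    obtain ⟨V, hV, ⟨F⟩⟩ := K.exists_frame t x
    exact ⟨V, hV, ⟨⟨F.M, F.M', F.d, fun T' g f f' => by rw [Category.assoc]; exact F.spec g f f'⟩⟩⟩

/-- Over `t`, the correspondence contracts the first line to the point `κ` of the second line. -/
def Contr {T : Scheme.{u}} (t : T ⟶ Y) (κ : T ⟶ P1.{u}) : Prop :=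
  ∀ (T' : Scheme.{u}) (g : T' ⟶ T) (f : T' ⟶ P1.{u}), K.rel (g ≫ t) f (g ≫ κ)

variable {K}

lemma Contr.comp {T T' : Scheme.{u}} {t : T ⟶ Y} {κ : T ⟶ P1.{u}} (h : K.Contr t κ)
    (g : T' ⟶ T) : K.Contr (g ≫ t) (g ≫ κ) := fun T'' g' f => by
  have := h T'' (g' ≫ g) f
  simpa using this

lemma contr_of_local {T : Scheme.{u}} {t : T ⟶ Y} {κ : T ⟶ P1.{u}}
    (h : ∀ x : T, ∃ V : T.Opens, x ∈ V ∧ K.Contr (V.ι ≫ t) (V.ι ≫ κ)) : K.Contr t κ := by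
  refine fun T' g f => K.glue _ _ _ fun x => ?_
  obtain ⟨V, hV, h⟩ := h (g x)
  refine ⟨g ⁻¹ᵁ V, hV, ?_⟩
  have := h _ (g ∣_ V) ((g ⁻¹ᵁ V).ι ≫ f)
  rw [← Category.assoc, ← Category.assoc, morphismRestrict_ι, Category.assoc,
    Category.assoc] at this
  exact this

/-- In a frame, a line is contracted if and only if `d = 0`, and then to the point `(0 : 1)`. -/
lemma contr_iff {T : Scheme.{u}} {t : T ⟶ Y} (F : Frame K.rel t) (κ : T ⟶ P1.{u}) :
    K.Contr t κ ↔ F.d = 0 ∧ act F.M' κ = zeroPt T := by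
  constructor
  · intro h
    have h0 : ∀ x : T, ∃ V : T.Opens, x ∈ V ∧ V.ι ≫ act F.M' κ = V.ι ≫ zeroPt T ∧
        V.ι.appTop F.d = V.ι.appTop 0 := by
      intro x
      obtain ⟨V, a, hx, ha⟩ := exists_local_coords (act F.M' κ) x
      refine ⟨V, hx, ?_⟩
      have key : ∀ f, Conic (V.ι.appTop F.d) (act (pbGL V.ι F.M) f) (V.ι ≫ act F.M' κ) := by
        intro f
        rw [comp_act]
        exact (F.spec V.ι f _).mp (h V V.ι f)
      -- the points `(1 : 0)` and `(0 : 1)` of the first line determine both `d` and `κ`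
      have k1 := key ((actEquiv (pbGL V.ι F.M)).symm (inftyPt V))
      have k2 := key ((actEquiv (pbGL V.ι F.M)).symm (zeroPt V))
      change Conic _ (actEquiv (pbGL V.ι F.M) _) _ at k1 k2
      rw [Equiv.apply_symm_apply] at k1 k2
      rw [(hasCoords_inftyPt V).conic_iff ha] at k1
      rw [(hasCoords_zeroPt V).conic_iff ha] at k2
      have h0 : a 0 = 0 := by simpa using k1
      have e : V.ι ≫ act F.M' κ = V.ι ≫ zeroPt T := by
        rw [comp_zeroPt, ha.eq_zeroPt_iff, h0]
      refine ⟨e, ?_⟩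
      obtain ⟨c, hc⟩ := ha.exists_combination
      have : V.ι.appTop F.d * a 1 = 0 := by simpa [h0] using k2.symm
      rw [map_zero]
      linear_combination c 1 * this - V.ι.appTop F.d * hc + V.ι.appTop F.d * c 0 * h0
    exact ⟨section_ext_of_local fun x => let ⟨V, hV, h⟩ := h0 x; ⟨V, hV, h.2⟩,
      hom_ext_of_local fun x => let ⟨V, hV, h⟩ := h0 x; ⟨V, hV, h.1⟩⟩
  · rintro ⟨hd, hκ⟩ T' g f
    rw [F.spec, ← comp_act, hκ, hd, map_zero, comp_zeroPt]
    intro T'' g' x x' hx hx'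
    rw [comp_zeroPt] at hx'
    rw [(hx'.eq_zeroPt_iff).mp rfl]
    simp

lemma Contr.unique {T : Scheme.{u}} {t : T ⟶ Y} {κ κ' : T ⟶ P1.{u}} (h : K.Contr t κ)
    (h' : K.Contr t κ') : κ = κ' := by
  refine hom_ext_of_local fun x => ?_
  obtain ⟨V, hV, ⟨F⟩⟩ := K.exists_frame t x
  refine ⟨V, hV, (actEquiv F.M').injective ?_⟩
  exact ((contr_iff F _).mp (h.comp V.ι)).2.trans ((contr_iff F _).mp (h'.comp V.ι)).2.symm

variable (K)

/-- Over `t`, the correspondence contracts a line. -/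
def Deg ⦃T : Scheme.{u}⦄ (t : T ⟶ Y) : Prop := ∃ κ : T ⟶ P1.{u}, K.Contr t κ

variable {K}

/-- In a frame, the parameter `d` is the equation of the degeneration locus. -/
lemma deg_iff {T : Scheme.{u}} {t : T ⟶ Y} (F : Frame K.rel t) : K.Deg t ↔ F.d = 0 := by
  constructor
  · rintro ⟨κ, hκ⟩
    exact ((contr_iff F κ).mp hκ).1
  · intro h
    exact ⟨(actEquiv F.M').symm (zeroPt T), (contr_iff F _).mpr
      ⟨h, (actEquiv F.M').apply_symm_apply _⟩⟩

lemma Deg.comp {T T' : Scheme.{u}} {t : T ⟶ Y} (h : K.Deg t) (g : T' ⟶ T) : K.Deg (g ≫ t) :=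
  let ⟨_, h⟩ := h; ⟨_, h.comp g⟩

lemma deg_of_local {T : Scheme.{u}} {t : T ⟶ Y}
    (h : ∀ x : T, ∃ V : T.Opens, x ∈ V ∧ K.Deg (V.ι ≫ t)) : K.Deg t := by
  obtain ⟨κ, hκ⟩ := exists_hom_of_local (T := T) (S := P1.{u}) (fun _ g κ => K.Contr (g ≫ t) κ)
    (fun _ _ h g κ hκ => by simpa using hκ.comp h) (fun _ _ _ _ h h' => h.unique h')
    (fun x => let ⟨V, hV, κ, h⟩ := h x; ⟨V, κ, hV, h⟩)
  exact ⟨κ, contr_of_local hκ⟩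

lemma deg_swap_iff {T : Scheme.{u}} {t : T ⟶ Y} : K.swap.Deg t ↔ K.Deg t := by
  have : ∀ K : Correspondence Y, K.Deg t → K.swap.Deg t := fun K h => deg_of_local fun x => by
    obtain ⟨V, hV, ⟨F⟩⟩ := K.exists_frame t x
    exact ⟨V, hV, (deg_iff (K := K.swap) F.swap).mpr ((deg_iff F).mp (h.comp _))⟩
  exact ⟨this K.swap, this K⟩

variable (K)

/-- The locus where a line is contracted is a closed subscheme of the base. -/
theorem exists_degeneration : ∃ (Z : Scheme.{u}) (ζ : Z ⟶ Y), IsClosedImmersion ζ ∧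
    ∀ (T : Scheme.{u}) (t : T ⟶ Y), (∃ z : T ⟶ Z, z ≫ ζ = t) ↔ K.Deg t := by
  refine exists_closedImmersion_of_local (P := K.Deg) (fun _ _ g _ h => h.comp g) (fun y => ?_)
    (fun _ _ h => deg_of_local h)
  obtain ⟨V, hV, ⟨F⟩⟩ := K.frame y
  exact exists_cutOutBy V.ι F.d (fun T t => deg_iff (F.comp t)) ⟨y, hV⟩

lemma PSq_hom_eq {T Y : Scheme.{u}} (t : T ⟶ PSq Y) : t = PSq.lift (t ≫ PSq.fst Y ≫ PLine.proj Y)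
    (t ≫ PSq.fst Y ≫ PLine.toP1 Y) (t ≫ PSq.snd Y ≫ PLine.toP1 Y) := by
  have h : t ≫ PSq.fst Y ≫ PLine.proj Y = t ≫ PSq.snd Y ≫ PLine.proj Y :=
    congrArg (t ≫ ·) pullback.condition
  apply pullback.hom_ext
  · refine Eq.trans ?_ (pullback.lift_fst _ _ _).symm
    apply pullback.hom_ext
    · exact (Category.assoc _ _ _).trans (PLine.lift_proj _ _).symm
    · exact (Category.assoc _ _ _).trans (PLine.lift_toP1 _ _).symm
  · refine Eq.trans ?_ (pullback.lift_snd _ _ _).symm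
    apply pullback.hom_ext
    · exact ((Category.assoc _ _ _).trans h.symm).trans (PLine.lift_proj _ _).symm
    · exact (Category.assoc _ _ _).trans (PLine.lift_toP1 _ _).symm

/-- The correspondence is represented by a closed subscheme of `(ℙ¹)²_Y`. -/
theorem exists_curve : ∃ (C : Scheme.{u}) (ι : C ⟶ PSq Y), IsClosedImmersion ι ∧
    ∀ (T : Scheme.{u}) (t : T ⟶ PSq Y), (∃ γ : T ⟶ C, γ ≫ ι = t) ↔
      K.rel (t ≫ PSq.fst Y ≫ PLine.proj Y) (t ≫ PSq.fst Y ≫ PLine.toP1 Y)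
        (t ≫ PSq.snd Y ≫ PLine.toP1 Y) := by
  refine exists_closedImmersion_of_local (P := fun T (t : T ⟶ PSq Y) =>
      K.rel (t ≫ PSq.fst Y ≫ PLine.proj Y) (t ≫ PSq.fst Y ≫ PLine.toP1 Y)
        (t ≫ PSq.snd Y ≫ PLine.toP1 Y))
    (fun _ _ g _ h => by simpa using K.comp g _ _ _ h) (fun y => ?_)
    (fun _ t h => K.glue _ _ _ (by simpa using h))
  obtain ⟨V, hV, ⟨F⟩⟩ := K.exists_frame (PSq.fst Y ≫ PLine.proj Y) y
  obtain ⟨W, a, a', hW, ha, ha'⟩ := exists_local_coords₂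
    (act F.M (V.ι ≫ PSq.fst Y ≫ PLine.toP1 Y)) (act F.M' (V.ι ≫ PSq.snd Y ≫ PLine.toP1 Y)) ⟨y, hV⟩
  refine exists_cutOutBy (W.ι ≫ V.ι) (a 0 * a' 0 - W.ι.appTop F.d * (a 1 * a' 1)) (fun T t => ?_)
    ⟨⟨y, hV⟩, hW⟩
  have h1 := ha.comp t
  have h2 := ha'.comp t
  rw [← Category.assoc, comp_act] at h1 h2
  have h3 := F.spec (t ≫ W.ι) (t ≫ W.ι ≫ V.ι ≫ PSq.fst Y ≫ PLine.toP1 Y)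
    (t ≫ W.ι ≫ V.ι ≫ PSq.snd Y ≫ PLine.toP1 Y)
  simp only [Category.assoc] at h1 h2 h3 ⊢
  rw [h3, h1.conic_iff h2, Scheme.Hom.comp_appTop, CommRingCat.comp_apply, map_sub, sub_eq_zero]
  simp only [map_mul, pb_apply]

end Correspondence

/-! ### Morphisms to the projective line over a base -/

lemma PLine.hom_ext {T Y : Scheme.{u}} {a b : T ⟶ PLine Y}
    (h : a ≫ PLine.proj Y = b ≫ PLine.proj Y) (h' : a ≫ PLine.toP1 Y = b ≫ PLine.toP1 Y) : a = b :=
  pullback.hom_ext h h'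

lemma PLine.comp_lift {T T' Y : Scheme.{u}} (g : T' ⟶ T) (t : T ⟶ Y) (f : T ⟶ P1.{u}) :
    g ≫ PLine.lift t f = PLine.lift (g ≫ t) (g ≫ f) := by
  apply PLine.hom_ext <;> simp only [Category.assoc, PLine.lift_proj, PLine.lift_toP1]

lemma PLine.eq_lift {T Y : Scheme.{u}} (a : T ⟶ PLine Y) :
    a = PLine.lift (a ≫ PLine.proj Y) (a ≫ PLine.toP1 Y) := by
  apply PLine.hom_ext <;> simp only [PLine.lift_proj, PLine.lift_toP1]

lemma eq_zero_of_not_isUnit {k : Type u} [Field k] {b : Γ(Spec (.of k), ⊤)} (h : ¬ IsUnit b) :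
    b = 0 := by
  by_contra hb
  have h1 : (Scheme.ΓSpecIso (.of k)).hom b ≠ 0 := fun h0 => hb (by
    have := congrArg (Scheme.ΓSpecIso (.of k)).inv h0
    simpa using this)
  have h2 := (IsUnit.mk0 _ h1).map (Scheme.ΓSpecIso (.of k)).inv.hom
  exact h (by simpa using h2)

lemma fromSpecResidueField_appTop_eq_zero {T : Scheme.{u}} {z : T} {a : Γ(T, ⊤)}
    (h : z ∉ T.basicOpen a) : (T.fromSpecResidueField z).appTop a = 0 := by
  refine eq_zero_of_not_isUnit (k := T.residueField z) fun hu => h ?_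
  obtain ⟨x⟩ : Nonempty (Spec (T.residueField z)) := inferInstance
  have := (isUnit_appTop_iff _ _).mp hu x
  have hx : T.fromSpecResidueField z x = z := by
    have : T.fromSpecResidueField z x ∈ Set.range (T.fromSpecResidueField z) := ⟨x, rfl⟩
    rwa [Scheme.range_fromSpecResidueField] at this
  rwa [hx] at this

lemma exists_span_eq_top {T : Scheme.{u}} {a : Fin 2 → Γ(T, ⊤)} {z : T}
    (h : ∃ i, z ∈ T.basicOpen (a i)) :
    ∃ V : T.Opens, z ∈ V ∧ Ideal.span (Set.range (pb V.ι a)) = ⊤ := by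
  obtain ⟨i, hi⟩ := h
  exact ⟨_, hi, Ideal.eq_top_of_isUnit_mem _ (Ideal.subset_span ⟨i, rfl⟩) (isUnit_ι_basicOpen _)⟩

lemma exists_opens_of_isOpenImmersion {S T : Scheme.{u}} (j : S ⟶ T) [IsOpenImmersion j] (x : S) :
    ∃ V : T.Opens, j x ∈ V ∧ ∃ k : (V : Scheme.{u}) ⟶ S, k ≫ j = V.ι :=
  ⟨j.opensRange, ⟨x, rfl⟩, IsOpenImmersion.lift j j.opensRange.ι (by simp),
    IsOpenImmersion.lift_fac _ _ _⟩

lemma isIso_of_section {X S : Scheme.{u}} (p : X ⟶ S) (σ : S ⟶ X) (h : σ ≫ p = 𝟙 S)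
    (h' : p ≫ σ = 𝟙 X) : IsIso p := ⟨σ, h', h⟩

namespace Correspondence

variable {Y : Scheme.{u}} (K : Correspondence Y)

/-! ### The correspondence away from the contracted points -/

/-- The point `f` of the first line avoids the point to which the second line is contracted. -/
def Avoids {T : Scheme.{u}} (t : T ⟶ Y) (f : T ⟶ P1.{u}) : Prop :=
  ∀ (T' : Scheme.{u}) (g : T' ⟶ T), K.swap.Contr (g ≫ t) (g ≫ f) → IsEmpty T'

variable {K}

lemma Avoids.comp {T T' : Scheme.{u}} {t : T ⟶ Y} {f : T ⟶ P1.{u}} (h : K.Avoids t f)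
    (g : T' ⟶ T) : K.Avoids (g ≫ t) (g ≫ f) := fun T'' g' h' =>
  h T'' (g' ≫ g) (by simpa using h')

/-- In a frame, a point `(x_0 : x_1)` that avoids the contracted point has unimodular
`(x_0, d x_1)`. -/
lemma Avoids.mem_basicOpen {T : Scheme.{u}} {t : T ⟶ Y} {f : T ⟶ P1.{u}} (h : K.Avoids t f)
    (F : Frame K.rel t) {x : Fin 2 → Γ(T, ⊤)} (hx : HasCoords (act F.M f) x) (z : T) :
    ∃ i, z ∈ T.basicOpen (![F.d * x 1, x 0] i) := by
  by_contra! hz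
  have h0 := fromSpecResidueField_appTop_eq_zero (hz 0)
  have h1 := fromSpecResidueField_appTop_eq_zero (hz 1)
  simp only [Matrix.cons_val_zero, Matrix.cons_val_one, map_mul] at h0 h1
  set g := T.fromSpecResidueField z
  have hgx := hx.comp g
  obtain ⟨c, hc⟩ := hgx.exists_combination
  rw [pb_apply, h1, mul_zero, zero_add, pb_apply] at hc
  have hd : g.appTop F.d = 0 := by linear_combination c 1 * h0 - g.appTop F.d * hc
  have : IsEmpty (Spec (T.residueField z)) := h _ g ((contr_iff (K := K.swap) (F.swap.comp g) _).mpr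
    ⟨hd, by
      change act (pbGL g F.M) _ = _
      rw [← comp_act, hgx.eq_zeroPt_iff]
      exact h1⟩)
  exact not_isEmpty_of_nonempty (Spec (T.residueField z)) this

/-- Locally there is a frame in which a point `(x_0 : x_1)` that avoids the contracted point has a
well-defined partner `(d x_1 : x_0)` on the other line. -/
lemma Avoids.exists_local {T : Scheme.{u}} {t : T ⟶ Y} {f : T ⟶ P1.{u}} (h : K.Avoids t f)
    (z : T) : ∃ V : T.Opens, z ∈ V ∧ ∃ (F : Frame K.rel (V.ι ≫ t)) (x : Fin 2 → Γ(V, ⊤)),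
      HasCoords (act F.M (V.ι ≫ f)) x ∧ Ideal.span (Set.range ![F.d * x 1, x 0]) = ⊤ := by
  obtain ⟨V, hV, ⟨F⟩⟩ := K.exists_frame t z
  obtain ⟨W, x, hW, hx⟩ := exists_local_coords (act F.M (V.ι ≫ f)) ⟨z, hV⟩
  rw [comp_act] at hx
  obtain ⟨W', hW', hs⟩ := exists_span_eq_top (((h.comp V.ι).comp W.ι).mem_basicOpen
    (F.comp W.ι) (x := x) hx ⟨_, hW⟩)
  obtain ⟨V', hV', k, hk⟩ := exists_opens_of_isOpenImmersion (W'.ι ≫ W.ι ≫ V.ι)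
    ⟨⟨⟨z, hV⟩, hW⟩, hW'⟩
  have key : ∃ (F : Frame K.rel ((k ≫ W'.ι ≫ W.ι ≫ V.ι) ≫ t)) (x : Fin 2 → Γ(V', ⊤)),
      HasCoords (act F.M ((k ≫ W'.ι ≫ W.ι ≫ V.ι) ≫ f)) x ∧
        Ideal.span (Set.range ![F.d * x 1, x 0]) = ⊤ := by
    simp only [Category.assoc]
    refine ⟨((F.comp W.ι).comp W'.ι).comp k, pb k (pb W'.ι x), ?_, ?_⟩
    · have := (hx.comp W'.ι).comp k
      rw [comp_act, comp_act] at this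
      exact this
    · convert span_pb k hs using 3
      funext i
      fin_cases i
      · exact (map_mul _ _ _).symm.trans (congrArg _ (map_mul _ _ _).symm)
      · rfl
  rw [hk] at key
  exact ⟨V', hV', key⟩

/-- Locally both points are `(d x_1 : x_0)`. -/
lemma Avoids.unique {T : Scheme.{u}} {t : T ⟶ Y} {f f' f'' : T ⟶ P1.{u}} (h : K.Avoids t f)
    (h' : K.rel t f f') (h'' : K.rel t f f'') : f' = f'' := by
  refine hom_ext_of_local fun z => ?_
  obtain ⟨V, hV, F, x, hx, hs⟩ := h.exists_local z
  refine ⟨V, hV, ?_⟩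
  have key : ∀ f', K.rel t f f' → act F.M' (V.ι ≫ f') = homogPoint _ hs := by
    intro f' h'
    have := (F.rel_iff _ _).mp (K.comp V.ι _ _ _ h')
    refine hom_ext_of_local fun w => ?_
    obtain ⟨W, x', hW, hx'⟩ := exists_local_coords (act F.M' (V.ι ≫ f')) w
    refine ⟨W, hW, ?_⟩
    rw [hx'.eq_iff ((hasCoords_homogPoint _ hs).comp W.ι)]
    have := ((hx.comp W.ι).conic_iff hx').mp (this.comp W.ι)
    simp only [pb_apply, Matrix.cons_val_zero, Matrix.cons_val_one, map_mul] at this ⊢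
    linear_combination this
  exact (actEquiv F.M').injective ((key f' h').trans (key f'' h'').symm)

/-- The local partners `(d x_1 : x_0)` are unique and therefore glue. -/
lemma Avoids.exists_rel {T : Scheme.{u}} {t : T ⟶ Y} {f : T ⟶ P1.{u}} (h : K.Avoids t f) :
    ∃ f' : T ⟶ P1.{u}, K.rel t f f' := by
  obtain ⟨f', h⟩ := exists_hom_of_local (T := T) (S := P1.{u})
    (fun _ g f' => K.rel (g ≫ t) (g ≫ f) f')
    (fun _ _ k g f' h => by simpa using K.comp k _ _ _ h)
    (fun _ g f' f'' h' h'' => (h.comp g).unique h' h'')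
    (fun z => by
      obtain ⟨V, hV, F, x, hx, hs⟩ := h.exists_local z
      refine ⟨V, (actEquiv F.M').symm (homogPoint _ hs), hV, (F.rel_iff _ _).mpr ?_⟩
      have : act F.M' ((actEquiv F.M').symm (homogPoint _ hs)) = homogPoint _ hs :=
        (actEquiv F.M').apply_symm_apply _
      rw [this, hx.conic_iff (hasCoords_homogPoint _ hs)]
      simp only [Matrix.cons_val_zero, Matrix.cons_val_one]
      ring)
  exact ⟨f', K.glue _ _ _ h⟩

/-! ### Schemes that represent the correspondence -/

variable (K)

/-- The scheme `X` over `Y` with the two points `a, b` of the projective line represents the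
correspondence. -/
structure IsModel {X : Scheme.{u}} (π : X ⟶ Y) (a b : X ⟶ P1.{u}) : Prop where
  rel : K.rel π a b
  lift : ∀ ⦃T : Scheme.{u}⦄ (t : T ⟶ Y) (f f' : T ⟶ P1.{u}), K.rel t f f' →
    ∃ γ : T ⟶ X, γ ≫ π = t ∧ γ ≫ a = f ∧ γ ≫ b = f'
  ext : ∀ ⦃T : Scheme.{u}⦄ (γ γ' : T ⟶ X), γ ≫ π = γ' ≫ π → γ ≫ a = γ' ≫ a → γ ≫ b = γ' ≫ b →
    γ = γ'

variable {K}

/-- The closed subscheme of `(ℙ¹)²_Y` with the points of the correspondence represents it. Working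
with the universal property makes base change and the exchange of the two lines formal. -/
lemma isModel_of_curve {C : Scheme.{u}} (ι : C ⟶ PSq Y) [IsClosedImmersion ι]
    (h : ∀ (T : Scheme.{u}) (t : T ⟶ PSq Y), (∃ γ : T ⟶ C, γ ≫ ι = t) ↔
      K.rel (t ≫ PSq.fst Y ≫ PLine.proj Y) (t ≫ PSq.fst Y ≫ PLine.toP1 Y)
        (t ≫ PSq.snd Y ≫ PLine.toP1 Y)) :
    K.IsModel (toBase ι) (ι ≫ PSq.fst Y ≫ PLine.toP1 Y) (ι ≫ PSq.snd Y ≫ PLine.toP1 Y) where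
  rel := (h C ι).mp ⟨𝟙 C, Category.id_comp _⟩
  lift T t f f' hr := by
    have h1 : PSq.lift t f f' ≫ PSq.fst Y = PLine.lift t f := pullback.lift_fst _ _ _
    have h2 : PSq.lift t f f' ≫ PSq.snd Y = PLine.lift t f' := pullback.lift_snd _ _ _
    obtain ⟨γ, hγ⟩ := (h T (PSq.lift t f f')).mpr (by
      rw [← Category.assoc, ← Category.assoc, ← Category.assoc, h1, h2]
      simpa only [PLine.lift_proj, PLine.lift_toP1] using hr)
    refine ⟨γ, ?_, ?_, ?_⟩
    · rw [toBase, ← Category.assoc, hγ, ← Category.assoc, h1, PLine.lift_proj]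
    · rw [← Category.assoc, hγ, ← Category.assoc, h1, PLine.lift_toP1]
    · rw [← Category.assoc, hγ, ← Category.assoc, h2, PLine.lift_toP1]
  ext T γ γ' h1 h2 h3 := by
    rw [← cancel_mono ι, PSq_hom_eq (γ ≫ ι), PSq_hom_eq (γ' ≫ ι)]
    simp only [Category.assoc, h2, h3]
    congr 1

lemma IsModel.swap {X : Scheme.{u}} {π : X ⟶ Y} {a b : X ⟶ P1.{u}} (h : K.IsModel π a b) :
    K.swap.IsModel π b a where
  rel := h.rel
  lift _ t f f' hr := let ⟨γ, h1, h2, h3⟩ := h.lift t f' f hr; ⟨γ, h1, h3, h2⟩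
  ext _ γ γ' h1 h2 h3 := h.ext γ γ' h1 h3 h2

lemma IsModel.of_isPullback {X X' T : Scheme.{u}} {π : X ⟶ Y} {a b : X ⟶ P1.{u}}
    (h : K.IsModel π a b) {t : T ⟶ Y} {p : X' ⟶ X} {π' : X' ⟶ T} (sq : IsPullback p π' π t) :
    (K.pull t).IsModel π' (p ≫ a) (p ≫ b) where
  rel := by
    change K.rel (π' ≫ t) _ _
    rw [← sq.w]
    exact K.comp p _ _ _ h.rel
  lift T' g f f' hr := by
    obtain ⟨γ, h1, h2, h3⟩ := h.lift _ _ _ hr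
    refine ⟨sq.lift γ g h1, sq.lift_snd _ _ _, ?_, ?_⟩
    · rw [← Category.assoc, sq.lift_fst, h2]
    · rw [← Category.assoc, sq.lift_fst, h3]
  ext T' γ γ' h1 h2 h3 := by
    refine sq.hom_ext (h.ext _ _ ?_ (by simpa using h2) (by simpa using h3)) h1
    rw [Category.assoc, Category.assoc, sq.w, ← Category.assoc, h1, Category.assoc]

variable {X : Scheme.{u}} {π : X ⟶ Y} {a b : X ⟶ P1.{u}}

/-- A model of a correspondence without contracted points is a projective line. -/
lemma IsModel.isIso (h : K.IsModel π a b) (hd : ∀ (T : Scheme.{u}) (t : T ⟶ Y), K.Deg t → IsEmpty T) :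
    IsIso (PLine.lift π a) := by
  have hav : K.Avoids (PLine.proj Y) (PLine.toP1 Y) := fun T g hg =>
    hd T _ (deg_swap_iff.mp ⟨_, hg⟩)
  obtain ⟨f', hf'⟩ := hav.exists_rel
  obtain ⟨σ, h1, h2, h3⟩ := h.lift _ _ _ hf'
  refine isIso_of_section _ σ ?_ ?_
  · apply PLine.hom_ext <;> simp only [Category.assoc, PLine.lift_proj, PLine.lift_toP1, h1, h2,
      Category.id_comp]
  · have e1 : PLine.lift π a ≫ σ ≫ π = π := by rw [h1, PLine.lift_proj]
    have e2 : PLine.lift π a ≫ σ ≫ a = a := by rw [h2, PLine.lift_toP1]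
    refine h.ext _ _ (by simpa using e1) (by simpa using e2) ?_
    have hav' := hav.comp (PLine.lift π a)
    rw [PLine.lift_proj, PLine.lift_toP1] at hav'
    refine hav'.unique ?_ (by simpa using h.rel)
    have := K.comp (PLine.lift π a ≫ σ) _ _ _ h.rel
    simp only [Category.assoc, e1, e2] at this
    simpa using this

/-- Away from the points to which the second line is contracted, the first projection has an
inverse. -/
lemma IsModel.exists_morphism (h : K.IsModel π a b) {p : X ⟶ PLine Y} (hp : p = PLine.lift π a)
    (W : (PLine Y).Opens) (hW : K.Avoids (W.ι ≫ PLine.proj Y) (W.ι ≫ PLine.toP1 Y)) :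
    IsIso (p ∣_ W) ∧ ∃ f' : (W : Scheme.{u}) ⟶ P1.{u},
      K.rel (W.ι ≫ PLine.proj Y) (W.ι ≫ PLine.toP1 Y) f' ∧
      (p ∣_ W) ≫ f' = (p ⁻¹ᵁ W).ι ≫ b := by
  obtain ⟨f', hf'⟩ := hW.exists_rel
  have e1 : (p ∣_ W) ≫ W.ι ≫ PLine.proj Y = (p ⁻¹ᵁ W).ι ≫ π := by
    rw [← Category.assoc, morphismRestrict_ι, Category.assoc, hp, PLine.lift_proj]
  have e2 : (p ∣_ W) ≫ W.ι ≫ PLine.toP1 Y = (p ⁻¹ᵁ W).ι ≫ a := by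
    rw [← Category.assoc, morphismRestrict_ι, Category.assoc, hp, PLine.lift_toP1]
  have hav := hW.comp (p ∣_ W)
  rw [e1, e2] at hav
  have e3 : (p ∣_ W) ≫ f' = (p ⁻¹ᵁ W).ι ≫ b := by
    refine hav.unique ?_ (K.comp _ _ _ _ h.rel)
    rw [← e1, ← e2]
    exact K.comp _ _ _ _ hf'
  refine ⟨?_, f', hf', e3⟩
  obtain ⟨σ, h1, h2, h3⟩ := h.lift _ _ _ hf'
  have e4 : σ ≫ p = W.ι := by
    rw [hp]
    apply PLine.hom_ext <;> simp only [Category.assoc, PLine.lift_proj, PLine.lift_toP1, h1, h2]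
  have hr : Set.range σ ⊆ Set.range (p ⁻¹ᵁ W).ι := by
    rw [Scheme.Opens.range_ι]
    rintro _ ⟨x, rfl⟩
    change p (σ x) ∈ W
    rw [← Scheme.Hom.comp_apply, e4]
    exact x.2
  refine isIso_of_section _ (IsOpenImmersion.lift (p ⁻¹ᵁ W).ι σ hr) ?_ ?_
  · rw [← cancel_mono W.ι, Category.assoc, morphismRestrict_ι, IsOpenImmersion.lift_fac_assoc, e4,
      Category.id_comp]
  · rw [← cancel_mono (p ⁻¹ᵁ W).ι, Category.assoc, IsOpenImmersion.lift_fac, Category.id_comp]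
    refine h.ext _ _ ?_ ?_ ?_
    · rw [Category.assoc, h1, e1]
    · rw [Category.assoc, h2, e2]
    · rw [Category.assoc, h3, e3]

end Correspondence

/-! ### The ring of a hyperbola -/

section Hyperbola

open LaurentPolynomial

lemma isReduced_laurentPolynomial {R : Type u} [CommRing R] [IsReduced R] : IsReduced R[T;T⁻¹] := by
  refine ⟨fun f hf => ?_⟩
  obtain ⟨n, f', h⟩ := exists_T_pow f
  have h1 : IsNilpotent f' := by
    rw [← IsNilpotent.map_iff (f := (Polynomial.toLaurent : Polynomial R →+* _))
      Polynomial.toLaurent_injective, h]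
    exact (Commute.all _ _).isNilpotent_mul_right hf
  have h2 : f' = 0 := by
    ext i
    exact ((Polynomial.isNilpotent_iff.mp h1) i).eq_zero
  rw [h2, map_zero] at h
  exact ((isUnit_T n).mul_left_eq_zero).mp h.symm

variable {R : Type u} [CommRing R] (d : R)

/-- The ring `R[u, v] / (u v - d)`. -/
def Hyperbola : Type u :=
  MvPolynomial (Fin 2) R ⧸ Ideal.span {(MvPolynomial.X 0 * MvPolynomial.X 1 - MvPolynomial.C d :
    MvPolynomial (Fin 2) R)}

namespace Hyperbola

instance : CommRing (Hyperbola d) := inferInstanceAs (CommRing (_ ⧸ _))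

instance : Algebra R (Hyperbola d) := inferInstanceAs (Algebra R (_ ⧸ _))

/-- The projection from the polynomial ring. -/
def mk : MvPolynomial (Fin 2) R →+* Hyperbola d := Ideal.Quotient.mk _

/-- The two coordinate functions. -/
def coord (i : Fin 2) : Hyperbola d := mk d (MvPolynomial.X i)

lemma coord_mul_coord : coord d 0 * coord d 1 = algebraMap R (Hyperbola d) d := by
  rw [coord, coord, ← map_mul]
  exact Ideal.Quotient.eq.mpr (Ideal.mem_span_singleton_self _)

variable {d} in
lemma hom_ext {B : Type*} [CommRing B] {f g : Hyperbola d →+* B}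
    (h : f.comp (algebraMap R (Hyperbola d)) = g.comp (algebraMap R (Hyperbola d)))
    (h' : ∀ i, f (coord d i) = g (coord d i)) : f = g :=
  Ideal.Quotient.ringHom_ext (MvPolynomial.ringHom_ext (fun r => DFunLike.congr_fun h r) h')

variable {d} in
lemma exists_hom {B : Type*} [CommRing B] (φ : R →+* B) (b : Fin 2 → B) (h : b 0 * b 1 = φ d) :
    ∃ f : Hyperbola d →+* B, f.comp (algebraMap R (Hyperbola d)) = φ ∧
      ∀ i, f (coord d i) = b i := by
  refine ⟨Ideal.Quotient.lift _ (MvPolynomial.eval₂Hom φ b) ?_, ?_, ?_⟩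
  · intro a ha
    obtain ⟨c, rfl⟩ := Ideal.mem_span_singleton.mp ha
    simp [h]
  · ext r
    change (MvPolynomial.eval₂Hom φ b) (MvPolynomial.C r) = _
    simp
  · intro i
    change (MvPolynomial.eval₂Hom φ b) (MvPolynomial.X i) = _
    simp

/-- The monomial `u ^ n` for `n ≥ 0` and `v ^ (-n)` for `n < 0`. -/
def mono (n : ℤ) : Hyperbola d :=
  if 0 ≤ n then coord d 0 ^ n.toNat else coord d 1 ^ (-n).toNat

lemma pow_mul_pow_mem (a b : ℕ) : coord d 0 ^ a * coord d 1 ^ b ∈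
    Submodule.span R (Set.range (mono d)) := by
  rcases le_total b a with h | h
  · obtain ⟨c, rfl⟩ := Nat.exists_eq_add_of_le h
    have : coord d 0 ^ (b + c) * coord d 1 ^ b = d ^ b • mono d c := by
      rw [Algebra.smul_def, map_pow, ← coord_mul_coord, mono, if_pos (by positivity),
        Int.toNat_natCast]
      ring
    rw [this]
    exact Submodule.smul_mem _ _ (Submodule.subset_span ⟨_, rfl⟩)
  · obtain ⟨c, rfl⟩ := Nat.exists_eq_add_of_le h
    have : coord d 0 ^ a * coord d 1 ^ (a + c) = d ^ a • mono d (-c) := by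
      rw [Algebra.smul_def, map_pow, ← coord_mul_coord, mono]
      rcases Nat.eq_zero_or_pos c with rfl | hc
      · simp [mul_pow]
      · rw [if_neg (by lia), neg_neg, Int.toNat_natCast]
        ring
    rw [this]
    exact Submodule.smul_mem _ _ (Submodule.subset_span ⟨_, rfl⟩)

/-- A product of powers of `u` and `v` is a scalar multiple of a power of one of them, since `u v =
d`. -/
lemma span_mono : Submodule.span R (Set.range (mono d)) = ⊤ := by
  rw [eq_top_iff]
  rintro x -
  obtain ⟨p, rfl⟩ := Ideal.Quotient.mk_surjective x
  change mk d p ∈ _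
  induction p using MvPolynomial.induction_on' with
  | add p q hp hq => rw [map_add]; exact add_mem hp hq
  | monomial m r =>
    have : mk d (MvPolynomial.monomial m r) =
        r • (coord d 0 ^ m 0 * coord d 1 ^ m 1) := by
      rw [MvPolynomial.monomial_eq, Finsupp.prod_fintype _ _ (by simp), Fin.prod_univ_two,
        Algebra.smul_def]
      simp only [map_mul, map_pow]
      rfl
    rw [this]
    exact Submodule.smul_mem _ _ (pow_mul_pow_mem d _ _)

/-- The two morphisms `u ↦ T, v ↦ d T⁻¹` and `u ↦ d T⁻¹, v ↦ T` to the Laurent polynomials. -/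
lemma exists_toLaurent : ∃ f : Fin 2 → Hyperbola d →+* R[T;T⁻¹],
    (∀ i, (f i).comp (algebraMap R (Hyperbola d)) = algebraMap R R[T;T⁻¹]) ∧
    f 0 (coord d 0) = T 1 ∧ f 0 (coord d 1) = C d * T (-1) ∧
    f 1 (coord d 0) = C d * T (-1) ∧ f 1 (coord d 1) = T 1 ∧
    (∀ (c : ℤ →₀ R) (n : ℤ), 0 ≤ n →
      (f 0 (Finsupp.linearCombination R (mono d) c)).coeff n = c n) ∧
    (∀ (c : ℤ →₀ R) (n : ℤ), n < 0 →
      (f 1 (Finsupp.linearCombination R (mono d) c)).coeff (-n) = c n) := by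
  obtain ⟨f, hf, hf'⟩ := exists_hom (d := d) (algebraMap R R[T;T⁻¹]) ![T 1, C d * T (-1)] (by
    have : (T 1 * T (-1) : R[T;T⁻¹]) = 1 := by rw [← T_add]; simp
    simp only [Matrix.cons_val_zero, Matrix.cons_val_one]
    change _ = C d
    linear_combination C d * this)
  obtain ⟨g, hg, hg'⟩ := exists_hom (d := d) (algebraMap R R[T;T⁻¹]) ![C d * T (-1), T 1] (by
    have : (T 1 * T (-1) : R[T;T⁻¹]) = 1 := by rw [← T_add]; simp
    simp only [Matrix.cons_val_zero, Matrix.cons_val_one]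
    change _ = C d
    linear_combination C d * this)
  have hT : ∀ n : ℕ, (C d * T (-1) : R[T;T⁻¹]) ^ n = C (d ^ n) * T (-n) := fun n => by
    rw [mul_pow, T_pow, ← map_pow]; simp
  refine ⟨![f, g], ?_, hf' 0, hf' 1, hg' 0, hg' 1, ?_, ?_⟩
  · intro i; fin_cases i
    exacts [hf, hg]
  · intro c n hn
    induction c using Finsupp.induction_linear with
    | zero => simp
    | add c c' h h' => simp_all
    | single m r =>
      simp only [Finsupp.linearCombination_single, Algebra.smul_def, map_mul, Matrix.cons_val_zero]
      have e : f (algebraMap R (Hyperbola d) r) = C r := DFunLike.congr_fun hf r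
      rw [e, mono]
      split_ifs with hm
      · rw [map_pow, hf' 0, Matrix.cons_val_zero, T_pow, mul_one, Int.toNat_of_nonneg hm,
          ← single_eq_C_mul_T]
        rfl
      · rw [map_pow, hf' 1, Matrix.cons_val_one, Matrix.cons_val_zero, hT, ← mul_assoc, ← map_mul,
          ← single_eq_C_mul_T, AddMonoidAlgebra.coeff_single, Finsupp.single_apply,
          Finsupp.single_apply, if_neg (by lia), if_neg (by lia)]
  · intro c n hn
    induction c using Finsupp.induction_linear with
    | zero => simp
    | add c c' h h' => simp_all
    | single m r =>
      simp only [Finsupp.linearCombination_single, Algebra.smul_def, map_mul, Matrix.cons_val_one, Matrix.cons_val_zero]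
      have e : g (algebraMap R (Hyperbola d) r) = C r := DFunLike.congr_fun hg r
      rw [e, mono]
      split_ifs with hm
      · rw [map_pow, hg' 0, Matrix.cons_val_zero, hT, ← mul_assoc, ← map_mul,
          ← single_eq_C_mul_T, AddMonoidAlgebra.coeff_single, Finsupp.single_apply,
          Finsupp.single_apply, if_neg (by lia), if_neg (by lia)]
      · rw [map_pow, hg' 1, Matrix.cons_val_one, Matrix.cons_val_zero, T_pow, mul_one,
          Int.toNat_of_nonneg (by lia), ← single_eq_C_mul_T, AddMonoidAlgebra.coeff_single,
          Finsupp.single_apply, Finsupp.single_apply]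
        simp only [neg_inj]

/-- The coefficient of `u ^ n` can be read off from the first of the two Laurent polynomials, that
of `v ^ n` from the second. -/
lemma linearIndependent_mono : LinearIndependent R (mono d) := by
  obtain ⟨f, -, -, -, -, -, h, h'⟩ := exists_toLaurent d
  rw [linearIndependent_iff]
  intro c hc
  ext n
  rcases le_or_gt 0 n with hn | hn
  · rw [← h c n hn, hc]; simp
  · rw [← h' c n hn, hc]; simp

lemma free : Module.Free R (Hyperbola d) :=
  .of_basis (Module.Basis.mk (linearIndependent_mono d) (span_mono d).ge)

/-- The hyperbola embeds into the product of the coordinate rings of two punctured lines. -/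
lemma exists_toLaurent_injective : ∃ f : Fin 2 → Hyperbola d →+* R[T;T⁻¹],
    (∀ i, (f i).comp (algebraMap R (Hyperbola d)) = algebraMap R R[T;T⁻¹]) ∧
    f 0 (coord d 1) = C d * T (-1) ∧ f 1 (coord d 0) = C d * T (-1) ∧
    ∀ x, (∀ i, f i x = 0) → x = 0 := by
  obtain ⟨f, h0, -, h1, h2, -, h, h'⟩ := exists_toLaurent d
  refine ⟨f, h0, h1, h2, fun x hx => ?_⟩
  have hmem : x ∈ Submodule.span R (Set.range (mono d)) := span_mono d ▸ trivial
  rw [← Finsupp.range_linearCombination] at hmem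
  obtain ⟨c, rfl⟩ := hmem
  have : c = 0 := by
    ext n
    rcases le_or_gt 0 n with hn | hn
    · rw [← h c n hn, hx]; simp
    · rw [← h' c n hn, hx]; simp
  rw [this, map_zero]

lemma isReduced [IsReduced R] : IsReduced (Hyperbola d) := by
  obtain ⟨f, -, -, -, h⟩ := exists_toLaurent_injective d
  have := isReduced_laurentPolynomial (R := R)
  refine ⟨fun x hx => h x fun i => (hx.map (f i)).eq_zero⟩

end Hyperbola

end Hyperbola

/-! ### Affine charts of a conic -/

/-- A monomorphism that lands in an open subset, over which it has a section, is an open immersion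
onto this subset. -/
lemma isOpenImmersion_of_section {S X : Scheme.{u}} (c : S ⟶ X) (O : X.Opens)
    (hO : ∀ s, c s ∈ O) (hc : ∀ ⦃T : Scheme.{u}⦄ (p q : T ⟶ S), p ≫ c = q ≫ c → p = q)
    (σ : (O : Scheme.{u}) ⟶ S) (hσ : σ ≫ c = O.ι) : IsOpenImmersion c ∧ Set.range c = O := by
  have hr : Set.range c ⊆ Set.range O.ι := by
    rw [Scheme.Opens.range_ι]
    rintro _ ⟨s, rfl⟩
    exact hO s
  have h1 : σ ≫ IsOpenImmersion.lift O.ι c hr = 𝟙 _ := by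
    rw [← cancel_mono O.ι, Category.assoc, IsOpenImmersion.lift_fac, hσ, Category.id_comp]
  have h2 : IsOpenImmersion.lift O.ι c hr ≫ σ = 𝟙 _ := by
    apply hc
    rw [Category.assoc, hσ, IsOpenImmersion.lift_fac, Category.id_comp]
  have : IsIso (IsOpenImmersion.lift O.ι c hr) := isIso_of_section _ σ h1 h2
  have h3 : IsOpenImmersion (IsOpenImmersion.lift O.ι c hr ≫ O.ι) := inferInstance
  rw [IsOpenImmersion.lift_fac] at h3
  refine ⟨h3, subset_antisymm ?_ ?_⟩
  · rintro _ ⟨s, rfl⟩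
    exact hO s
  · intro x hx
    exact ⟨σ ⟨x, hx⟩, congrArg (fun f : (O : Scheme.{u}) ⟶ X => f ⟨x, hx⟩) hσ⟩

/-- Global functions on an affine scheme. -/
abbrev specFun {A : Type u} [CommRing A] (a : A) : Γ(Spec (.of A), ⊤) :=
  (Scheme.ΓSpecIso (.of A)).inv a

lemma appTop_toSpecΓ_SpecMap {T : Scheme.{u}} {A : CommRingCat.{u}} (φ : A ⟶ Γ(T, ⊤)) (a : A) :
    (T.toSpecΓ ≫ Spec.map φ).appTop ((Scheme.ΓSpecIso A).inv a) = φ a := by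
  have : (Scheme.ΓSpecIso A).inv ≫ (T.toSpecΓ ≫ Spec.map φ).appTop = φ := by
    rw [Scheme.Hom.comp_appTop, ← Category.assoc, ← Scheme.ΓSpecIso_inv_naturality, Category.assoc,
      Scheme.toSpecΓ_appTop]
    simp
  rw [← CommRingCat.comp_apply, this]

lemma SpecMap_appTop_specFun {A B : Type u} [CommRing A] [CommRing B] (r : A →+* B) (a : A) :
    (Spec.map (CommRingCat.ofHom r)).appTop (specFun a) = specFun (r a) := by
  have := Scheme.ΓSpecIso_inv_naturality (CommRingCat.ofHom r)
  exact (DFunLike.congr_fun (congrArg CommRingCat.Hom.hom this) a).symm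

lemma exists_specFun_eq {A : Type u} [CommRing A] (a : Γ(Spec (.of A), ⊤)) :
    ∃ a' : A, specFun a' = a := ⟨(Scheme.ΓSpecIso (.of A)).hom a, by simp [specFun]⟩

lemma specFun_one {A : Type u} [CommRing A] : specFun (1 : A) = 1 := map_one _

lemma specFun_zero {A : Type u} [CommRing A] : specFun (0 : A) = 0 := map_zero _

lemma specFun_mul {A : Type u} [CommRing A] (a b : A) : specFun (a * b) = specFun a * specFun b :=
  map_mul _ _ _

lemma specFun_injective {A : Type u} [CommRing A] : Function.Injective (specFun : A → _) :=
  (ConcreteCategory.bijective_of_isIso (Scheme.ΓSpecIso (.of A)).inv).1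

lemma span_eq_top_of_eq_one {R : Type*} [CommRing R] {a : Fin 2 → R} {i : Fin 2} (h : a i = 1) :
    Ideal.span (Set.range a) = ⊤ :=
  Ideal.eq_top_of_isUnit_mem _ (Ideal.subset_span ⟨i, rfl⟩) (h ▸ isUnit_one)

lemma HasCoords.ext_of_eq_one {T : Scheme.{u}} {f g : T ⟶ P1.{u}} {a b : Fin 2 → Γ(T, ⊤)}
    (h : HasCoords f a) (h' : HasCoords g b) {i : Fin 2} (ha : a i = 1) (hb : b i = 1)
    (hfg : f = g) : a = b := by
  have := (h.eq_iff h').mp hfg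
  funext k
  fin_cases i <;> fin_cases k <;> simp_all

namespace Correspondence

variable {R : Type u} [CommRing R] {X : Scheme.{u}}

/-- `X` over `Spec R` with the two points `α, β` of the projective line represents the conic
`x_0 x'_0 = d x_1 x'_1`. -/
structure IsConicModel (d : R) (π : X ⟶ Spec (.of R)) (α β : X ⟶ P1.{u}) : Prop where
  rel : Conic (π.appTop (specFun d)) α β
  lift : ∀ ⦃T : Scheme.{u}⦄ (t : T ⟶ Spec (.of R)) (f f' : T ⟶ P1.{u}),
    Conic (t.appTop (specFun d)) f f' → ∃ γ : T ⟶ X, γ ≫ π = t ∧ γ ≫ α = f ∧ γ ≫ β = f'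
  ext : ∀ ⦃T : Scheme.{u}⦄ (γ γ' : T ⟶ X), γ ≫ π = γ' ≫ π → γ ≫ α = γ' ≫ α → γ ≫ β = γ' ≫ β →
    γ = γ'

variable {d : R} {π : X ⟶ Spec (.of R)} {α β : X ⟶ P1.{u}}

/-- The part of the conic where `x_i ≠ 0` and `x'_{i'} ≠ 0` is the spectrum of any `R`-algebra with
the universal property. -/
lemma IsConicModel.exists_chart (h : IsConicModel d π α β) {A : Type u} [CommRing A] (ψ : R →+* A)
    (w w' : Fin 2 → A) {i i' : Fin 2} (hw : w i = 1) (hw' : w' i' = 1)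
    (hc : w 0 * w' 0 = ψ d * (w 1 * w' 1))
    (hext : ∀ (B : Type u) [CommRing B] (f g : A →+* B), f.comp ψ = g.comp ψ →
      (∀ k, f (w k) = g (w k)) → (∀ k, f (w' k) = g (w' k)) → f = g)
    (hex : ∀ (B : Type u) [CommRing B] (φ : R →+* B) (b b' : Fin 2 → B), b i = 1 → b' i' = 1 →
      b 0 * b' 0 = φ d * (b 1 * b' 1) → ∃ f : A →+* B, f.comp ψ = φ ∧ (∀ k, f (w k) = b k) ∧
        ∀ k, f (w' k) = b' k) :
    ∃ c : Spec (.of A) ⟶ X, IsOpenImmersion c ∧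
      Set.range c = (α ⁻¹ᵁ chartOpen i ⊓ β ⁻¹ᵁ chartOpen i' : X.Opens) ∧
      c ≫ π = Spec.map (CommRingCat.ofHom ψ) ∧
      HasCoords (c ≫ α) (fun k => specFun (w k)) ∧ HasCoords (c ≫ β) (fun k => specFun (w' k)) := by
  have h1 : (specFun (w i)) = 1 := by rw [hw, specFun_one]
  have h1' : (specFun (w' i')) = 1 := by rw [hw', specFun_one]
  have hα := hasCoords_homogPoint (fun k => specFun (w k)) (span_eq_top_of_eq_one (i := i) h1)
  have hβ := hasCoords_homogPoint (fun k => specFun (w' k)) (span_eq_top_of_eq_one (i := i') h1')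
  obtain ⟨c, e0, e1, e2⟩ := h.lift (Spec.map (CommRingCat.ofHom ψ)) _ _ ((hα.conic_iff hβ).mpr (by
    rw [SpecMap_appTop_specFun, ← specFun_mul, ← specFun_mul, ← specFun_mul, hc]))
  rw [← e1] at hα
  rw [← e2] at hβ
  set O : X.Opens := α ⁻¹ᵁ chartOpen i ⊓ β ⁻¹ᵁ chartOpen i'
  obtain ⟨b, hb, hb1⟩ := exists_hasCoords_of_chart (O.ι ≫ α) i (TopologicalSpace.Opens.ext (Set.eq_univ_of_forall fun x => x.2.1))
  obtain ⟨b', hb', hb1'⟩ := exists_hasCoords_of_chart (O.ι ≫ β) i' (TopologicalSpace.Opens.ext (Set.eq_univ_of_forall fun x => x.2.2))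
  obtain ⟨φ, hφ⟩ := exists_toSpecΓ_SpecMap (O.ι ≫ π)
  have hbb := ((hb1.conic_iff hb1').mp (h.rel.comp O.ι))
  rw [← CommRingCat.comp_apply, ← Scheme.Hom.comp_appTop, hφ, appTop_toSpecΓ_SpecMap] at hbb
  obtain ⟨f, hf, hf1, hf2⟩ := hex Γ(O, ⊤) φ.hom b b' hb hb' hbb
  let f' : CommRingCat.of A ⟶ Γ(O, ⊤) := CommRingCat.ofHom f
  have hf' : CommRingCat.ofHom ψ ≫ f' = φ := CommRingCat.hom_ext hf
  have hσ : ∀ a : A, ((O : Scheme.{u}).toSpecΓ ≫ Spec.map f').appTop (specFun a) = f a :=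
    fun a => appTop_toSpecΓ_SpecMap f' a
  refine ⟨c, ?_⟩
  rw [← and_assoc]
  refine ⟨isOpenImmersion_of_section c O (fun s => ?_) (fun T p q hpq => ?_)
    ((O : Scheme.{u}).toSpecΓ ≫ Spec.map f') ?_, e0, hα, hβ⟩
  · constructor
    · have : s ∈ (c ≫ α) ⁻¹ᵁ chartOpen i := by
        rw [hα.preimage, h1, Scheme.basicOpen_of_isUnit _ isUnit_one]; trivial
      exact this
    · have : s ∈ (c ≫ β) ⁻¹ᵁ chartOpen i' := by
        rw [hβ.preimage, h1', Scheme.basicOpen_of_isUnit _ isUnit_one]; trivial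
      exact this
  · have key : ∀ {f : Spec (.of A) ⟶ P1.{u}} {a : Fin 2 → A} {j : Fin 2}, a j = 1 →
        HasCoords f (fun k => specFun (a k)) → p ≫ f = q ≫ f →
        ∀ k, p.appTop (specFun (a k)) = q.appTop (specFun (a k)) := by
      intro f a j haj ha e k
      refine congrFun ((ha.comp p).ext_of_eq_one (ha.comp q) (i := j) ?_ ?_ e) k
      · simp only [pb_apply]
        rw [haj, specFun_one, map_one]
      · simp only [pb_apply]
        rw [haj, specFun_one, map_one]
    have k1 := key hw hα (by rw [← Category.assoc, hpq, Category.assoc])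
    have k2 := key hw' hβ (by rw [← Category.assoc, hpq, Category.assoc])
    have k3 : p ≫ Spec.map (CommRingCat.ofHom ψ) = q ≫ Spec.map (CommRingCat.ofHom ψ) := by
      rw [← e0, ← Category.assoc, hpq, Category.assoc]
    obtain ⟨φp, rfl⟩ := exists_toSpecΓ_SpecMap p
    obtain ⟨φq, rfl⟩ := exists_toSpecΓ_SpecMap q
    simp only [appTop_toSpecΓ_SpecMap] at k1 k2
    have := hext _ φp.hom φq.hom ?_ k1 k2
    · rw [CommRingCat.hom_ext this]
    · rw [Category.assoc, Category.assoc, ← Spec.map_comp, ← Spec.map_comp] at k3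
      exact congrArg CommRingCat.Hom.hom (toSpecΓ_SpecMap_injective k3)
  · refine h.ext _ _ ?_ ?_ ?_
    · rw [Category.assoc, e0, Category.assoc, ← Spec.map_comp, hf', hφ]
    · rw [Category.assoc]
      refine (((hα.comp _).eq_iff hb1).mpr ?_)
      simp only [pb_apply, hσ, hf1]
      ring
    · rw [Category.assoc]
      refine (((hβ.comp _).eq_iff hb1').mpr ?_)
      simp only [pb_apply, hσ, hf2]
      ring

lemma isReduced_polynomial {R : Type u} [CommRing R] [IsReduced R] : IsReduced (Polynomial R) :=
  ⟨fun f hf => by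
    ext i
    exact ((Polynomial.isNilpotent_iff.mp hf) i).eq_zero⟩

/-- The conic is covered by three affine charts: the hyperbola `u v = d`, where `x_1` and `x'_1` are
invertible, and two affine lines. They are flat and inherit reducedness. If `d = 0`, then a function
on a chart vanishes as soon as its pullbacks to all affine schemes over the two lines `x_0 = 0` and
`x'_0 = 0` vanish. -/
lemma IsConicModel.exists_flat_chart (h : IsConicModel d π α β) (x : X) :
    ∃ (A : Type u) (_ : CommRing A) (ψ : R →+* A) (c : Spec (.of A) ⟶ X), IsOpenImmersion c ∧
      x ∈ Set.range c ∧ c ≫ π = Spec.map (CommRingCat.ofHom ψ) ∧ ψ.Flat ∧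
      (IsReduced R → IsReduced A) ∧
      (d = 0 → ∀ z : A, (∀ (B : Type u) [CommRing B] (r : A →+* B),
        (Spec.map (CommRingCat.ofHom r) ≫ c ≫ β = zeroPt _ ∨
          Spec.map (CommRingCat.ofHom r) ≫ c ≫ α = zeroPt _) → r z = 0) → z = 0) := by
  have hcov : ∀ p : P1.{u}, p ∈ chartOpen.{u} 0 ∨ p ∈ chartOpen.{u} 1 := fun p => by
    have : p ∈ chartOpen.{u} 0 ⊔ chartOpen.{u} 1 := iSup_chartOpen ▸ trivial
    exact this
  -- a point with `x_0, x'_0 ≠ 0` has `x_1, x'_1 ≠ 0`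
  have h00 : α x ∈ chartOpen 0 → β x ∈ chartOpen 0 → α x ∈ chartOpen 1 ∧ β x ∈ chartOpen 1 := by
    intro hα hβ
    set O : X.Opens := α ⁻¹ᵁ chartOpen 0 ⊓ β ⁻¹ᵁ chartOpen 0
    obtain ⟨b, hb, hb1⟩ := exists_hasCoords_of_chart (O.ι ≫ α) 0
      (TopologicalSpace.Opens.ext (Set.eq_univ_of_forall fun x => x.2.1))
    obtain ⟨b', hb', hb1'⟩ := exists_hasCoords_of_chart (O.ι ≫ β) 0
      (TopologicalSpace.Opens.ext (Set.eq_univ_of_forall fun x => x.2.2))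
    have hbb := ((hb1.conic_iff hb1').mp (h.rel.comp O.ι))
    rw [hb, hb', one_mul] at hbb
    have m1 : (⟨x, hα, hβ⟩ : O) ∈ (O.ι ≫ α) ⁻¹ᵁ chartOpen 1 := by
      rw [hb1.preimage, Scheme.basicOpen_of_isUnit _ (IsUnit.of_mul_eq_one
        (O.ι.appTop (π.appTop (specFun d)) * b' 1) (by rw [hbb]; ring))]
      trivial
    have m2 : (⟨x, hα, hβ⟩ : O) ∈ (O.ι ≫ β) ⁻¹ᵁ chartOpen 1 := by
      rw [hb1'.preimage, Scheme.basicOpen_of_isUnit _ (IsUnit.of_mul_eq_one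
        (O.ι.appTop (π.appTop (specFun d)) * b 1) (by rw [hbb]; ring))]
      trivial
    exact ⟨m1, m2⟩
  have hcases : (α x ∈ chartOpen 1 ∧ β x ∈ chartOpen 1) ∨ (α x ∈ chartOpen 0 ∧ β x ∈ chartOpen 1) ∨
      (α x ∈ chartOpen 1 ∧ β x ∈ chartOpen 0) := by
    have := hcov (α x)
    have := hcov (β x)
    tauto
  have hpoly : ∀ {A : Type u} [CommRing A] (f g : Polynomial R →+* A),
      f.comp Polynomial.C = g.comp Polynomial.C → f Polynomial.X = g Polynomial.X → f = g :=
    fun f g h h' => Polynomial.ringHom_ext (fun r => DFunLike.congr_fun h r) h'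
  have hzero : ∀ {B : Type u} [CommRing B] {A : Type u} [CommRing A] (r : A →+* B)
      {f : Spec (.of A) ⟶ P1.{u}} {w : Fin 2 → A}, HasCoords f (fun k => specFun (w k)) →
      r (w 0) = 0 → Spec.map (CommRingCat.ofHom r) ≫ f = zeroPt _ := by
    intro B _ A _ r f w hf hr
    rw [(hf.comp _).eq_zeroPt_iff, pb_apply, SpecMap_appTop_specFun, hr, specFun_zero]
  rcases hcases with hx | hx | hx
  · obtain ⟨c, hc, hr, hπ, hα, hβ⟩ := h.exists_chart (A := Hyperbola d) (i := 1) (i' := 1)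
      (algebraMap R _) ![Hyperbola.coord d 0, 1] ![Hyperbola.coord d 1, 1] rfl rfl
      (by simpa using Hyperbola.coord_mul_coord d)
      (fun B _ f g e e1 e2 => Hyperbola.hom_ext e fun i => by
        fin_cases i
        exacts [e1 0, e2 0])
      (fun B _ φ b b' hb hb' e => by
        obtain ⟨f, hf, hf'⟩ := Hyperbola.exists_hom φ ![b 0, b' 0] (by
          rw [hb, hb', mul_one, mul_one] at e
          exact e)
        refine ⟨f, hf, fun k => ?_, fun k => ?_⟩
        · fin_cases k
          · exact hf' 0
          · exact (map_one f).trans hb.symm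
        · fin_cases k
          · exact hf' 1
          · exact (map_one f).trans hb'.symm)
    have := Hyperbola.free d
    refine ⟨_, _, _, c, hc, by rw [hr]; exact hx, hπ, RingHom.flat_algebraMap_iff.mpr inferInstance,
      fun _ => Hyperbola.isReduced d, fun hd z hz => ?_⟩
    obtain ⟨f, -, h1, h2, hinj⟩ := Hyperbola.exists_toLaurent_injective d
    refine hinj z fun i => hz _ (f i) ?_
    fin_cases i
    · exact Or.inl (hzero _ hβ (by
        change f 0 (Hyperbola.coord d 1) = 0
        rw [h1, hd, map_zero, zero_mul]))
    · exact Or.inr (hzero _ hα (by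
        change f 1 (Hyperbola.coord d 0) = 0
        rw [h2, hd, map_zero, zero_mul]))
  · obtain ⟨c, hc, hr, hπ, hα, hβ⟩ := h.exists_chart (A := Polynomial R) (i := 0) (i' := 1)
      Polynomial.C ![1, Polynomial.X] ![Polynomial.C d * Polynomial.X, 1] rfl rfl
      (by simp)
      (fun B _ f g e e1 e2 => hpoly f g e (e1 1))
      (fun B _ φ b b' hb hb' e => by
        refine ⟨Polynomial.eval₂RingHom φ (b 1), by ext; simp, fun k => ?_, fun k => ?_⟩
        · fin_cases k <;> simp [hb]
        · rw [hb, hb', one_mul, mul_one] at e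
          fin_cases k <;> simp [hb', e])
    refine ⟨_, _, _, c, hc, by rw [hr]; exact hx, hπ,
      RingHom.flat_algebraMap_iff (R := R) (S := Polynomial R) |>.mpr inferInstance,
      fun _ => isReduced_polynomial, fun hd z hz => ?_⟩
    refine hz _ (RingHom.id _) (Or.inl (hzero _ hβ ?_))
    simp [hd]
  · obtain ⟨c, hc, hr, hπ, hα, hβ⟩ := h.exists_chart (A := Polynomial R) (i := 1) (i' := 0)
      Polynomial.C ![Polynomial.C d * Polynomial.X, 1] ![1, Polynomial.X] rfl rfl
      (by simp)
      (fun B _ f g e e1 e2 => hpoly f g e (e2 1))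
      (fun B _ φ b b' hb hb' e => by
        refine ⟨Polynomial.eval₂RingHom φ (b' 1), by ext; simp, fun k => ?_, fun k => ?_⟩
        · rw [hb, hb', one_mul, mul_one] at e
          fin_cases k <;> simp [hb, e]
        · fin_cases k <;> simp [hb'])
    refine ⟨_, _, _, c, hc, by rw [hr]; exact hx, hπ,
      RingHom.flat_algebraMap_iff (R := R) (S := Polynomial R) |>.mpr inferInstance,
      fun _ => isReduced_polynomial, fun hd z hz => ?_⟩
    refine hz _ (RingHom.id _) (Or.inr (hzero _ hα ?_))
    simp [hd]

end Correspondence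

/-! ### Local structure of schemes -/

lemma isOpenCover_of_mem {X : Scheme.{u}} {V : X → X.Opens} (h : ∀ x, x ∈ V x) : ⨆ x, V x = ⊤ :=
  TopologicalSpace.Opens.ext (Set.eq_univ_of_forall fun x => by simpa using ⟨x, h x⟩)

lemma exists_affine_nhd {Y : Scheme.{u}} (V : Y.Opens) {y : Y} (hy : y ∈ V) :
    ∃ (R : Type u) (_ : CommRing R) (j : Spec (.of R) ⟶ Y) (k : Spec (.of R) ⟶ V),
      IsOpenImmersion j ∧ y ∈ Set.range j ∧ k ≫ V.ι = j := by
  obtain ⟨W, hW, hyW, hWV⟩ := exists_isAffineOpen_mem_and_subset hy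
  refine ⟨Γ(Y, W), inferInstance, hW.fromSpec, IsOpenImmersion.lift V.ι hW.fromSpec ?_,
    inferInstance, ?_, IsOpenImmersion.lift_fac _ _ _⟩
  · rw [hW.range_fromSpec, Scheme.Opens.range_ι]
    exact hWV
  · rw [hW.range_fromSpec]
    exact hyW

lemma isReduced_of_local {X : Scheme.{u}} (h : ∀ x : X, ∃ (S : Scheme.{u}) (c : S ⟶ X),
    IsOpenImmersion c ∧ x ∈ Set.range c ∧ IsReduced S) : IsReduced X := by
  choose S c hc hx hS using h
  have (x : X) : IsReduced (c x).opensRange := by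
    have h1 : IsOpenImmersion (IsOpenImmersion.lift (c x) (c x).opensRange.ι (by simp) ≫ c x) := by
      rw [IsOpenImmersion.lift_fac]; infer_instance
    have := IsOpenImmersion.of_comp (IsOpenImmersion.lift (c x) (c x).opensRange.ι _) (c x)
    exact isReduced_of_isOpenImmersion (IsOpenImmersion.lift (c x) (c x).opensRange.ι _)
  exact @IsReduced.of_openCover _ (X.openCoverOfIsOpenCover (fun x => (c x).opensRange)
    (isOpenCover_of_mem hx)) this

namespace Correspondence

variable {Y : Scheme.{u}} {K : Correspondence Y}

/-! ### Flatness and reducedness -/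

/-- A frame turns a scheme representing a correspondence into one representing a conic. -/
lemma isConicModel_of_frame {R : Type u} [CommRing R] {X : Scheme.{u}} {π : X ⟶ Spec (.of R)}
    {a b : X ⟶ P1.{u}} {j : Spec (.of R) ⟶ Y} (h : (K.pull j).IsModel π a b)
    (F : Frame K.rel j) {d : R} (hd : specFun d = F.d) :
    IsConicModel d π (act (pbGL π F.M) a) (act (pbGL π F.M') b) where
  rel := by
    rw [hd]
    exact (F.spec _ _ _).mp h.rel
  lift T t f f' hc := by
    rw [hd] at hc
    have e : act (pbGL t F.M) ((actEquiv (pbGL t F.M)).symm f) = f :=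
      (actEquiv (pbGL t F.M)).apply_symm_apply f
    have e' : act (pbGL t F.M') ((actEquiv (pbGL t F.M')).symm f') = f' :=
      (actEquiv (pbGL t F.M')).apply_symm_apply f'
    obtain ⟨γ, h1, h2, h3⟩ := h.lift t ((actEquiv (pbGL t F.M)).symm f)
      ((actEquiv (pbGL t F.M')).symm f') ((F.spec _ _ _).mpr (by rwa [e, e']))
    refine ⟨γ, h1, ?_, ?_⟩
    · rw [comp_act, ← pbGL_comp, h1, h2, e]
    · rw [comp_act, ← pbGL_comp, h1, h3, e']
  ext T γ γ' h1 h2 h3 := by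
    rw [comp_act, comp_act, ← pbGL_comp, ← pbGL_comp, h1] at h2 h3
    exact h.ext γ γ' h1 ((actEquiv _).injective h2) ((actEquiv _).injective h3)

variable {X : Scheme.{u}} {π : X ⟶ Y} {a b : X ⟶ P1.{u}}

/-- A scheme representing a correspondence is covered by spectra of flat algebras over affine
open subschemes of the base. These algebras inherit reducedness, and if both lines are contracted
then functions on them are determined by their restrictions to the two lines. -/
lemma IsModel.exists_flat_chart (h : K.IsModel π a b) (x : X) :
    ∃ (R A : Type u) (_ : CommRing R) (_ : CommRing A) (ψ : R →+* A) (j : Spec (.of R) ⟶ Y)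
      (c : Spec (.of A) ⟶ X), IsOpenImmersion j ∧ IsOpenImmersion c ∧ x ∈ Set.range c ∧
      c ≫ π = Spec.map (CommRingCat.ofHom ψ) ≫ j ∧ ψ.Flat ∧ (IsReduced R → IsReduced A) ∧
      (∀ κ κ' : Y ⟶ P1.{u}, K.Contr (𝟙 Y) κ' → K.swap.Contr (𝟙 Y) κ → ∀ z : A,
        (∀ (B : Type u) [CommRing B] (r : A →+* B),
          (Spec.map (CommRingCat.ofHom r) ≫ c ≫ b = Spec.map (CommRingCat.ofHom r) ≫ c ≫ π ≫ κ' ∨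
            Spec.map (CommRingCat.ofHom r) ≫ c ≫ a = Spec.map (CommRingCat.ofHom r) ≫ c ≫ π ≫ κ) →
          r z = 0) → z = 0) := by
  obtain ⟨V, hV, ⟨F⟩⟩ := K.frame (π x)
  obtain ⟨R, _, j, k, hj, ⟨y, hy⟩, rfl⟩ := exists_affine_nhd V hV
  obtain ⟨d, hd⟩ := exists_specFun_eq (F.comp k).d
  have sq := IsPullback.of_hasPullback π (k ≫ V.ι)
  have hm := isConicModel_of_frame (h.of_isPullback sq) (F.comp k) hd
  obtain ⟨x', hx', -⟩ := Scheme.Pullback.exists_preimage_pullback x y hy.symm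
  obtain ⟨A, _, ψ, c, hc, hxc, hπ, hflat, hred, hker⟩ := hm.exists_flat_chart x'
  set F' := F.comp k
  refine ⟨R, A, _, _, ψ, k ≫ V.ι, c ≫ pullback.fst _ _, hj, inferInstance, ?_, ?_, hflat, hred, ?_⟩
  · obtain ⟨s, hs⟩ := hxc
    exact ⟨s, by rw [Scheme.Hom.comp_apply, hs, hx']⟩
  · rw [Category.assoc, pullback.condition, ← Category.assoc, hπ]
  · intro κ κ' hκ' hκ z hz
    have h1 := hκ'.comp (k ≫ V.ι)
    have h2 := hκ.comp (k ≫ V.ι)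
    rw [Category.comp_id] at h1 h2
    rw [contr_iff F'] at h1
    rw [contr_iff (K := K.swap) F'.swap] at h2
    refine hker (specFun_injective (by rw [hd, h1.1, specFun_zero])) z fun B _ r hr => hz B r ?_
    have key : ∀ (M : GL (Fin 2) Γ(Spec (.of R), ⊤)) (e : X ⟶ P1.{u}) (κ : Y ⟶ P1.{u}),
        act M ((k ≫ V.ι) ≫ κ) = zeroPt _ →
        Spec.map (CommRingCat.ofHom r) ≫ c ≫ act (pbGL (pullback.snd π (k ≫ V.ι)) M)
          (pullback.fst π (k ≫ V.ι) ≫ e) = zeroPt _ →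
        Spec.map (CommRingCat.ofHom r) ≫ (c ≫ pullback.fst π (k ≫ V.ι)) ≫ e =
          Spec.map (CommRingCat.ofHom r) ≫ (c ≫ pullback.fst π (k ≫ V.ι)) ≫ π ≫ κ := by
      intro M e κ hM hr
      have e1 : pullback.fst π (k ≫ V.ι) ≫ π ≫ κ = pullback.snd π (k ≫ V.ι) ≫ (k ≫ V.ι) ≫ κ := by
        rw [← Category.assoc, pullback.condition, Category.assoc]
      rw [Category.assoc, Category.assoc, e1]
      rw [comp_act, comp_act] at hr
      refine (actEquiv _).injective (hr.trans ?_)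
      rw [← comp_zeroPt (Spec.map (CommRingCat.ofHom r) ≫ c ≫ pullback.snd π (k ≫ V.ι)), ← hM,
        comp_act, pbGL_comp, pbGL_comp]
      simp only [Category.assoc]
      rfl
    exact hr.imp (key _ _ _ h1.2) (key _ _ _ h2.2)

lemma IsModel.flat (h : K.IsModel π a b) : Flat π := by
  choose R A _ _ ψ j c hj hc hx e hf _ using h.exists_flat_chart
  have : IsZariskiLocalAtSource (@Flat : MorphismProperty Scheme.{u}) :=
    HasRingHomProperty.instIsZariskiLocalAtSource
  refine IsZariskiLocalAtSource.of_iSup_eq_top (P := @Flat) (fun x => (c x).opensRange)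
    (isOpenCover_of_mem hx) fun x => ?_
  obtain ⟨k, hk⟩ : ∃ k, k ≫ c x = (c x).opensRange.ι :=
    ⟨IsOpenImmersion.lift (c x) (c x).opensRange.ι (by simp), IsOpenImmersion.lift_fac _ _ _⟩
  have : IsOpenImmersion (k ≫ c x) := by rw [hk]; infer_instance
  have : IsOpenImmersion k := IsOpenImmersion.of_comp k (c x)
  have : Flat (Spec.map (CommRingCat.ofHom (ψ x))) := Flat.SpecMap_iff.mpr (hf x)
  rw [← hk, Category.assoc, e]
  infer_instance

lemma IsModel.isReduced (h : K.IsModel π a b) [IsReduced Y] : IsReduced X := by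
  refine isReduced_of_local fun x => ?_
  obtain ⟨R, A, _, _, ψ, j, c, hj, hc, hx, -, -, hred, -⟩ := h.exists_flat_chart x
  have h1 : IsReduced (Spec (.of R)) := isReduced_of_isOpenImmersion j
  rw [affine_isReduced_iff] at h1
  exact ⟨_, c, hc, hx, (affine_isReduced_iff _).mpr (hred h1)⟩

/-- A base change to a field represents the base change of the correspondence, and its base is
reduced. -/
lemma IsModel.geometricallyReduced (h : K.IsModel π a b) : GeometricallyReduced π := by
  refine ⟨fun k _ y X' p π' sq => ?_⟩
  have : IsReduced (Spec (.of k)) := (affine_isReduced_iff _).mpr inferInstance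
  exact (h.of_isPullback sq).isReduced

/-! ### Chains of two projective lines -/

instance : P1.{u}.IsSeparated :=
  inferInstanceAs (Proj (MvPolynomial.homogeneousSubmodule (Fin 2) (ULift.{u} ℤ))).IsSeparated

instance (Y : Scheme.{u}) : IsSeparated (PLine.proj Y) := by
  have : IsSeparated (terminal.from P1.{u}) := Scheme.IsSeparated.isSeparated_terminal_from
  exact IsSeparated.isStableUnderBaseChange.of_isPullback (IsPullback.of_hasPullback _ _).flip this

instance (Y : Scheme.{u}) : IsSeparated (PSq.fst Y) := by
  exact IsSeparated.isStableUnderBaseChange.of_isPullback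
    (IsPullback.of_hasPullback (PLine.proj Y) (PLine.proj Y)).flip inferInstance

/-- If both lines are contracted, then the curve is the scheme-theoretic union of the two lines. -/
lemma IsModel.ker_inf_ker (h : K.IsModel π a b) {κ κ' : Y ⟶ P1.{u}} (hκ' : K.Contr (𝟙 Y) κ')
    (hκ : K.swap.Contr (𝟙 Y) κ) (δ δ' : PLine Y ⟶ X) [QuasiCompact δ] [QuasiCompact δ']
    (h1 : δ ≫ π = PLine.proj Y) (h2 : δ ≫ a = PLine.toP1 Y) (h3 : δ ≫ b = PLine.proj Y ≫ κ')
    (h1' : δ' ≫ π = PLine.proj Y) (h2' : δ' ≫ b = PLine.toP1 Y) (h3' : δ' ≫ a = PLine.proj Y ≫ κ) :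
    δ.ker ⊓ δ'.ker = ⊥ := by
  choose R A _ _ ψ j c hj hc hx e _ _ hinj using h.exists_flat_chart
  refine Scheme.IdealSheafData.ext_of_iSup_eq_top
    (fun x => ⟨c x ''ᵁ ⊤, (isAffineOpen_top _).image_of_isOpenImmersion (c x)⟩)
    (isOpenCover_of_mem fun x => let ⟨s, hs⟩ := hx x; ⟨s, trivial, hs⟩) fun x => eq_bot_iff.mpr ?_
  set U : X.Opens := c x ''ᵁ ⊤
  rintro g ⟨hg, hg'⟩
  replace hg : δ.app U g = 0 := Scheme.Hom.ideal_ker_le δ _ hg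
  replace hg' : δ'.app U g = 0 := Scheme.Hom.ideal_ker_le δ' _ hg'
  have hU : ⊤ ≤ c x ⁻¹ᵁ U := by rw [Scheme.Hom.preimage_image_eq]
  obtain ⟨z, hz⟩ := exists_specFun_eq ((c x).appLE U ⊤ hU g)
  -- a function that vanishes on a line vanishes on every point that factors through the line
  have hvan : ∀ (T : Scheme.{u}) (t : T ⟶ X) (m : T ⟶ PLine Y) (δ : PLine Y ⟶ X),
      m ≫ δ = t → δ.app U g = 0 → ∀ ht : ⊤ ≤ t ⁻¹ᵁ U, t.appLE U ⊤ ht g = 0 := by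
    rintro T _ m δ rfl hδ ht
    have e := Scheme.Hom.appLE_comp_appLE m δ U (δ ⁻¹ᵁ U) ⊤ le_rfl ht
    rw [← e, Scheme.Hom.appLE_eq_app]
    exact (congrArg (m.appLE (δ ⁻¹ᵁ U) ⊤ ht).hom hδ).trans (RingHom.map_zero _)
  have hz0 : z = 0 := by
    refine hinj x κ κ' hκ' hκ z fun B _ r hr => specFun_injective ?_
    have e1 := appLE_comp_appTop (c x) (Spec.map (CommRingCat.ofHom r)) hU
    rw [← SpecMap_appTop_specFun, hz, specFun_zero, ← CommRingCat.comp_apply, e1]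
    rcases hr with hr | hr
    · refine hvan _ _ (PLine.lift (Spec.map (CommRingCat.ofHom r) ≫ c x ≫ π)
        (Spec.map (CommRingCat.ofHom r) ≫ c x ≫ a)) δ (h.ext _ _ ?_ ?_ ?_) hg _
      · rw [Category.assoc, h1, PLine.lift_proj, Category.assoc]
      · rw [Category.assoc, h2, PLine.lift_toP1, Category.assoc]
      · rw [Category.assoc, h3, ← Category.assoc, PLine.lift_proj]
        simpa only [Category.assoc] using hr.symm
    · refine hvan _ _ (PLine.lift (Spec.map (CommRingCat.ofHom r) ≫ c x ≫ π)
        (Spec.map (CommRingCat.ofHom r) ≫ c x ≫ b)) δ' (h.ext _ _ ?_ ?_ ?_) hg' _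
      · rw [Category.assoc, h1', PLine.lift_proj, Category.assoc]
      · rw [Category.assoc, h3', ← Category.assoc, PLine.lift_proj]
        simpa only [Category.assoc] using hr.symm
      · rw [Category.assoc, h2', PLine.lift_toP1, Category.assoc]
  rw [hz0, specFun_zero] at hz
  have hinj' : Function.Injective ((c x).appLE U ⊤ hU) := by
    have := (ConcreteCategory.bijective_of_isIso ((c x).appIso ⊤).hom).1
    rwa [Scheme.Hom.appIso_hom'] at this
  exact hinj' (hz.symm.trans (map_zero _).symm)

/-- If both lines are contracted, to `κ` and `κ'`, then the pairs `(f, κ')` and `(κ, f')` lie on the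
correspondence. They form the two components of the chain, which meet in `(κ, κ')`. -/
lemma IsModel.isChain (h : K.IsModel π a b) [IsSeparated π] {κ κ' : Y ⟶ P1.{u}}
    (hκ' : K.Contr (𝟙 Y) κ') (hκ : K.swap.Contr (𝟙 Y) κ) {p p' : X ⟶ PLine Y}
    (hp : p = PLine.lift π a) (hp' : p' = PLine.lift π b) :
    IsChain p p' (Sec.ofPoint κ) (Sec.ofPoint κ') := by
  subst hp hp'
  obtain ⟨δ, h1, h2, h3⟩ := h.lift (PLine.proj Y) (PLine.toP1 Y) (PLine.proj Y ≫ κ') (by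
    have := hκ' _ (PLine.proj Y) (PLine.toP1 Y)
    rwa [Category.comp_id] at this)
  obtain ⟨δ', h1', h3', h2'⟩ := h.lift (PLine.proj Y) (PLine.proj Y ≫ κ) (PLine.toP1 Y) (by
    have := hκ _ (PLine.proj Y) (PLine.toP1 Y)
    rwa [Category.comp_id] at this)
  have hδ : δ ≫ PLine.lift π a = 𝟙 _ := by
    rw [PLine.comp_lift, h1, h2, PLine.eq_lift (𝟙 _), Category.id_comp, Category.id_comp]
  have hδ' : δ' ≫ PLine.lift π b = 𝟙 _ := by
    rw [PLine.comp_lift, h1', h2', PLine.eq_lift (𝟙 _), Category.id_comp, Category.id_comp]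
  have hsep : ∀ a : X ⟶ P1.{u}, IsSeparated (PLine.lift π a) := fun a => by
    have : IsSeparated (PLine.lift π a ≫ PLine.proj Y) := by rw [PLine.lift_proj]; infer_instance
    exact IsSeparated.of_comp _ (PLine.proj Y)
  have hcl : IsClosedImmersion δ := by
    have : IsClosedImmersion (δ ≫ PLine.lift π a) := by rw [hδ]; infer_instance
    have := hsep a
    exact IsClosedImmersion.of_comp _ (PLine.lift π a)
  have hcl' : IsClosedImmersion δ' := by
    have : IsClosedImmersion (δ' ≫ PLine.lift π b) := by rw [hδ']; infer_instance
    have := hsep b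
    exact IsClosedImmersion.of_comp _ (PLine.lift π b)
  refine ⟨_, _, δ, δ', hcl, hcl', by rw [hδ]; infer_instance, ?_, by rw [hδ']; infer_instance, ?_,
    ?_, h.ker_inf_ker hκ' hκ δ δ' h1 h2 h3 h1' h2' h3'⟩
  · rw [reassoc_of% hδ, PLine.comp_lift, h1, h3]
    change _ = PLine.proj Y ≫ PLine.lift (𝟙 Y) κ'
    rw [PLine.comp_lift, Category.comp_id]
  · rw [reassoc_of% hδ', PLine.comp_lift, h1', h3']
    change _ = PLine.proj Y ≫ PLine.lift (𝟙 Y) κ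
    rw [PLine.comp_lift, Category.comp_id]
  · rw [reassoc_of% hδ]
    have hw : PLine.lift (𝟙 Y) κ ≫ δ = PLine.lift (𝟙 Y) κ' ≫ δ' := by
      refine h.ext _ _ ?_ ?_ ?_
      · rw [Category.assoc, Category.assoc, h1, h1', PLine.lift_proj, PLine.lift_proj]
      · rw [Category.assoc, Category.assoc, h2, h3', PLine.lift_toP1, ← Category.assoc,
          PLine.lift_proj, Category.id_comp]
      · rw [Category.assoc, Category.assoc, h3, h2', PLine.lift_toP1, ← Category.assoc,
          PLine.lift_proj, Category.id_comp]
    have c0 := pullback.condition (f := δ) (g := δ')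
    have c1 := congrArg (· ≫ π) c0
    have c2 := congrArg (· ≫ a) c0
    have c3 := congrArg (· ≫ b) c0
    simp only [Category.assoc, h1, h1', h2, h2', h3, h3'] at c1 c2 c3
    refine isIso_of_section _ (pullback.lift _ _ hw) ?_ ?_
    · rw [← Category.assoc, pullback.lift_fst, PLine.lift_proj]
    · apply pullback.hom_ext
      · rw [Category.assoc, pullback.lift_fst, Category.id_comp, PLine.comp_lift,
          PLine.eq_lift (pullback.fst δ δ'), c2, c1, PLine.lift_proj, Category.comp_id,
          ← Category.assoc]
      · rw [Category.assoc, pullback.lift_snd, Category.id_comp, PLine.comp_lift,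
          PLine.eq_lift (pullback.snd δ δ'), ← c3, ← c1]
        simp only [Category.assoc, Category.comp_id]

/-- The component of a chain that maps isomorphically to the first line shows that this line is
contracted. -/
lemma IsModel.contr_of_isChain (h : K.IsModel π a b) {p p' : X ⟶ PLine Y}
    (hp : p = PLine.lift π a) (hp' : p' = PLine.lift π b) {τ τ' : Sec Y}
    (hc : IsChain p p' τ τ') : K.Contr (𝟙 Y) τ'.toP1 := by
  subst hp hp'
  obtain ⟨D, D', δ, δ', -, -, hi, he, -⟩ := hc
  intro T g f
  have he' : δ ≫ PLine.lift π b = (δ ≫ PLine.lift π a) ≫ PLine.proj Y ≫ τ'.hom := by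
    rw [he, Category.assoc]
  have e1 : (PLine.lift g f ≫ inv (δ ≫ PLine.lift π a) ≫ δ) ≫ PLine.lift π a = PLine.lift g f := by
    simp only [Category.assoc, IsIso.inv_hom_id, Category.comp_id]
  have e2 : (PLine.lift g f ≫ inv (δ ≫ PLine.lift π a) ≫ δ) ≫ PLine.lift π b =
      g ≫ τ'.hom := by
    rw [Category.assoc, Category.assoc, he', IsIso.inv_hom_id_assoc, ← Category.assoc,
      PLine.lift_proj]
  have h1 := congrArg (· ≫ PLine.proj Y) e1
  have h2 := congrArg (· ≫ PLine.toP1 Y) e1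
  have h3 := congrArg (· ≫ PLine.toP1 Y) e2
  simp only [Category.assoc, PLine.lift_proj, PLine.lift_toP1] at h1 h2 h3
  have := K.comp (PLine.lift g f ≫ inv (δ ≫ PLine.lift π a) ≫ δ) _ _ _ h.rel
  simp only [Category.assoc, h1, h2, h3] at this
  rw [Category.comp_id]
  exact this

end Correspondence

lemma Sec.toP1_ofPoint {Y : Scheme.{u}} (f : Y ⟶ P1.{u}) : (Sec.ofPoint f).toP1 = f :=
  PLine.lift_toP1 _ _

lemma Sec.hom_eq {Y : Scheme.{u}} (s : Sec Y) : s.hom = PLine.lift (𝟙 Y) s.toP1 := by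
  rw [PLine.eq_lift s.hom, s.hom_proj]; rfl

namespace Correspondence

variable {Y : Scheme.{u}} {K : Correspondence Y}

/-! ### The curve of a correspondence -/

lemma contr_pull_iff {T : Scheme.{u}} {t : T ⟶ Y} {κ : T ⟶ P1.{u}} :
    (K.pull t).Contr (𝟙 T) κ ↔ K.Contr t κ := by
  refine forall₃_congr fun T' g f => ?_
  rw [Category.comp_id]
  rfl

lemma deg_pull_iff {T T' : Scheme.{u}} {t : T ⟶ Y} {t' : T' ⟶ T} :
    (K.pull t).Deg t' ↔ K.Deg (t' ≫ t) := by
  refine exists_congr fun κ => forall₃_congr fun T' g f => ?_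
  rw [← Category.assoc]
  rfl

instance {Y C : Scheme.{u}} (ι : C ⟶ PSq Y) [IsClosedImmersion ι] : IsSeparated (toBase ι) := by
  unfold toBase; infer_instance

/-- The points of the first line outside of the section `κ` over the degeneration locus avoid the
contracted point, so the first projection is invertible there. Over the degeneration locus the
partner of a point is `κ'`, because it is unique. -/
lemma IsModel.inducesMorphism {X Z : Scheme.{u}} {π : X ⟶ Y} {a b : X ⟶ P1.{u}}
    (h : K.IsModel π a b) {p q : X ⟶ PLine Y} (hp : p = PLine.lift π a) (hq : q = PLine.lift π b)
    {ζ : Z ⟶ Y} [IsClosedImmersion ζ]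
    (hζ : ∀ (T : Scheme.{u}) (t : T ⟶ Y), K.Deg t → ∃ z : T ⟶ Z, z ≫ ζ = t)
    {κ κ' : Z ⟶ P1.{u}} (hκ' : K.Contr ζ κ') (hκ : K.swap.Contr ζ κ) {U : Y.Opens}
    {Φ : PLine (U : Scheme.{u}) ⟶ PLine (U : Scheme.{u})}
    (hΦ : ∀ (T : Scheme.{u}) (t : T ⟶ U) (f f' : T ⟶ P1.{u}),
      K.rel (t ≫ U.ι) f f' ↔ PLine.lift t f ≫ Φ = PLine.lift t f') :
    InducesMorphism p q ζ (Sec.ofPoint κ) (Sec.ofPoint κ') U Φ := by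
  have hcl : IsClosedImmersion (PLine.lift ζ κ) := by
    have : IsClosedImmersion (PLine.lift ζ κ ≫ PLine.proj Y) := by
      rw [PLine.lift_proj]; infer_instance
    exact IsClosedImmersion.of_comp _ (PLine.proj Y)
  rw [InducesMorphism, Sec.toP1_ofPoint, Sec.toP1_ofPoint]
  refine ⟨⟨(Set.range (PLine.lift ζ κ))ᶜ, (PLine.lift ζ κ).isClosedEmbedding.isClosed_range.isOpen_compl⟩, rfl, ?_⟩
  set W : (PLine Y).Opens :=
    ⟨(Set.range (PLine.lift ζ κ))ᶜ, (PLine.lift ζ κ).isClosedEmbedding.isClosed_range.isOpen_compl⟩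
  have hav : K.Avoids (W.ι ≫ PLine.proj Y) (W.ι ≫ PLine.toP1 Y) := by
    intro T g hg
    obtain ⟨z, hz⟩ := hζ _ _ (deg_swap_iff.mp ⟨_, hg⟩)
    have h1 := hκ.comp z
    rw [hz] at h1
    have h2 := hg.unique h1
    have h3 : g ≫ W.ι = z ≫ PLine.lift ζ κ := by
      apply PLine.hom_ext
      · rw [Category.assoc, ← hz, Category.assoc, PLine.lift_proj]
      · rw [Category.assoc, h2, Category.assoc, PLine.lift_toP1]
    refine ⟨fun x => (g x).2 ⟨z x, ?_⟩⟩
    exact (congrArg (fun f : T ⟶ PLine Y => f x) h3).symm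
  obtain ⟨hi, f', hf', hb⟩ := h.exists_morphism hp W hav
  refine ⟨hi, PLine.lift (W.ι ≫ PLine.proj Y) f', ?_, ?_, ?_⟩
  · rw [PLine.comp_lift, hb, hq, PLine.comp_lift]
    congr 1
    rw [← Category.assoc, morphismRestrict_ι, Category.assoc, hp, PLine.lift_proj]
  · intro T w z hwz
    rw [PLine.comp_lift, hwz]
    congr 1
    refine (hav.comp w).unique (K.comp w _ _ _ hf') ?_
    have := hκ' _ z (w ≫ W.ι ≫ PLine.toP1 Y)
    rwa [← hwz] at this
  · intro T w v hwv
    rw [PLine.comp_lift, hwv]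
    congr 1
    have h1 := K.comp w _ _ _ hf'
    rw [hwv] at h1
    rw [← Category.assoc, (hΦ _ _ _ _).mp h1, PLine.lift_toP1]

variable (K)

/-- The curve of a correspondence of conic type and its degeneration scheme. -/
theorem exists_scheme : ∃ (Z : Scheme.{u}) (ζ : Z ⟶ Y) (C : Scheme.{u}) (ι : C ⟶ PSq Y),
    IsClosedImmersion ζ ∧ IsClosedImmersion ι ∧
    (∀ (T : Scheme.{u}) (t : T ⟶ Y), (∃ z : T ⟶ Z, z ≫ ζ = t) ↔ K.Deg t) ∧
    (∀ (T : Scheme.{u}) (t : T ⟶ Y) (f f' : T ⟶ P1.{u}),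
      (∃ γ : T ⟶ C, γ ≫ ι = PSq.lift t f f') ↔ K.rel t f f') ∧
    Flat (toBase ι) ∧ GeometricallyReduced (toBase ι) ∧ (IsReduced Y → IsReduced C) ∧
    (∀ (T : Scheme.{u}) (t : T ⟶ Y),
      (∃ z : T ⟶ Z, z ≫ ζ = t) ↔ ∃ τ τ' : Sec T, IsChain (proj₁ ι t) (proj₂ ι t) τ τ') ∧
    ∀ U : Y.Opens, Set.range ζ = (U : Set Y)ᶜ →
      IsIso (proj₁ ι U.ι) ∧ IsIso (proj₂ ι U.ι) ∧
      ∃ (τ τ' : Sec Z) (Φ : PLine (U : Scheme.{u}) ≅ PLine (U : Scheme.{u})),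
        IsChain (proj₁ ι ζ) (proj₂ ι ζ) τ τ' ∧
        Φ.hom ≫ PLine.proj U = PLine.proj U ∧
        proj₁ ι U.ι ≫ Φ.hom = proj₂ ι U.ι ∧
        (∀ (T : Scheme.{u}) (t : T ⟶ U) (f f' : T ⟶ P1.{u}),
          K.rel (t ≫ U.ι) f f' ↔ PLine.lift t f ≫ Φ.hom = PLine.lift t f') ∧
        InducesMorphism (ι ≫ PSq.fst Y) (ι ≫ PSq.snd Y) ζ τ τ' U Φ.hom ∧
        InducesMorphism (ι ≫ PSq.snd Y) (ι ≫ PSq.fst Y) ζ τ' τ U Φ.inv := by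
  obtain ⟨Z, ζ, hζ, hZ⟩ := K.exists_degeneration
  obtain ⟨C, ι, hι, hC⟩ := K.exists_curve
  have hM := isModel_of_curve ι hC
  have hMt : ∀ {T : Scheme.{u}} (t : T ⟶ Y), (K.pull t).IsModel (pullback.snd (toBase ι) t)
      (pullback.fst _ _ ≫ ι ≫ PSq.fst Y ≫ PLine.toP1 Y)
      (pullback.fst _ _ ≫ ι ≫ PSq.snd Y ≫ PLine.toP1 Y) := fun t =>
    hM.of_isPullback (IsPullback.of_hasPullback _ _)
  have hsep : ∀ {T : Scheme.{u}} (t : T ⟶ Y), IsSeparated (pullback.snd (toBase ι) t) := fun t =>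
    IsSeparated.isStableUnderBaseChange.of_isPullback (IsPullback.of_hasPullback _ t) inferInstance
  have hchain : ∀ {T : Scheme.{u}} {t : T ⟶ Y} {κ κ' : T ⟶ P1.{u}}, K.Contr t κ' →
      K.swap.Contr t κ → IsChain (proj₁ ι t) (proj₂ ι t) (Sec.ofPoint κ) (Sec.ofPoint κ') := by
    intro T t κ κ' h' h
    have := hsep t
    exact (hMt t).isChain (contr_pull_iff.mpr h') (contr_pull_iff (K := K.swap).mpr h) rfl rfl
  refine ⟨Z, ζ, C, ι, hζ, hι, hZ, ?_, hM.flat, hM.geometricallyReduced, fun _ => hM.isReduced,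
    fun T t => ?_, fun U hU => ?_⟩
  · intro T t f f'
    have h1 : PSq.lift t f f' ≫ PSq.fst Y = PLine.lift t f := pullback.lift_fst _ _ _
    have h2 : PSq.lift t f f' ≫ PSq.snd Y = PLine.lift t f' := pullback.lift_snd _ _ _
    rw [hC, ← Category.assoc, ← Category.assoc, ← Category.assoc, h1, h2]
    simp only [PLine.lift_proj, PLine.lift_toP1]
  · rw [hZ]
    constructor
    · intro h
      obtain ⟨κ, hκ⟩ := deg_swap_iff.mpr h
      obtain ⟨κ', hκ'⟩ := h
      exact ⟨_, _, hchain hκ' hκ⟩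
    · rintro ⟨τ, τ', h⟩
      exact ⟨_, contr_pull_iff.mp ((hMt t).contr_of_isChain rfl rfl h)⟩
  · have hd : ∀ (T : Scheme.{u}) (t : T ⟶ U), (K.pull U.ι).Deg t → IsEmpty T := by
      intro T t ht
      obtain ⟨z, hz⟩ := (hZ _ _).mpr (deg_pull_iff.mp ht)
      refine ⟨fun x => ?_⟩
      have hx : ζ (z x) ∈ (U : Set Y)ᶜ := hU ▸ ⟨z x, rfl⟩
      have hzx : ζ (z x) = U.ι (t x) := congrArg (fun f : T ⟶ Y => f x) hz
      rw [hzx] at hx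
      exact hx (t x).2
    have hi₁ : IsIso (proj₁ ι U.ι) := (hMt U.ι).isIso hd
    have hi₂ : IsIso (proj₂ ι U.ι) := (hMt U.ι).swap.isIso fun T t ht => hd T t (deg_swap_iff.mp ht)
    obtain ⟨κ', hκ'⟩ := (hZ _ ζ).mp ⟨𝟙 Z, Category.id_comp _⟩
    obtain ⟨κ, hκ⟩ := deg_swap_iff.mpr ⟨κ', hκ'⟩
    have hΦ : ∀ (T : Scheme.{u}) (t : T ⟶ U) (f f' : T ⟶ P1.{u}), K.rel (t ≫ U.ι) f f' ↔
        PLine.lift t f ≫ inv (proj₁ ι U.ι) ≫ proj₂ ι U.ι = PLine.lift t f' := by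
      intro T t f f'
      constructor
      · intro h
        obtain ⟨γ, h1, h2, h3⟩ := (hMt U.ι).lift t f f' h
        have e1 : γ ≫ proj₁ ι U.ι = PLine.lift t f := by rw [proj₁, PLine.comp_lift, h1, h2]
        have e2 : γ ≫ proj₂ ι U.ι = PLine.lift t f' := by rw [proj₂, PLine.comp_lift, h1, h3]
        rw [← e1, Category.assoc, IsIso.hom_inv_id_assoc, e2]
      · intro h
        have e1 : (PLine.lift t f ≫ inv (proj₁ ι U.ι)) ≫ proj₁ ι U.ι = PLine.lift t f := by
          rw [Category.assoc, IsIso.inv_hom_id, Category.comp_id]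
        rw [← Category.assoc] at h
        have h1 := congrArg (· ≫ PLine.proj _) e1
        have h2 := congrArg (· ≫ PLine.toP1 _) e1
        have h3 := congrArg (· ≫ PLine.toP1 _) h
        have p1 : proj₁ ι U.ι ≫ PLine.proj _ = pullback.snd _ _ := PLine.lift_proj _ _
        have p2 : proj₁ ι U.ι ≫ PLine.toP1 _ = _ := PLine.lift_toP1 _ _
        have p3 : proj₂ ι U.ι ≫ PLine.toP1 _ = _ := PLine.lift_toP1 _ _
        simp only [Category.assoc, p1, p2, p3, PLine.lift_proj, PLine.lift_toP1] at h1 h2 h3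
        have := (K.pull U.ι).comp (PLine.lift t f ≫ inv (proj₁ ι U.ι)) _ _ _ (hMt U.ι).rel
        simp only [Category.assoc] at this
        rw [h1, h2, h3] at this
        exact this
    have hp : ι ≫ PSq.fst Y = PLine.lift (toBase ι) (ι ≫ PSq.fst Y ≫ PLine.toP1 Y) := by
      rw [PLine.eq_lift (ι ≫ PSq.fst Y), Category.assoc, Category.assoc]; rfl
    have hq : ι ≫ PSq.snd Y = PLine.lift (toBase ι) (ι ≫ PSq.snd Y ≫ PLine.toP1 Y) := by
      have : PSq.fst Y ≫ PLine.proj Y = PSq.snd Y ≫ PLine.proj Y := pullback.condition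
      rw [PLine.eq_lift (ι ≫ PSq.snd Y), Category.assoc, Category.assoc, toBase, this]
    refine ⟨hi₁, hi₂, Sec.ofPoint κ, Sec.ofPoint κ',
      (asIso (proj₁ ι U.ι)).symm ≪≫ asIso (proj₂ ι U.ι), hchain hκ' hκ, ?_, ?_, ?_, ?_, ?_⟩
    · simp only [Iso.trans_hom, Iso.symm_hom, asIso_inv, asIso_hom, Category.assoc]
      rw [IsIso.inv_comp_eq, proj₂, proj₁, PLine.lift_proj, PLine.lift_proj]
    · simp
    · simpa using hΦ
    · exact hM.inducesMorphism hp hq (fun T t => (hZ T t).mpr) hκ' hκ (by simpa using hΦ)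
    · refine hM.swap.inducesMorphism hq hp (fun T t h => (hZ T t).mpr (deg_swap_iff.mp h)) hκ hκ'
        fun T t f f' => (hΦ T t f' f).trans ?_
      simp only [Iso.trans_inv, Iso.symm_inv, asIso_inv, asIso_hom]
      rw [← Category.assoc, ← Category.assoc, ← IsIso.eq_comp_inv, IsIso.comp_inv_eq]
      exact eq_comm

end Correspondence

/-! ### The cross ratio relation -/

/-- The determinant of two vectors of length two. -/
def br {R : Type*} [CommRing R] (a b : Fin 2 → R) : R := a 0 * b 1 - a 1 * b 0

/-- The equality of the cross ratios of two quadruples of vectors, cleared of denominators. -/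
def Cross {R : Type*} [CommRing R] (X X' : Fin 4 → Fin 2 → R) : Prop :=
  br (X 2) (X 0) * br (X' 2) (X' 1) * br (X 3) (X 1) * br (X' 3) (X' 0) =
    br (X 2) (X 1) * br (X' 2) (X' 0) * br (X 3) (X 0) * br (X' 3) (X' 1)

lemma br_mulVec {R : Type*} [CommRing R] (M : Matrix (Fin 2) (Fin 2) R) (a b : Fin 2 → R) :
    br (M.mulVec a) (M.mulVec b) = M.det * br a b := by
  simp only [br, Matrix.mulVec, dotProduct, Fin.sum_univ_two, Matrix.det_fin_two]
  ring

lemma cross_mulVec_iff {R : Type*} [CommRing R] (M M' : GL (Fin 2) R) (X X' : Fin 4 → Fin 2 → R) :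
    Cross (fun m => (M : Matrix (Fin 2) (Fin 2) R).mulVec (X m))
      (fun m => (M' : Matrix (Fin 2) (Fin 2) R).mulVec (X' m)) ↔ Cross X X' := by
  simp only [Cross, br_mulVec]
  obtain ⟨u, hu⟩ := Matrix.isUnits_det_units M
  obtain ⟨u', hu'⟩ := Matrix.isUnits_det_units M'
  rw [← hu, ← hu', ← (u ^ 2 * u' ^ 2).isUnit.mul_right_inj
    (b := br (X 2) (X 0) * br (X' 2) (X' 1) * br (X 3) (X 1) * br (X' 3) (X' 0))]
  push_cast
  constructor <;> intro h <;> linear_combination h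

lemma Cross.symm {R : Type*} [CommRing R] {X X' : Fin 4 → Fin 2 → R} (h : Cross X X') :
    Cross X' X := by
  simp only [Cross] at h ⊢
  linear_combination -h

lemma Cross.map {R S : Type*} [CommRing R] [CommRing S] (φ : R →+* S) {X X' : Fin 4 → Fin 2 → R}
    (h : Cross X X') : Cross (fun m r => φ (X m r)) (fun m r => φ (X' m r)) := by
  have := congrArg φ h
  simpa only [Cross, br, map_mul, map_sub] using this

lemma Cross.smul {R : Type*} [CommRing R] {X X' : Fin 4 → Fin 2 → R} (h : Cross X X')
    (w w' : Fin 4 → R) : Cross (fun m r => w m * X m r) (fun m r => w' m * X' m r) := by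
  simp only [Cross, br] at h ⊢
  linear_combination w 0 * w 1 * w 2 * w 3 * w' 0 * w' 1 * w' 2 * w' 3 * h

/-- The coordinates of a point on the conic `x_0 x'_1 = b x_1 x'_0` over a local ring. -/
lemma exists_conic_param {R : Type*} [CommRing R] [IsLocalRing R] {b : R} {x x' : Fin 2 → R}
    (hx : IsUnit (x 0) ∨ IsUnit (x 1)) (hx' : IsUnit (x' 0) ∨ IsUnit (x' 1))
    (h : x 0 * x' 1 = b * (x 1 * x' 0)) : ∃ α β m n r r' : R, r * r' = b ∧
      x 0 = α * (m * r) ∧ x 1 = α * n ∧ x' 0 = β * m ∧ x' 1 = β * (n * r') := by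
  rcases hx with ⟨u, hu⟩ | ⟨u, hu⟩
  · -- `x = (1 : z)` and `x' = (1 : b z)`
    refine ⟨u, x' 0, 1, ↑u⁻¹ * x 1, 1, b, one_mul _, by rw [hu]; ring, ?_, by ring, ?_⟩
    · rw [← mul_assoc, u.mul_inv, one_mul]
    · calc x' 1 = ↑u⁻¹ * (x 0 * x' 1) := by rw [← hu, ← mul_assoc, u.inv_mul, one_mul]
        _ = _ := by rw [h]; ring
  · rcases hx' with ⟨w, hw⟩ | ⟨w, hw⟩
    · -- `x = (z : 1)` and `x' = (1 : z')` with `z z' = b`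
      refine ⟨u, w, 1, 1, ↑u⁻¹ * x 0, ↑w⁻¹ * x' 1, ?_, ?_, by rw [hu]; ring, by rw [hw]; ring, ?_⟩
      · rw [← hu, ← hw] at h
        linear_combination (↑u⁻¹ * ↑w⁻¹) * h + b * u.inv_mul + b * u * ↑u⁻¹ * w.inv_mul
      · rw [one_mul, ← mul_assoc, u.mul_inv, one_mul]
      · rw [one_mul, ← mul_assoc, w.mul_inv, one_mul]
    · -- `x = (b z : 1)` and `x' = (z : 1)`
      refine ⟨u, w, ↑w⁻¹ * x' 0, 1, b, 1, mul_one _, ?_, by rw [hu]; ring, ?_, by rw [hw]; ring⟩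
      · rw [← hu, ← hw] at h
        linear_combination ↑w⁻¹ * h - x 0 * w.inv_mul
      · rw [← mul_assoc, w.mul_inv, one_mul]

/-- Four points on a conic `x_0 x'_1 = b x_1 x'_0` have the same cross ratio in both
projections. -/
lemma cross_of_conic_param {R : Type*} [CommRing R] {b : R} {α β m n r r' : Fin 4 → R}
    (h : ∀ i, r i * r' i = b) :
    Cross (fun i => ![α i * (m i * r i), α i * n i]) (fun i => ![β i * m i, β i * (n i * r' i)]) := by
  -- the factors `α`, `β` of the vectors do not matter, and what remains is an identity of
  -- polynomials
  suffices Cross (fun i => ![m i * r i, n i]) (fun i => ![m i, n i * r' i]) by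
    have := this.smul α β
    convert this using 4 <;> rename_i i k <;> fin_cases k <;> rfl
  simp only [Cross, br, Matrix.cons_val_zero, Matrix.cons_val_one]
  have h0 := h 0
  have h1 := h 1
  have h2 := h 2
  have h3 := h 3
  generalize r 0 = r0, r 1 = r1, r 2 = r2, r 3 = r3, r' 0 = s0, r' 1 = s1, r' 2 = s2, r' 3 = s3,
    m 0 = m0, m 1 = m1, m 2 = m2, m 3 = m3, n 0 = n0, n 1 = n1, n 2 = n2, n 3 = n3 at *
  grind

/-- Points on a conic `x_0 x'_0 = d x_1 x'_1` over a local ring. -/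
lemma cross_of_conic {R : Type*} [CommRing R] [IsLocalRing R] {d : R} {X X' : Fin 4 → Fin 2 → R}
    (hX : ∀ m, IsUnit (X m 0) ∨ IsUnit (X m 1)) (hX' : ∀ m, IsUnit (X' m 0) ∨ IsUnit (X' m 1))
    (h : ∀ m, X m 0 * X' m 0 = d * (X m 1 * X' m 1)) : Cross X X' := by
  choose α β p q r r' hr h0 h1 h2 h3 using fun m => exists_conic_param (x' := ![X' m 1, X' m 0])
    (hX m) (hX' m).symm (h m)
  have key := cross_of_conic_param (α := α) (β := β) (m := p) (n := q) hr
  simp only [← h0, ← h1, ← h2, ← h3] at key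
  simp only [Cross, br, Matrix.cons_val_zero, Matrix.cons_val_one] at key ⊢
  linear_combination key

/-! ### The cross ratio relation for points of the projective line -/

/-- The quadruples of points `P` and `P'` have the same cross ratio. -/
def CrossPt {T : Scheme.{u}} (P P' : Fin 4 → (T ⟶ P1.{u})) : Prop :=
  ∀ ⦃T' : Scheme.{u}⦄ (g : T' ⟶ T) (X X' : Fin 4 → Fin 2 → Γ(T', ⊤)),
    (∀ m, HasCoords (g ≫ P m) (X m)) → (∀ m, HasCoords (g ≫ P' m) (X' m)) → Cross X X'

lemma CrossPt.symm {T : Scheme.{u}} {P P' : Fin 4 → (T ⟶ P1.{u})} (h : CrossPt P P') :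
    CrossPt P' P := fun _ g X X' hX hX' => (h g X' X hX' hX).symm

lemma crossPt_iff {T : Scheme.{u}} {P P' : Fin 4 → (T ⟶ P1.{u})} {X X' : Fin 4 → Fin 2 → Γ(T, ⊤)}
    (hX : ∀ m, HasCoords (P m) (X m)) (hX' : ∀ m, HasCoords (P' m) (X' m)) :
    CrossPt P P' ↔ Cross X X' := by
  constructor
  · intro h
    exact h (𝟙 T) X X' (by simpa using hX) (by simpa using hX')
  · intro h T' g Y Y' hY hY'
    choose w hw using fun m => ((hX m).comp g).exists_unit (hY m)
    choose w' hw' using fun m => ((hX' m).comp g).exists_unit (hY' m)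
    convert (h.map g.appTop.hom).smul (fun m => (w m : Γ(T', ⊤))) (fun m => (w' m : Γ(T', ⊤)))
      using 3
    · exact hw _ _
    · exact hw' _ _

lemma CrossPt.comp {T T' : Scheme.{u}} {P P' : Fin 4 → (T ⟶ P1.{u})} (h : CrossPt P P')
    (g : T' ⟶ T) : CrossPt (fun m => g ≫ P m) (fun m => g ≫ P' m) :=
  fun T'' g' X X' hX hX' => h (g' ≫ g) X X' (by simpa using hX) (by simpa using hX')

lemma crossPt_of_local {T : Scheme.{u}} {P P' : Fin 4 → (T ⟶ P1.{u})}
    (h : ∀ x : T, ∃ V : T.Opens, x ∈ V ∧ CrossPt (fun m => V.ι ≫ P m) (fun m => V.ι ≫ P' m)) :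
    CrossPt P P' := by
  intro T' g X X' hX hX'
  refine section_ext_of_local fun x => ?_
  obtain ⟨V, hV, h⟩ := h (g x)
  refine ⟨g ⁻¹ᵁ V, hV, ?_⟩
  have e : ∀ f : T ⟶ P1.{u}, (g ∣_ V) ≫ V.ι ≫ f = (g ⁻¹ᵁ V).ι ≫ g ≫ f := fun f => by
    rw [← Category.assoc, morphismRestrict_ι, Category.assoc]
  have := h (g ∣_ V) (fun m => pb (g ⁻¹ᵁ V).ι (X m)) (fun m => pb (g ⁻¹ᵁ V).ι (X' m))
    (fun m => by rw [e]; exact (hX m).comp _) (fun m => by rw [e]; exact (hX' m).comp _)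
  simpa only [Cross, br, map_mul, map_sub, pb_apply] using this

/-- The unit condition on the coordinates of a point, in a local ring. -/
lemma HasCoords.isUnit_germ {T : Scheme.{u}} {f : T ⟶ P1.{u}} {a : Fin 2 → Γ(T, ⊤)}
    (h : HasCoords f a) (x : T) : IsUnit (T.presheaf.germ ⊤ x trivial (a 0)) ∨
      IsUnit (T.presheaf.germ ⊤ x trivial (a 1)) := by
  obtain ⟨i, hi⟩ := exists_mem_basicOpen h.1 x
  rw [Scheme.mem_basicOpen_top] at hi
  fin_cases i
  · exact Or.inl hi
  · exact Or.inr hi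

/-- Four pairs of points on a conic have the same cross ratio in both projections. -/
lemma crossPt_of_conic {T : Scheme.{u}} {P P' : Fin 4 → (T ⟶ P1.{u})} (M M' : GL (Fin 2) Γ(T, ⊤))
    (d : Γ(T, ⊤)) (h : ∀ m, Conic d (act M (P m)) (act M' (P' m))) : CrossPt P P' := by
  intro T' g X X' hX hX'
  rw [← cross_mulVec_iff (pbGL g M) (pbGL g M')]
  have h0 := fun m => (hX m).act (pbGL g M)
  have h1 := fun m => (hX' m).act (pbGL g M')
  simp only [← comp_act] at h0 h1
  refine section_ext_of_germ fun x => ?_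
  have := cross_of_conic (X := fun m r => T'.presheaf.germ ⊤ x trivial
      ((pbGL g M : Matrix (Fin 2) (Fin 2) Γ(T', ⊤)).mulVec (X m) r))
    (X' := fun m r => T'.presheaf.germ ⊤ x trivial
      ((pbGL g M' : Matrix (Fin 2) (Fin 2) Γ(T', ⊤)).mulVec (X' m) r))
    (d := T'.presheaf.germ ⊤ x trivial (g.appTop d))
    (fun m => (h0 m).isUnit_germ x) (fun m => (h1 m).isUnit_germ x) (fun m => by
      have := congrArg (T'.presheaf.germ ⊤ x trivial) (h m T' g _ _ (h0 m) (h1 m))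
      simpa only [map_mul] using this)
  simpa only [Cross, br, map_mul, map_sub] using this

/-! ### The locus where two sections meet -/

/-- Two sections of the projective line differ at the image of `x` if and only if the determinant
of their coordinates does not vanish at `x`. -/
lemma hom_ne_iff {T Y : Scheme.{u}} (s s' : Sec Y) (t : T ⟶ Y) {a b : Fin 2 → Γ(T, ⊤)}
    (ha : HasCoords (t ≫ s.toP1) a) (hb : HasCoords (t ≫ s'.toP1) b) (x : T) :
    s.hom (t x) ≠ s'.hom (t x) ↔ x ∈ T.basicOpen (br a b) := by
  rw [ne_eq, not_iff_comm]
  constructor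
  · intro h
    have e : (T.fromSpecResidueField x ≫ t) ≫ s.hom = (T.fromSpecResidueField x ≫ t) ≫ s'.hom := by
      rw [s.hom_eq, s'.hom_eq, PLine.comp_lift, PLine.comp_lift]
      congr 1
      rw [Category.assoc, Category.assoc, (ha.comp _).eq_iff (hb.comp _), ← sub_eq_zero]
      have := fromSpecResidueField_appTop_eq_zero h
      simpa only [br, map_sub, map_mul, pb_apply] using this
    obtain ⟨z⟩ : Nonempty (Spec (T.residueField x)) := inferInstance
    have hz : T.fromSpecResidueField x z = x := by
      have : T.fromSpecResidueField x z ∈ Set.range (T.fromSpecResidueField x) := ⟨z, rfl⟩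
      rwa [Scheme.range_fromSpecResidueField] at this
    have h2 : s.hom (t (T.fromSpecResidueField x z)) = s'.hom (t (T.fromSpecResidueField x z)) :=
      congrArg (fun f : Spec (T.residueField x) ⟶ PLine Y => f z) e
    rwa [hz] at h2
  · intro h hx
    obtain ⟨w, hw, -⟩ := Scheme.Pullback.exists_preimage_pullback (f := s.hom) (g := s'.hom) _ _ h
    have e1 : pullback.fst s.hom s'.hom = pullback.snd s.hom s'.hom := by
      have := congrArg (fun f => f ≫ PLine.proj Y) (pullback.condition (f := s.hom) (g := s'.hom))
      simpa only [Category.assoc, Sec.hom_proj, Category.comp_id] using this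
    have e2 : pullback.fst s.hom s'.hom ≫ s.toP1 = pullback.fst s.hom s'.hom ≫ s'.toP1 := by
      have := congrArg (fun f => f ≫ PLine.toP1 Y) (pullback.condition (f := s.hom) (g := s'.hom))
      rw [← e1] at this
      simpa only [Category.assoc, Sec.toP1] using this
    obtain ⟨v, -, hv⟩ := Scheme.Pullback.exists_preimage_pullback
      (f := pullback.fst s.hom s'.hom) (g := t) _ _ hw
    set p := pullback.snd (pullback.fst s.hom s'.hom) t
    have e3 : p ≫ t ≫ s.toP1 = p ≫ t ≫ s'.toP1 := by
      have c := pullback.condition (f := pullback.fst s.hom s'.hom) (g := t)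
      rw [← Category.assoc, ← c, Category.assoc, e2, ← Category.assoc, c, Category.assoc]
    have h0 : p.appTop (br a b) = 0 := by
      have := ((ha.comp p).eq_iff (hb.comp p)).mp e3
      rw [← sub_eq_zero] at this
      simpa only [br, map_sub, map_mul, pb_apply] using this
    have h1 : v ∈ (pullback (pullback.fst s.hom s'.hom) t).basicOpen (p.appTop (br a b)) := by
      rw [← Scheme.preimage_basicOpen_top]
      change p v ∈ T.basicOpen (br a b)
      rwa [hv]
    rw [h0, Scheme.basicOpen_zero] at h1
    exact h1

/-! ### Adapted coordinates -/

lemma pbGL_inv {T T' : Scheme.{u}} (g : T' ⟶ T) (M : GL (Fin 2) Γ(T, ⊤)) :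
    pbGL g M⁻¹ = (pbGL g M)⁻¹ := map_inv _ _

lemma pbGL_mul {T T' : Scheme.{u}} (g : T' ⟶ T) (M N : GL (Fin 2) Γ(T, ⊤)) :
    pbGL g (M * N) = pbGL g M * pbGL g N := map_mul _ _ _

lemma pb_zero_one {T T' : Scheme.{u}} (g : T' ⟶ T) :
    pb g (![0, 1] : Fin 2 → Γ(T, ⊤)) = ![0, 1] := by
  funext r; fin_cases r <;> simp

lemma pb_one_zero {T T' : Scheme.{u}} (g : T' ⟶ T) :
    pb g (![1, 0] : Fin 2 → Γ(T, ⊤)) = ![1, 0] := by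
  funext r; fin_cases r <;> simp

section
variable {Y : Scheme.{u}} {n : ℕ} {s s' : Fin n → Sec Y} {K : Kind} {T T' : Scheme.{u}}
  {t : T ⟶ Y} {i j : Mark n K}

/-- The base change of adapted coordinates. -/
def AdaptedCoords.comp (c : AdaptedCoords s t i j) (g : T' ⟶ T) :
    AdaptedCoords s (g ≫ t) i j where
  g := pbGL g c.g
  at_i := by
    have := c.at_i.comp g
    rwa [pb_mulVec, pbGL_inv, pb_zero_one, ← Category.assoc] at this
  at_j := by
    have := c.at_j.comp g
    rwa [pb_mulVec, pbGL_inv, pb_one_zero, ← Category.assoc] at this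
  a k := pb g (c.a k)
  at_k k := by
    have := (c.at_k k).comp g
    rwa [pb_mulVec, pbGL_inv, ← Category.assoc] at this

lemma AdaptedCoords.Represents.act {c : AdaptedCoords s t i j} {f : T ⟶ P1.{u}}
    {x : Fin 2 → Γ(T, ⊤)} (h : c.Represents f x) : HasCoords (act c.g f) x := by
  have := HasCoords.act h c.g
  rwa [Matrix.mulVec_mulVec, ← Units.val_mul, mul_inv_cancel, Units.val_one,
    Matrix.one_mulVec] at this

lemma AdaptedCoords.represents_of_act {c : AdaptedCoords s t i j} {f : T ⟶ P1.{u}}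
    {x : Fin 2 → Γ(T, ⊤)} (h : HasCoords (QuiverCurve.act c.g f) x) : c.Represents f x := by
  have := h.act c.g⁻¹
  rwa [act_act, inv_mul_cancel, act_one] at this

lemma basicOpen_isUnit_mul (u a : Γ(T, ⊤)) (hu : IsUnit u) :
    T.basicOpen (u * a) = T.basicOpen a := by
  rw [Scheme.basicOpen_mul, Scheme.basicOpen_of_isUnit _ hu]
  exact inf_eq_right.mpr le_top

lemma AdaptedCoords.ne_left_iff (c : AdaptedCoords s t i j) (k : Fin n) (x : T) :
    (s k).hom (t x) ≠ (extend s i).hom (t x) ↔ x ∈ T.basicOpen (c.a k 0) := by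
  rw [hom_ne_iff _ _ t (c.at_k k) c.at_i, br_mulVec,
    basicOpen_isUnit_mul _ _ (Matrix.isUnits_det_units c.g⁻¹)]
  simp [br]

lemma AdaptedCoords.ne_right_iff (c : AdaptedCoords s t i j) (k : Fin n) (x : T) :
    (s k).hom (t x) ≠ (extend s j).hom (t x) ↔ x ∈ T.basicOpen (c.a k 1) := by
  rw [hom_ne_iff _ _ t (c.at_k k) c.at_j, br_mulVec,
    basicOpen_isUnit_mul _ _ (Matrix.isUnits_det_units c.g⁻¹)]
  have : br (c.a k) ![1, 0] = (-1) * c.a k 1 := by simp [br]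
  rw [this, basicOpen_isUnit_mul _ _ isUnit_one.neg]

lemma AdaptedCoords.ne (c : AdaptedCoords s t i j) (x : T) :
    (extend s i).hom (t x) ≠ (extend s j).hom (t x) := by
  rw [hom_ne_iff _ _ t c.at_i c.at_j, br_mulVec,
    basicOpen_isUnit_mul _ _ (Matrix.isUnits_det_units c.g⁻¹)]
  have : br ![(0 : Γ(T, ⊤)), 1] ![1, 0] = -1 := by simp [br]
  rw [this, Scheme.basicOpen_of_isUnit _ isUnit_one.neg]
  trivial

end

lemma exists_coords_family {T : Scheme.{u}} {I : Type*} [Finite I] (f : I → (T ⟶ P1.{u})) (x : T) :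
    ∃ (V : T.Opens) (a : I → Fin 2 → Γ(V, ⊤)), x ∈ V ∧ ∀ i, HasCoords (V.ι ≫ f i) (a i) := by
  choose V a hx ha using fun i => exists_local_coords (f i) x
  let W : T.Opens := ⟨⋂ i, (V i : Set T), isOpen_iInter_of_finite fun i => (V i).2⟩
  have hW : ∀ i, W ≤ V i := fun i => Set.iInter_subset _ i
  refine ⟨W, fun i => pb (T.homOfLE (hW i)) (a i), Set.mem_iInter.mpr hx, fun i => ?_⟩
  simpa using (ha i).comp (T.homOfLE (hW i))

/-- The invertible matrix with columns `b, a`, for vectors `a, b` whose determinant is a unit. -/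
def frameGL {R : Type*} [CommRing R] (a b : Fin 2 → R) (h : IsUnit (br a b)) : GL (Fin 2) R :=
  Matrix.GeneralLinearGroup.mk'' !![b 0, a 0; b 1, a 1] (by
    rw [Matrix.det_fin_two_of]
    convert h.neg using 1
    simp only [br]; ring)

lemma frameGL_val {R : Type*} [CommRing R] (a b : Fin 2 → R) (h : IsUnit (br a b)) :
    (frameGL a b h).val = !![b 0, a 0; b 1, a 1] := rfl

lemma frameGL_zero_one {R : Type*} [CommRing R] (a b : Fin 2 → R) (h : IsUnit (br a b)) :
    (frameGL a b h : Matrix (Fin 2) (Fin 2) R).mulVec ![0, 1] = a := by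
  funext r; fin_cases r <;> simp [frameGL_val, Matrix.mulVec, dotProduct]

lemma frameGL_one_zero {R : Type*} [CommRing R] (a b : Fin 2 → R) (h : IsUnit (br a b)) :
    (frameGL a b h : Matrix (Fin 2) (Fin 2) R).mulVec ![1, 0] = b := by
  funext r; fin_cases r <;> simp [frameGL_val, Matrix.mulVec, dotProduct]

/-- Locally, the coordinates of two distinct sections are the columns of an invertible matrix, and
its inverse is the change of coordinates. -/
lemma exists_adaptedCoords {Y : Scheme.{u}} {n : ℕ} (s : Fin n → Sec Y) {K : Kind} {i j : Mark n K}
    {y : Y} (h : (extend s i).hom y ≠ (extend s j).hom y) :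
    ∃ V : Y.Opens, y ∈ V ∧ Nonempty (AdaptedCoords s V.ι i j) := by
  obtain ⟨V, a, hy, ha⟩ := exists_coords_family (I := Fin n ⊕ Bool)
    (Sum.elim (fun k => (s k).toP1)
      fun b => cond b (extend s i).toP1 (extend s j).toP1) y
  have hi := ha (.inr true)
  have hj := ha (.inr false)
  have hk := fun k => ha (.inl k)
  dsimp only [Sum.elim_inl, Sum.elim_inr, cond] at hi hj hk
  set δ := br (a (.inr true)) (a (.inr false)) with hδ
  have hyδ : (⟨y, hy⟩ : V) ∈ Scheme.basicOpen V δ := (hom_ne_iff _ _ V.ι hi hj ⟨y, hy⟩).mp h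
  let W : Scheme.Opens V := Scheme.basicOpen V δ
  obtain ⟨O, hO, e, he⟩ := exists_opens_of_isOpenImmersion (W.ι ≫ V.ι) ⟨⟨y, hy⟩, hyδ⟩
  suffices c : AdaptedCoords s (W.ι ≫ V.ι) i j from ⟨O, hO, ⟨he ▸ c.comp e⟩⟩
  have hu : IsUnit (br (pb W.ι (a (.inr true))) (pb W.ι (a (.inr false)))) := by
    have := isUnit_ι_basicOpen δ
    simp only [hδ, br, map_sub, map_mul] at this
    exact this
  have key : ∀ x : Fin 2 → Γ(W, ⊤), (frameGL _ _ hu : Matrix _ _ _).mulVec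
      (((frameGL _ _ hu)⁻¹ : GL (Fin 2) Γ(W, ⊤)).val.mulVec x) = x := fun x => by
    rw [Matrix.mulVec_mulVec, ← Units.val_mul, mul_inv_cancel, Units.val_one, Matrix.one_mulVec]
  refine ⟨(frameGL _ _ hu)⁻¹, ?_, ?_,
    fun k => ((frameGL _ _ hu)⁻¹ : GL (Fin 2) Γ(W, ⊤)).val.mulVec (pb W.ι (a (.inl k))), ?_⟩
  · rw [inv_inv, frameGL_zero_one, Category.assoc]
    exact hi.comp _
  · rw [inv_inv, frameGL_one_zero, Category.assoc]
    exact hj.comp _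
  · intro k
    rw [inv_inv, key, Category.assoc]
    exact (hk k).comp _

lemma exists_adaptedCoords₂ {Y : Scheme.{u}} {n : ℕ} (s s' : Fin n → Sec Y) {K : Kind}
    {i j : Mark n K} {y : Y} (h : y ∈ pairLocus (extend s) (extend s') i j) :
    ∃ V : Y.Opens, y ∈ V ∧ Nonempty (AdaptedCoords s V.ι i j) ∧
      Nonempty (AdaptedCoords s' V.ι i j) := by
  obtain ⟨V, hV, ⟨c⟩⟩ := exists_adaptedCoords s h.1
  obtain ⟨V', hV', ⟨c'⟩⟩ := exists_adaptedCoords s' h.2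
  refine ⟨V ⊓ V', ⟨hV, hV'⟩, ⟨?_⟩, ⟨?_⟩⟩
  · have := c.comp (Y.homOfLE (inf_le_left : V ⊓ V' ≤ V))
    rwa [Scheme.homOfLE_ι] at this
  · have := c'.comp (Y.homOfLE (inf_le_right : V ⊓ V' ≤ V'))
    rwa [Scheme.homOfLE_ι] at this

/-! ### The relation defined by the cross ratios -/

section
variable {Y : Scheme.{u}} {n : ℕ} (s s' : Fin n → Sec Y) {K : Kind} {T T' : Scheme.{u}}

/-- The sections `s_i, s_j, s_k` over `t`, followed by the point `f`. -/
def quad (t : T ⟶ Y) (i j : Mark n K) (k : Fin n) (f : T ⟶ P1.{u}) : Fin 4 → (T ⟶ P1.{u}) :=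
  ![t ≫ (extend s i).toP1, t ≫ (extend s j).toP1, t ≫ (s k).toP1, f]

lemma comp_quad (g : T' ⟶ T) (t : T ⟶ Y) (i j : Mark n K) (k : Fin n) (f : T ⟶ P1.{u}) :
    (fun m => g ≫ quad s t i j k f m) = quad s (g ≫ t) i j k (g ≫ f) := by
  funext m
  fin_cases m <;> simp [quad]

/-- The pair of points `f, f'` satisfies all equations of cross ratios with the sections. -/
def crossRel (K : Kind) (t : T ⟶ Y) (f f' : T ⟶ P1.{u}) : Prop :=
  ∀ i j : Mark n K, Adm i j → ∀ k, CrossPt (quad s t i j k f) (quad s' t i j k f')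

variable {s s'}

lemma crossRel_symm {t : T ⟶ Y} {f f' : T ⟶ P1.{u}} (h : crossRel s s' K t f f') :
    crossRel s' s K t f' f := fun i j hij k => (h i j hij k).symm

lemma crossRel.comp {t : T ⟶ Y} {f f' : T ⟶ P1.{u}} (h : crossRel s s' K t f f') (g : T' ⟶ T) :
    crossRel s s' K (g ≫ t) (g ≫ f) (g ≫ f') := fun i j hij k => by
  have := (h i j hij k).comp g
  rwa [comp_quad, comp_quad] at this

lemma crossRel_of_local {t : T ⟶ Y} {f f' : T ⟶ P1.{u}}
    (h : ∀ x : T, ∃ V : T.Opens, x ∈ V ∧ crossRel s s' K (V.ι ≫ t) (V.ι ≫ f) (V.ι ≫ f')) :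
    crossRel s s' K t f f' := fun i j hij k => crossPt_of_local fun x => by
  obtain ⟨V, hV, h⟩ := h x
  refine ⟨V, hV, ?_⟩
  rw [comp_quad, comp_quad]
  exact h i j hij k

variable {t : T ⟶ Y} {i j : Mark n K}

/-- In adapted coordinates the equality of cross ratios is the equation of the curve. -/
lemma crossPt_quad_iff (c : AdaptedCoords s t i j) (c' : AdaptedCoords s' t i j) (k : Fin n)
    {f f' : T ⟶ P1.{u}} {x x' : Fin 2 → Γ(T, ⊤)} (hx : c.Represents f x)
    (hx' : c'.Represents f' x') :
    CrossPt (quad s t i j k f) (quad s' t i j k f') ↔ CurveEq c c' k x x' := by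
  have h1 : ∀ m, HasCoords (quad s t i j k f m)
      ((c.g⁻¹ : GL (Fin 2) Γ(T, ⊤)).val.mulVec (![![0, 1], ![1, 0], c.a k, x] m)) := by
    intro m
    fin_cases m
    exacts [c.at_i, c.at_j, c.at_k k, hx]
  have h2 : ∀ m, HasCoords (quad s' t i j k f' m)
      ((c'.g⁻¹ : GL (Fin 2) Γ(T, ⊤)).val.mulVec (![![0, 1], ![1, 0], c'.a k, x'] m)) := by
    intro m
    fin_cases m
    exacts [c'.at_i, c'.at_j, c'.at_k k, hx']
  rw [crossPt_iff h1 h2, cross_mulVec_iff]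
  simp only [Cross, br, CurveEq, Matrix.cons_val]
  constructor <;> intro h <;> linear_combination h

/-- The relation between `s` and `s'` says that the marked points have the same cross ratios. -/
lemma crossPt_of_areRelated (hrel : AreRelated K s s') (hij : Adm i j)
    (ht : ∀ x, t x ∈ pairLocus (extend s) (extend s') i j) (k l : Fin n) :
    CrossPt (quad s t i j k (t ≫ (s l).toP1)) (quad s' t i j k (t ≫ (s' l).toP1)) := by
  refine crossPt_of_local fun x => ?_
  obtain ⟨V, hV, ⟨c⟩, ⟨c'⟩⟩ := exists_adaptedCoords₂ s s' (ht x)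
  refine ⟨t ⁻¹ᵁ V, hV, ?_⟩
  have h := (crossPt_quad_iff c c' k (c.at_k l) (c'.at_k l)).mpr (by
    have := hrel V i j hij c c' k l
    simp only [CurveEq]
    linear_combination this)
  have := h.comp (t ∣_ V)
  rw [comp_quad, comp_quad] at this ⊢
  simp only [← Category.assoc] at this ⊢
  rwa [morphismRestrict_ι] at this

lemma crossPt_of_left {P P' : Fin 4 → (T ⟶ P1.{u})} (h : P 3 = P 0) (h' : P' 3 = P' 0) :
    CrossPt P P' := by
  intro T' g X X' hX hX'
  have e := ((hX 3).eq_iff (hX 0)).mp (by rw [h])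
  have e' := ((hX' 3).eq_iff (hX' 0)).mp (by rw [h'])
  simp only [Cross, br, e, e']
  ring

lemma crossPt_of_right {P P' : Fin 4 → (T ⟶ P1.{u})} (h : P 3 = P 1) (h' : P' 3 = P' 1) :
    CrossPt P P' := by
  intro T' g X X' hX hX'
  have e := ((hX 3).eq_iff (hX 1)).mp (by rw [h])
  have e' := ((hX' 3).eq_iff (hX' 1)).mp (by rw [h'])
  simp only [Cross, br, e, e']
  ring

/-- For the sections `(0 : 1)`, `(1 : 0)` added for `P_n`, the equality of cross ratios is trivial,
since they are the sections `s_i, s_j`. -/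
lemma crossPt_mark (hrel : AreRelated K s s') (hij : Adm i j)
    (ht : ∀ x, t x ∈ pairLocus (extend s) (extend s') i j) (k : Fin n) (m : Mark n K) :
    CrossPt (quad s t i j k (t ≫ (extend s m).toP1)) (quad s' t i j k (t ≫ (extend s' m).toP1)) := by
  cases m with
  | pt l => exact crossPt_of_areRelated hrel hij ht k l
  | zero =>
    obtain ⟨rfl, -⟩ := hij
    exact crossPt_of_left rfl rfl
  | infty =>
    obtain ⟨-, rfl⟩ := hij
    exact crossPt_of_right rfl rfl

/-- The matrix that exchanges the two coordinates. -/
def swapGL (R : Type*) [CommRing R] : GL (Fin 2) R :=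
  Matrix.GeneralLinearGroup.mk'' !![0, 1; 1, 0] (by simp)

lemma swapGL_val (R : Type*) [CommRing R] : (swapGL R).val = !![0, 1; 1, 0] := rfl

lemma swapGL_mulVec {R : Type*} [CommRing R] (x : Fin 2 → R) :
    (swapGL R : Matrix (Fin 2) (Fin 2) R).mulVec x = ![x 1, x 0] := by
  funext r
  fin_cases r <;> simp [swapGL_val, Matrix.mulVec, dotProduct]

lemma pbGL_swapGL (g : T' ⟶ T) : pbGL g (swapGL Γ(T, ⊤)) = swapGL Γ(T', ⊤) := by
  ext a b
  fin_cases a <;> fin_cases b <;> simp [swapGL_val]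

/-- If the coefficient of `x_0 x'_1` in the `k`-th equation is invertible, then the equation is that
of a conic. -/
lemma crossPt_quad_iff_conic (c : AdaptedCoords s t i j) (c' : AdaptedCoords s' t i j) (k : Fin n)
    {w : Γ(T, ⊤)} (hw : c.a k 1 * c'.a k 0 * w = 1) {f f' : T ⟶ P1.{u}}
    (h : CrossPt (quad s t i j k f) (quad s' t i j k f')) :
    Conic (c.a k 0 * c'.a k 1 * w) (act c.g f) (act (swapGL _ * c'.g) f') := by
  intro T' g x x' hx hx'
  rw [comp_act] at hx hx'
  rw [pbGL_mul, pbGL_swapGL, ← act_act] at hx'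
  have hy' := hx'.act (swapGL _)⁻¹
  rw [act_act, inv_mul_cancel, act_one] at hy'
  have e : ((swapGL Γ(T', ⊤))⁻¹ : GL (Fin 2) Γ(T', ⊤)).val.mulVec x' = ![x' 1, x' 0] := by
    have : x' = (swapGL Γ(T', ⊤)).val.mulVec ![x' 1, x' 0] := by
      rw [swapGL_mulVec]; funext r; fin_cases r <;> rfl
    conv_lhs => rw [this]
    rw [Matrix.mulVec_mulVec, ← Units.val_mul, inv_mul_cancel, Units.val_one, Matrix.one_mulVec]
  rw [e] at hy'
  have hc := AdaptedCoords.represents_of_act (c := c.comp g) hx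
  have hc' := AdaptedCoords.represents_of_act (c := c'.comp g) hy'
  have h := h.comp g
  rw [comp_quad, comp_quad, crossPt_quad_iff _ _ k hc hc'] at h
  simp only [CurveEq, AdaptedCoords.comp, pb_apply, Matrix.cons_val_zero, Matrix.cons_val_one] at h
  have hw' := congrArg g.appTop hw
  simp only [map_mul, map_one] at hw' ⊢
  linear_combination (-g.appTop w) * h - x 0 * x' 0 * hw'

/-- If the coefficient of `x_0 x'_1` in one equation is invertible, then this equation implies all
others: all marked points lie on the conic defined by this equation. -/
lemma crossRel_iff_conic (hrel : AreRelated K s s') (hij : Adm i j) (c : AdaptedCoords s t i j)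
    (c' : AdaptedCoords s' t i j) (k : Fin n) {w : Γ(T, ⊤)} (hw : c.a k 1 * c'.a k 0 * w = 1)
    {f f' : T ⟶ P1.{u}} : crossRel s s' K t f f' ↔
    Conic (c.a k 0 * c'.a k 1 * w) (act c.g f) (act (swapGL _ * c'.g) f') := by
  refine ⟨fun h => crossPt_quad_iff_conic c c' k hw (h i j hij k), fun h i' j' _ k' => ?_⟩
  have hm := fun m => crossPt_quad_iff_conic c c' k hw
    (crossPt_mark hrel hij (fun x => ⟨c.ne x, c'.ne x⟩) k m)
  refine crossPt_of_conic c.g (swapGL _ * c'.g) (c.a k 0 * c'.a k 1 * w) fun m => ?_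
  fin_cases m
  exacts [hm i', hm j', hm (.pt k'), h]

end

/-! ### The correspondence of two related tuples -/

/-- The condition that the open sets on which three sections are distinct cover the base. -/
def IsCovered {Y : Scheme.{u}} {n : ℕ} (K : Kind) (s s' : Fin n → Sec Y) : Prop :=
  ∀ y : Y, ∃ (i j : Mark n K) (k : Fin n), Adm i j ∧
    y ∈ pairLocus (extend s) (extend s') i j ∧ y ∈ tripleLocus (extend s) (extend s') i j (.pt k)

section
variable {Y : Scheme.{u}} {n : ℕ} {s s' : Fin n → Sec Y} {K : Kind} {T T' : Scheme.{u}}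
  {t : T ⟶ Y} {i j : Mark n K}

/-- The relation is symmetric in `s` and `s'`, so the case where the coefficient of `x_1 x'_0` is
invertible follows from the other one. -/
lemma AreRelated.symm (h : AreRelated K s s') : AreRelated K s' s := fun V i j hij c c' k l => by
  have := h V i j hij c' c k l
  linear_combination -this

lemma pairLocus_swap {I : Type} (s s' : I → Sec Y) (i j : I) :
    pairLocus s s' i j = pairLocus s s' j i := by
  ext y; simp only [pairLocus, Set.mem_ofPred_eq, ne_comm]

lemma exists_adaptedCoords_comp (x : T) (h : t x ∈ pairLocus (extend s) (extend s') i j) :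
    ∃ V : T.Opens, x ∈ V ∧ Nonempty (AdaptedCoords s (V.ι ≫ t) i j) ∧
      Nonempty (AdaptedCoords s' (V.ι ≫ t) i j) := by
  obtain ⟨V, hV, ⟨c⟩, ⟨c'⟩⟩ := exists_adaptedCoords₂ s s' h
  refine ⟨t ⁻¹ᵁ V, hV, ?_⟩
  rw [← morphismRestrict_ι]
  exact ⟨⟨c.comp _⟩, ⟨c'.comp _⟩⟩

lemma isOpen_ne (σ σ' : Sec Y) : IsOpen {y | σ.hom y ≠ σ'.hom y} := by
  rw [isOpen_iff_forall_mem_open]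
  intro y hy
  obtain ⟨V, a, b, hV, ha, hb⟩ := exists_local_coords₂ σ.toP1 σ'.toP1 y
  refine ⟨(V.ι ''ᵁ Scheme.basicOpen V (br a b) : Y.Opens), ?_, (V.ι ''ᵁ _).2,
    ⟨⟨y, hV⟩, (hom_ne_iff σ σ' V.ι ha hb ⟨y, hV⟩).mp hy, rfl⟩⟩
  rintro _ ⟨z, hz, rfl⟩
  exact (hom_ne_iff σ σ' V.ι ha hb z).mpr hz

lemma isOpen_pairLocus {I : Type} (s s' : I → Sec Y) (i j : I) : IsOpen (pairLocus s s' i j) :=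
  (isOpen_ne _ _).inter (isOpen_ne _ _)

lemma isOpen_tripleLocus {I : Type} (s s' : I → Sec Y) (i j k : I) :
    IsOpen (tripleLocus s s' i j k) :=
  ((isOpen_ne _ _).inter ((isOpen_ne _ _).inter (isOpen_ne _ _))).union
    ((isOpen_ne _ _).inter ((isOpen_ne _ _).inter (isOpen_ne _ _)))

lemma AdaptedCoords.exists_mem_basicOpen (c : AdaptedCoords s t i j) (k : Fin n) (x : T) :
    x ∈ T.basicOpen (c.a k 0) ∨ x ∈ T.basicOpen (c.a k 1) := by
  obtain ⟨r, hr⟩ := QuiverCurve.exists_mem_basicOpen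
    (AdaptedCoords.Represents.act (c := c) (c.at_k k)).1 x
  fin_cases r
  · exact Or.inl hr
  · exact Or.inr hr

/-- Where three sections are distinct, one of the two coefficients of the equation is
invertible. -/
lemma mem_basicOpen_of_mem_tripleLocus (c : AdaptedCoords s t i j) (c' : AdaptedCoords s' t i j)
    (k : Fin n) {x : T} (h : t x ∈ tripleLocus (extend s) (extend s') i j (.pt k)) :
    x ∈ T.basicOpen (c.a k 1 * c'.a k 0) ∨ x ∈ T.basicOpen (c.a k 0 * c'.a k 1) := by
  rw [Scheme.basicOpen_mul, Scheme.basicOpen_mul]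
  rcases h with ⟨-, h0, h1⟩ | ⟨-, h0, h1⟩
  · have h0 := (c.ne_left_iff k x).mp h0.symm
    have h1 := (c.ne_right_iff k x).mp h1.symm
    rcases c'.exists_mem_basicOpen k x with h | h
    · exact Or.inl ⟨h1, h⟩
    · exact Or.inr ⟨h0, h⟩
  · have h0 := (c'.ne_left_iff k x).mp h0.symm
    have h1 := (c'.ne_right_iff k x).mp h1.symm
    rcases c.exists_mem_basicOpen k x with h | h
    · exact Or.inr ⟨h, h1⟩
    · exact Or.inl ⟨h, h0⟩

lemma isUnit_comp_ι_basicOpen (c : AdaptedCoords s t i j) (c' : AdaptedCoords s' t i j) (k : Fin n)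
    (r r' : Fin 2) : IsUnit ((c.comp (T.basicOpen (c.a k r * c'.a k r')).ι).a k r *
      (c'.comp (T.basicOpen (c.a k r * c'.a k r')).ι).a k r') := by
  have := isUnit_ι_basicOpen (c.a k r * c'.a k r')
  rw [map_mul] at this
  exact this

lemma crossRel_of_isUnit (hrel : AreRelated K s s') (hij : Adm i j) (c : AdaptedCoords s t i j)
    (c' : AdaptedCoords s' t i j) (k : Fin n) (hu : IsUnit (c.a k 1 * c'.a k 0))
    {f f' : T ⟶ P1.{u}} (h : CrossPt (quad s t i j k f) (quad s' t i j k f')) :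
    crossRel s s' K t f f' := by
  obtain ⟨w, hw⟩ := hu.exists_right_inv
  exact (crossRel_iff_conic hrel hij c c' k hw).mpr (crossPt_quad_iff_conic c c' k hw h)

/-- The equation for `k` implies all others where three of the sections `i, j, k` are distinct. -/
lemma crossRel_of_mem_tripleLocus (hrel : AreRelated K s s') (hij : Adm i j)
    (c : AdaptedCoords s t i j) (c' : AdaptedCoords s' t i j) {f f' : T ⟶ P1.{u}}
    (h : ∀ x, ∃ k, t x ∈ tripleLocus (extend s) (extend s') i j (.pt k) ∧
      CrossPt (quad s t i j k f) (quad s' t i j k f')) : crossRel s s' K t f f' := by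
  refine crossRel_of_local fun x => ?_
  obtain ⟨k, hx, h⟩ := h x
  rcases mem_basicOpen_of_mem_tripleLocus c c' k hx with hx | hx
  · refine ⟨_, hx, crossRel_of_isUnit hrel hij (c.comp _) (c'.comp _) k
      (isUnit_comp_ι_basicOpen c c' k 1 0) ?_⟩
    rw [← comp_quad, ← comp_quad]
    exact h.comp _
  · rw [mul_comm] at hx
    refine ⟨_, hx, crossRel_symm (crossRel_of_isUnit hrel.symm hij (c'.comp _) (c.comp _) k
      (isUnit_comp_ι_basicOpen c' c k 1 0) ?_)⟩
    rw [← comp_quad, ← comp_quad]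
    exact h.symm.comp _

/-- The conic given by the `k`-th equation if the coefficient of `x_0 x'_1` is invertible. -/
def frameOfUnit (hrel : AreRelated K s s') (hij : Adm i j) (c : AdaptedCoords s t i j)
    (c' : AdaptedCoords s' t i j) (k : Fin n) {w : Γ(T, ⊤)} (hw : c.a k 1 * c'.a k 0 * w = 1) :
    Frame (fun _ t f f' => crossRel s s' K t f f') t where
  M := c.g
  M' := swapGL _ * c'.g
  d := c.a k 0 * c'.a k 1 * w
  spec T' g f f' := by
    have := congrArg g.appTop hw
    rw [map_mul, map_mul, map_one] at this
    rw [crossRel_iff_conic hrel hij (c.comp g) (c'.comp g) k this, pbGL_mul, pbGL_swapGL, map_mul,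
      map_mul]
    rfl

/-- The conic given by the `k`-th equation if the coefficient of `x_1 x'_0` is invertible. -/
def frameOfUnit' (hrel : AreRelated K s s') (hij : Adm i j) (c : AdaptedCoords s t i j)
    (c' : AdaptedCoords s' t i j) (k : Fin n) {w : Γ(T, ⊤)} (hw : c'.a k 1 * c.a k 0 * w = 1) :
    Frame (fun _ t f f' => crossRel s s' K t f f') t where
  M := (frameOfUnit hrel.symm hij c' c k hw).M'
  M' := (frameOfUnit hrel.symm hij c' c k hw).M
  d := (frameOfUnit hrel.symm hij c' c k hw).d
  spec T' g f f' := by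
    rw [conic_comm, ← (frameOfUnit hrel.symm hij c' c k hw).spec]
    exact ⟨crossRel_symm, crossRel_symm⟩

/-- The correspondence between the projective lines that contain two related tuples. -/
def correspondence (hrel : AreRelated K s s') (hcov : IsCovered K s s') : Correspondence Y where
  rel _ t f f' := crossRel s s' K t f f'
  comp _ _ g _ _ _ h := h.comp g
  glue _ _ _ _ h := crossRel_of_local h
  frame y := by
    obtain ⟨i, j, k, hij, hp, ht⟩ := hcov y
    obtain ⟨V, hV, ⟨c⟩, ⟨c'⟩⟩ := exists_adaptedCoords₂ s s' hp
    have key : ∃ W : Scheme.Opens V, (⟨y, hV⟩ : V) ∈ W ∧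
        Nonempty (Frame (fun _ t f f' => crossRel s s' K t f f') (W.ι ≫ V.ι)) := by
      rcases mem_basicOpen_of_mem_tripleLocus c c' k (x := (⟨y, hV⟩ : V)) ht with hx | hx
      · obtain ⟨w, hw⟩ := (isUnit_comp_ι_basicOpen c c' k 1 0).exists_right_inv
        exact ⟨_, hx, ⟨frameOfUnit hrel hij (c.comp _) (c'.comp _) k hw⟩⟩
      · rw [mul_comm] at hx
        obtain ⟨w, hw⟩ := (isUnit_comp_ι_basicOpen c' c k 1 0).exists_right_inv
        exact ⟨_, hx, ⟨frameOfUnit' hrel hij (c.comp _) (c'.comp _) k hw⟩⟩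
    obtain ⟨W, hW, ⟨F⟩⟩ := key
    obtain ⟨O, hO, e, he⟩ := exists_opens_of_isOpenImmersion (W.ι ≫ V.ι) ⟨⟨y, hV⟩, hW⟩
    exact ⟨O, hO, ⟨he ▸ F.comp e⟩⟩

variable {hrel : AreRelated K s s'} {hcov : IsCovered K s s'}

/-- If one coefficient of the `k`-th equation is invertible, then the other one is the equation of
the degeneration locus. -/
lemma deg_iff_of_isUnit (hij : Adm i j) (c : AdaptedCoords s t i j)
    (c' : AdaptedCoords s' t i j) (k : Fin n) (hu : IsUnit (c.a k 1 * c'.a k 0)) :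
    (correspondence hrel hcov).Deg t ↔ c.a k 0 * c'.a k 1 = 0 := by
  obtain ⟨w, hw⟩ := hu.exists_right_inv
  rw [Correspondence.deg_iff (K := correspondence hrel hcov) (frameOfUnit hrel hij c c' k hw)]
  exact (IsUnit.of_mul_eq_one_right _ hw).mul_left_eq_zero

/-- The symmetric case, with the roles of `s` and `s'` exchanged. -/
lemma deg_iff_of_isUnit' (hij : Adm i j) (c : AdaptedCoords s t i j)
    (c' : AdaptedCoords s' t i j) (k : Fin n) (hu : IsUnit (c'.a k 1 * c.a k 0)) :
    (correspondence hrel hcov).Deg t ↔ c'.a k 0 * c.a k 1 = 0 := by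
  obtain ⟨w, hw⟩ := hu.exists_right_inv
  rw [Correspondence.deg_iff (K := correspondence hrel hcov) (frameOfUnit' hrel hij c c' k hw)]
  exact (IsUnit.of_mul_eq_one_right _ hw).mul_left_eq_zero

lemma AdaptedCoords.eq_left_iff (c : AdaptedCoords s t i j) (k : Fin n) :
    t ≫ (s k).toP1 = t ≫ (extend s i).toP1 ↔ c.a k 0 = 0 := by
  rw [(c.at_k k).eq_iff c.at_i, ← sub_eq_zero]
  change br _ _ = 0 ↔ _
  rw [br_mulVec, (Matrix.isUnits_det_units c.g⁻¹).mul_right_eq_zero]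
  simp [br]

lemma AdaptedCoords.eq_right_iff (c : AdaptedCoords s t i j) (k : Fin n) :
    t ≫ (s k).toP1 = t ≫ (extend s j).toP1 ↔ c.a k 1 = 0 := by
  rw [(c.at_k k).eq_iff c.at_j, ← sub_eq_zero]
  change br _ _ = 0 ↔ _
  rw [br_mulVec, (Matrix.isUnits_det_units c.g⁻¹).mul_right_eq_zero]
  simp [br]

lemma comp_hom_eq_iff (σ σ' : Sec Y) (t : T ⟶ Y) :
    t ≫ σ.hom = t ≫ σ'.hom ↔ t ≫ σ.toP1 = t ≫ σ'.toP1 := by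
  constructor
  · intro h
    have := congrArg (fun f => f ≫ PLine.toP1 Y) h
    simpa only [Category.assoc, Sec.toP1] using this
  · intro h
    rw [σ.hom_eq, σ'.hom_eq, PLine.comp_lift, PLine.comp_lift, h]

lemma isUnit_of_forall_mem_basicOpen {a : Γ(T, ⊤)} (h : ∀ x, x ∈ T.basicOpen a) : IsUnit a := by
  have := (isUnit_appTop_iff (𝟙 T) a).mpr h
  simpa using this

/-- A morphism factors through the degeneration scheme if and only if this holds locally. -/
lemma deg_iff_of_local {P : ∀ ⦃T : Scheme.{u}⦄, (T ⟶ Y) → Prop} (G : Correspondence Y)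
    (h : ∀ x : T, ∃ V : T.Opens, x ∈ V ∧ (G.Deg (V.ι ≫ t) ↔ P (V.ι ≫ t)))
    (hP : ∀ V : T.Opens, P t → P (V.ι ≫ t))
    (hP' : (∀ x : T, ∃ V : T.Opens, x ∈ V ∧ P (V.ι ≫ t)) → P t) : G.Deg t ↔ P t := by
  constructor
  · intro H
    refine hP' fun x => ?_
    obtain ⟨V, hV, h⟩ := h x
    exact ⟨V, hV, h.mp (H.comp V.ι)⟩
  · intro H
    refine Correspondence.deg_of_local fun x => ?_
    obtain ⟨V, hV, h⟩ := h x
    exact ⟨V, hV, h.mpr (hP V H)⟩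

lemma deg_iff_comp_eq (G : Correspondence Y) (σ σ' : Sec Y)
    (h : ∀ x : T, ∃ V : T.Opens, x ∈ V ∧
      (G.Deg (V.ι ≫ t) ↔ (V.ι ≫ t) ≫ σ.toP1 = (V.ι ≫ t) ≫ σ'.toP1)) :
    G.Deg t ↔ t ≫ σ.hom = t ≫ σ'.hom := by
  rw [comp_hom_eq_iff]
  refine deg_iff_of_local (P := fun _ t => t ≫ σ.toP1 = t ≫ σ'.toP1) G h
    (fun V h => by rw [Category.assoc, h, Category.assoc]) fun h => hom_ext_of_local fun x => ?_
  obtain ⟨V, hV, h⟩ := h x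
  exact ⟨V, hV, by simpa using h⟩

lemma isUnit_left (c : AdaptedCoords s t i j) (k : Fin n)
    (h : ∀ x, (s k).hom (t x) ≠ (extend s i).hom (t x)) : IsUnit (c.a k 0) :=
  isUnit_of_forall_mem_basicOpen fun x => (c.ne_left_iff k x).mp (h x)

lemma isUnit_right (c : AdaptedCoords s t i j) (k : Fin n)
    (h : ∀ x, (s k).hom (t x) ≠ (extend s j).hom (t x)) : IsUnit (c.a k 1) :=
  isUnit_of_forall_mem_basicOpen fun x => (c.ne_right_iff k x).mp (h x)

/-- Under the conditions on `i, j, k` all coordinates of `s_k` and `s'_k` are invertible except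
possibly one, and this coordinate generates the ideal of the degeneration locus. Exchanging `i` and
`j` exchanges the two coordinates. -/
lemma isDegenerationScheme {Z : Scheme.{u}} (ζ : Z ⟶ Y) [IsClosedImmersion ζ]
    (hζ : ∀ (T : Scheme.{u}) (t : T ⟶ Y), (∃ z, z ≫ ζ = t) ↔ (correspondence hrel hcov).Deg t) :
    IsDegenerationScheme K s s' ζ := by
  refine ⟨inferInstance, fun i j hij k T t => ⟨fun h => ?_, fun h => ?_⟩⟩
  · rw [hζ]
    refine deg_iff_comp_eq _ _ _ fun x => ?_
    rcases hij with hij | hij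
    · obtain ⟨V, hV, ⟨c⟩, ⟨c'⟩⟩ := exists_adaptedCoords_comp x (h x).1
      refine ⟨V, hV, ?_⟩
      have h0 := isUnit_left c k fun x => (h (V.ι x)).2.1.2.1.symm
      have h1 := isUnit_right c k fun x => (h (V.ι x)).2.1.2.2.symm
      have h2 := isUnit_left c' k fun x => (h (V.ι x)).2.2
      rw [deg_iff_of_isUnit hij c c' k (h1.mul h2), h0.mul_right_eq_zero]
      exact (c'.eq_right_iff k).symm
    · obtain ⟨V, hV, ⟨c⟩, ⟨c'⟩⟩ := exists_adaptedCoords_comp (i := j) (j := i) x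
        (pairLocus_swap (extend s) _ _ _ ▸ (h x).1)
      refine ⟨V, hV, ?_⟩
      have h0 := isUnit_right c k fun x => (h (V.ι x)).2.1.2.1.symm
      have h1 := isUnit_left c k fun x => (h (V.ι x)).2.1.2.2.symm
      have h2 := isUnit_right c' k fun x => (h (V.ι x)).2.2
      rw [deg_iff_of_isUnit' hij c c' k (h2.mul h1), h0.mul_left_eq_zero]
      exact (c'.eq_left_iff k).symm
  · rw [hζ]
    refine deg_iff_comp_eq _ _ _ fun x => ?_
    rcases hij with hij | hij
    · obtain ⟨V, hV, ⟨c⟩, ⟨c'⟩⟩ := exists_adaptedCoords_comp x (h x).1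
      refine ⟨V, hV, ?_⟩
      have h0 := isUnit_left c' k fun x => (h (V.ι x)).2.1.2.1.symm
      have h1 := isUnit_right c' k fun x => (h (V.ι x)).2.1.2.2.symm
      have h2 := isUnit_right c k fun x => (h (V.ι x)).2.2
      rw [deg_iff_of_isUnit hij c c' k (h2.mul h0), h1.mul_left_eq_zero]
      exact (c.eq_left_iff k).symm
    · obtain ⟨V, hV, ⟨c⟩, ⟨c'⟩⟩ := exists_adaptedCoords_comp (i := j) (j := i) x
        (pairLocus_swap (extend s) _ _ _ ▸ (h x).1)
      refine ⟨V, hV, ?_⟩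
      have h0 := isUnit_right c' k fun x => (h (V.ι x)).2.1.2.1.symm
      have h1 := isUnit_left c' k fun x => (h (V.ι x)).2.1.2.2.symm
      have h2 := isUnit_left c k fun x => (h (V.ι x)).2.2
      rw [deg_iff_of_isUnit' hij c c' k (h0.mul h2), h1.mul_right_eq_zero]
      exact (c.eq_right_iff k).symm

/-- A pair of sections lies on the curve. -/
lemma crossRel_mark (hrel : AreRelated K s s') (hcov : IsCovered K s s') (m : Mark n K) :
    crossRel s s' K (𝟙 Y) (extend s m).toP1 (extend s' m).toP1 := by
  refine crossRel_of_local fun y => ?_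
  obtain ⟨i, j, k, hij, hp, ht⟩ := hcov y
  obtain ⟨V, hV, ⟨c⟩, ⟨c'⟩⟩ := exists_adaptedCoords₂ s s' hp
  let W : Y.Opens := V ⊓ ⟨_, isOpen_tripleLocus (extend s) (extend s') i j (.pt k)⟩
  have e : Y.homOfLE (inf_le_left : W ≤ V) ≫ V.ι = W.ι := Scheme.homOfLE_ι _ _
  refine ⟨W, ⟨hV, ht⟩, ?_⟩
  have c := c.comp (Y.homOfLE (inf_le_left : W ≤ V))
  have c' := c'.comp (Y.homOfLE (inf_le_left : W ≤ V))
  rw [e] at c c'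
  rw [Category.comp_id]
  exact crossRel_of_mem_tripleLocus hrel hij c c' fun x => ⟨k, x.2.2,
    crossPt_mark hrel hij (fun x => ⟨c.ne x, c'.ne x⟩) k m⟩

end

/-! ### Subrepresentations and stability -/

section
variable {K : Kind} {n : ℕ} {k : Type u} [Field k]

/-- The vector `v` lies in the subspaces `H` at the sinks. -/
def MemHubs (H : Fin K.hubs → Submodule k (Fin K.hubDim → k)) (v : Fin 2 → k) : Prop :=
  ∀ j, (fun r => v (entry K j r)) ∈ H j

open Classical in
/-- The subspaces `H` at the sinks together with the sources in `I`. -/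
def subOf (H : Fin K.hubs → Submodule k (Fin K.hubDim → k)) (I : Finset (Fin n)) :
    ∀ q : Vertex K n, Submodule k (Fin (dimVec K n q) → k)
  | .inl j => H j
  | .inr i => if i ∈ I then (⊤ : Submodule k (Fin 1 → k)) else ⊥

lemma isSubrep_subOf {H : Fin K.hubs → Submodule k (Fin K.hubDim → k)} {I : Finset (Fin n)}
    {v : Fin n → Fin 2 → k} (h : ∀ i ∈ I, MemHubs H (v i)) :
    IsSubrep (repOf K v) (subOf H I) := by
  rintro _ _ ⟨i, j⟩ x hx
  have e : (repOf K v (Arrow.mk i j)).mulVec x = (x (0 : Fin 1)) • fun r => v i (entry K j r) := by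
    funext r
    change ∑ c : Fin 1, v i (entry K j r) * x c = x (0 : Fin 1) * v i (entry K j r)
    rw [Fin.sum_univ_one, mul_comm]
  rw [e]
  change _ ∈ H j
  by_cases hi : i ∈ I
  · exact (H j).smul_mem _ (h i hi j)
  · have hs : subOf H I (.q i) = (⊥ : Submodule k (Fin 1 → k)) := if_neg hi
    have hx : x ∈ (⊥ : Submodule k (Fin 1 → k)) :=
      Eq.mp (congrArg (fun S : Submodule k (Fin 1 → k) => x ∈ S) hs) hx
    have hx : x (0 : Fin 1) = 0 := congrFun ((Submodule.mem_bot k).mp hx) 0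
    rw [hx, zero_smul]
    exact (H j).zero_mem

lemma sum_vertex {M : Type*} [AddCommMonoid M] (f : Vertex K n → M) :
    ∑ q, f q = ∑ j, f (.hub j) + ∑ i, f (.q i) := Fintype.sum_sum_type f

lemma weightOf_subOf (θ : Vertex K n → ℚ) (H : Fin K.hubs → Submodule k (Fin K.hubDim → k))
    (I : Finset (Fin n)) : weightOf θ (subOf H I) =
      ∑ j, θ (.hub j) * (Module.finrank k (H j) : ℚ) + ∑ i ∈ I, θ (.q i) := by
  classical
  rw [weightOf, sum_vertex]
  congr 1
  have e : ∀ i, θ (.q i) * (Module.finrank k (subOf H I (.q i)) : ℚ) =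
      if i ∈ I then θ (.q i) else 0 := fun i => by
    split_ifs with hi
    · have : subOf H I (.q i) = (⊤ : Submodule k (Fin 1 → k)) := if_pos hi
      have : Module.finrank k (subOf H I (.q i)) = 1 :=
        (congrArg (fun S : Submodule k (Fin 1 → k) => Module.finrank k S) this).trans (by simp)
      rw [this, Nat.cast_one, mul_one]
    · have : subOf H I (.q i) = (⊥ : Submodule k (Fin 1 → k)) := if_neg hi
      have : Module.finrank k (subOf H I (.q i)) = 0 :=
        (congrArg (fun S : Submodule k (Fin 1 → k) => Module.finrank k S) this).trans (by simp)
      rw [this, Nat.cast_zero, mul_zero]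
  simp only [e, Finset.sum_ite_mem, Finset.univ_inter]

lemma sum_mul_dimVec (θ : Vertex K n → ℚ) : ∑ q, θ q * (dimVec K n q : ℚ) =
    ∑ j, θ (.hub j) * (K.hubDim : ℚ) + ∑ i, θ (.q i) := by
  rw [sum_vertex]
  congr 1
  refine Finset.sum_congr rfl fun i _ => ?_
  change _ * ((1 : ℕ) : ℚ) = _
  simp

/-- The weights of two families of subspaces of complementary dimensions add up to zero. -/
lemma weight_add_weight {θ : Vertex K n → ℚ} (hθ : ∑ q, θ q * (dimVec K n q : ℚ) = 0)
    {H H' : Fin K.hubs → Submodule k (Fin K.hubDim → k)}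
    (hd : ∀ j, Module.finrank k (H j) + Module.finrank k (H' j) = K.hubDim) (I : Finset (Fin n)) :
    weightOf θ (subOf H I) + weightOf θ (subOf H' Iᶜ) = 0 := by
  have e : ∀ j, θ (.hub j) * (K.hubDim : ℚ) = θ (.hub j) * (Module.finrank k (H j) : ℚ) +
      θ (.hub j) * (Module.finrank k (H' j) : ℚ) := fun j => by
    rw [← mul_add]
    congr 1
    exact_mod_cast (hd j).symm
  rw [sum_mul_dimVec, ← Finset.sum_add_sum_compl I] at hθ
  simp only [e, Finset.sum_add_distrib] at hθ
  rw [weightOf_subOf, weightOf_subOf]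
  linarith

/-- The vectors of a stable representation are not contained in the union of two families of
subspaces at the sinks of complementary dimensions. Otherwise there would be two subrepresentations
of complementary dimensions; their weights add up to zero and are not positive, so both vanish. -/
lemma IsStable.exists_not_memHubs {θ : Vertex K n → ℚ} {v : Fin n → Fin 2 → k}
    (h : IsStable θ (repOf K v)) {H H' : Fin K.hubs → Submodule k (Fin K.hubDim → k)}
    (hd : ∀ j, Module.finrank k (H j) + Module.finrank k (H' j) = K.hubDim)
    (hbot : ¬ ∀ j, H j = ⊥) (htop : ¬ ∀ j, H j = ⊤) :
    ∃ i, ¬ MemHubs H (v i) ∧ ¬ MemHubs H' (v i) := by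
  classical
  by_contra! hc
  let I : Finset (Fin n) := Finset.univ.filter fun i => MemHubs H (v i)
  have h1 := isSubrep_subOf (H := H) (I := I) (v := v) fun i hi => (Finset.mem_filter.mp hi).2
  have h2 := isSubrep_subOf (H := H') (I := Iᶜ) (v := v) fun i hi => hc i fun h => by
    simp [I, h] at hi
  have := weight_add_weight h.1.1 hd I
  have h0 : weightOf θ (subOf H I) = 0 :=
    le_antisymm (h.1.2 _ h1) (by linarith [h.1.2 _ h2])
  rcases h.2 _ h1 h0 with h | h
  · exact hbot fun j => h (.hub j)
  · exact htop fun j => h (.hub j)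

/-! ### Lines -/

/-- The subspaces at the sinks spanned by a vector. -/
def hubLine (K : Kind) (w : Fin 2 → k) (j : Fin K.hubs) : Submodule k (Fin K.hubDim → k) :=
  Submodule.span k {fun r => w (entry K j r)}

lemma memHubs_hubLine_smul (c : k) (w : Fin 2 → k) : MemHubs (hubLine K w) (c • w) := fun _ =>
  Submodule.smul_mem _ c (Submodule.subset_span rfl)

lemma exists_smul_eq_of_br_eq_zero {v w : Fin 2 → k} (hw : w ≠ 0) (h : br v w = 0) :
    ∃ c : k, v = c • w := by
  simp only [br] at h
  by_cases h0 : w 0 = 0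
  · have h1 : w 1 ≠ 0 := fun h1 => hw (by funext r; fin_cases r <;> assumption)
    refine ⟨v 1 / w 1, funext fun r => ?_⟩
    fin_cases r
    · have : v 0 * w 1 = 0 := by simpa [h0] using h
      simpa [h0, h1] using this
    · simp [h1]
  · refine ⟨v 0 / w 0, funext fun r => ?_⟩
    fin_cases r
    · simp [h0]
    · simp only [Fin.mk_one, Pi.smul_apply, smul_eq_mul, Fin.isValue]
      field_simp
      linear_combination -h

lemma br_ne_zero_of_not_memHubs {v w : Fin 2 → k} (hw : w ≠ 0) (h : ¬ MemHubs (hubLine K w) v) :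
    br v w ≠ 0 := fun h0 => by
  obtain ⟨c, rfl⟩ := exists_smul_eq_of_br_eq_zero hw h0
  exact h (memHubs_hubLine_smul c w)

/-- Two vectors span subspaces at the sinks of complementary dimensions: any two nonzero vectors for
`Q_n`, even if they are proportional, and nonzero vectors on different coordinate axes for
`P_n`. -/
def AreTransverse : (K : Kind) → (Fin 2 → k) → (Fin 2 → k) → Prop
  | .Q, w, w' => w ≠ 0 ∧ w' ≠ 0
  | .P, w, w' => (w 0 = 0 ∧ w 1 ≠ 0 ∧ w' 0 ≠ 0 ∧ w' 1 = 0) ∨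
      (w 0 ≠ 0 ∧ w 1 = 0 ∧ w' 0 = 0 ∧ w' 1 ≠ 0)

lemma finrank_hubLine_Q {w : Fin 2 → k} (hw : w ≠ 0) : ∀ j : Fin Kind.Q.hubs,
    Module.finrank k (hubLine .Q w j) = 1 :=
  fun _ => finrank_span_singleton hw

lemma finrank_hubLine_P_of_eq {w : Fin 2 → k} {j : Fin 2} (hw : w j = 0) :
    Module.finrank k (hubLine .P w j) = 0 := by
  have : (fun r => w (entry .P j r) : Fin Kind.P.hubDim → k) = 0 := funext fun _ => hw
  have h : hubLine .P w j = ⊥ := by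
    change Submodule.span k {fun r => w (entry .P j r)} = ⊥
    rw [this, Submodule.span_zero_singleton]
  rw [h, finrank_bot]

lemma finrank_hubLine_P_of_ne {w : Fin 2 → k} {j : Fin 2} (hw : w j ≠ 0) :
    Module.finrank k (hubLine .P w j) = 1 :=
  finrank_span_singleton fun h => hw (congrFun h (0 : Fin 1))

lemma AreTransverse.finrank_add {w w' : Fin 2 → k} (h : AreTransverse K w w') (j : Fin K.hubs) :
    Module.finrank k (hubLine K w j) + Module.finrank k (hubLine K w' j) = K.hubDim := by
  cases K with
  | Q => rw [finrank_hubLine_Q h.1, finrank_hubLine_Q h.2]; rfl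
  | P =>
    rcases h with ⟨h0, h1, h0', h1'⟩ | ⟨h0, h1, h0', h1'⟩ <;> revert j <;>
      refine Fin.forall_fin_two.mpr ⟨?_, ?_⟩
    · rw [finrank_hubLine_P_of_eq h0, finrank_hubLine_P_of_ne h0']; rfl
    · rw [finrank_hubLine_P_of_ne h1, finrank_hubLine_P_of_eq h1']; rfl
    · rw [finrank_hubLine_P_of_ne h0, finrank_hubLine_P_of_eq h0']; rfl
    · rw [finrank_hubLine_P_of_eq h1, finrank_hubLine_P_of_ne h1']; rfl

lemma AreTransverse.exists_finrank {w w' : Fin 2 → k} (h : AreTransverse K w w') :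
    ∃ j, Module.finrank k (hubLine K w j) = 1 := by
  cases K with
  | Q => exact ⟨(0 : Fin 1), finrank_hubLine_Q h.1 _⟩
  | P =>
    rcases h with ⟨-, h, -⟩ | ⟨h, -⟩
    · exact ⟨(1 : Fin 2), finrank_hubLine_P_of_ne h⟩
    · exact ⟨(0 : Fin 2), finrank_hubLine_P_of_ne h⟩

lemma AreTransverse.symm {w w' : Fin 2 → k} (h : AreTransverse K w w') : AreTransverse K w' w := by
  cases K with
  | Q => exact ⟨h.2, h.1⟩
  | P =>
    rcases h with ⟨h0, h1, h0', h1'⟩ | ⟨h0, h1, h0', h1'⟩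
    · exact Or.inr ⟨h0', h1', h0, h1⟩
    · exact Or.inl ⟨h0', h1', h0, h1⟩

lemma AreTransverse.ne_zero {w w' : Fin 2 → k} (h : AreTransverse K w w') : w ≠ 0 := by
  rintro rfl
  cases K with
  | Q => exact h.1 rfl
  | P => rcases h with ⟨-, h, -⟩ | ⟨h, -⟩ <;> exact h rfl

/-- A stable representation contains a vector that is not proportional to either of two transverse
vectors. -/
lemma IsStable.exists_br_ne_zero {θ : Vertex K n → ℚ} {v : Fin n → Fin 2 → k}
    (h : IsStable θ (repOf K v)) {w w' : Fin 2 → k} (hw : AreTransverse K w w') :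
    ∃ i, br (v i) w ≠ 0 ∧ br (v i) w' ≠ 0 := by
  obtain ⟨i, h1, h2⟩ := h.exists_not_memHubs hw.finrank_add
    (fun h0 => by
      obtain ⟨j, hj⟩ := hw.exists_finrank
      rw [h0 j, finrank_bot] at hj
      exact zero_ne_one hj)
    (fun h0 => by
      obtain ⟨j, hj⟩ := hw.symm.exists_finrank
      have := hw.finrank_add j
      rw [h0 j, hj, finrank_top, Module.finrank_fin_fun] at this
      omega)
  exact ⟨i, br_ne_zero_of_not_memHubs hw.ne_zero h1, br_ne_zero_of_not_memHubs hw.symm.ne_zero h2⟩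

/-! ### Isomorphisms of representations and semistability -/

/-- Semistability is tested on the preimages of the subrepresentations under the isomorphism. -/
lemma IsRepIso.isSemistable {Q : Type} [Fintype Q] [Quiver.{0} Q] {d : Q → ℕ} {θ : Q → ℚ}
    {M N : RepSpace Q d k} {h : ∀ q, GL (Fin (d q)) k} (hh : IsRepIso h M N)
    (hM : IsSemistable θ M) : IsSemistable θ N := by
  refine ⟨hM.1, fun W hW => ?_⟩
  let e : ∀ q, (Fin (d q) → k) ≃ₗ[k] (Fin (d q) → k) := fun q =>
    LinearMap.GeneralLinearGroup.toLinearEquiv (Matrix.GeneralLinearGroup.toLin (h q))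
  have he : ∀ q x, e q x = (h q).val.mulVec x := fun q x => rfl
  let W' : ∀ q, Submodule k (Fin (d q) → k) := fun q => (W q).comap (e q).toLinearMap
  have hW' : IsSubrep M W' := by
    intro a b α x hx
    change e b ((M α).mulVec x) ∈ W b
    rw [he, Matrix.mulVec_mulVec, hh α, ← Matrix.mulVec_mulVec]
    exact hW α _ hx
  have : weightOf θ W' = weightOf θ W := Finset.sum_congr rfl fun q _ => by
    rw [((e q).submoduleMap (W' q)).finrank_eq,
      Submodule.map_comap_eq_of_surjective (e q).surjective]
  exact this ▸ hM.2 W' hW'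

end

/-! ### The polytope of normalised weights -/

section
variable {K : Kind} {n : ℕ} {k : Type u} [Field k]

lemma IsStable.smul {Q : Type} [Fintype Q] [Quiver.{0} Q] {d : Q → ℕ} {θ : Q → ℚ}
    {M : RepSpace Q d k} (h : IsStable θ M) {c : ℚ} (hc : 0 < c) :
    IsStable (fun q => c * θ q) M := by
  have key : ∀ W : ∀ q, Submodule k (Fin (d q) → k),
      weightOf (fun q => c * θ q) W = c * weightOf θ W := fun W => by
    simp only [weightOf, Finset.mul_sum, mul_assoc]
  refine ⟨⟨?_, fun W hW => ?_⟩, fun W hW h0 => h.2 W hW ?_⟩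
  · simp only [mul_assoc, ← Finset.mul_sum, h.1.1, mul_zero]
  · rw [key]
    exact mul_nonpos_of_nonneg_of_nonpos hc.le (h.1.2 W hW)
  · rw [key] at h0
    exact (mul_eq_zero.mp h0).resolve_left hc.ne'

lemma exists_areTransverse (K : Kind) (k : Type u) [Field k] :
    ∃ w w' : Fin 2 → k, AreTransverse K w w' := by
  refine ⟨![0, 1], ![1, 0], ?_⟩
  cases K with
  | Q => exact ⟨fun h => one_ne_zero (congrFun h 1), fun h => one_ne_zero (congrFun h 0)⟩
  | P => exact Or.inl ⟨rfl, one_ne_zero, one_ne_zero, rfl⟩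

/-- The total weight of the sinks of a stable representation is negative, since the sinks with all
their vector spaces form a proper nonzero subrepresentation. -/
lemma IsStable.sum_hub_neg {θ : Vertex K n → ℚ} {v : Fin n → Fin 2 → k}
    (h : IsStable θ (repOf K v)) : ∑ j, θ (.hub j) * (K.hubDim : ℚ) < 0 := by
  obtain ⟨w, w', hw⟩ := exists_areTransverse K k
  obtain ⟨i, -⟩ := h.exists_br_ne_zero hw
  have hs : IsSubrep (repOf K v) (subOf (fun _ => ⊤) ∅) := isSubrep_subOf (by simp)
  have e : weightOf θ (subOf (k := k) (fun _ => ⊤) ∅) = ∑ j, θ (.hub j) * (K.hubDim : ℚ) := by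
    rw [weightOf_subOf, Finset.sum_empty, add_zero]
    refine Finset.sum_congr rfl fun j _ => ?_
    rw [finrank_top, Module.finrank_fin_fun]
  rw [← e]
  refine lt_of_le_of_ne (h.1.2 _ hs) fun h0 => ?_
  rcases h.2 _ hs h0 with h | h
  · obtain ⟨j, hj⟩ := hw.exists_finrank
    have : (⊤ : Submodule k (Fin K.hubDim → k)) = ⊥ := h (.hub j)
    have h2 := Submodule.finrank_le (hubLine K w j)
    rw [← finrank_top k (Fin K.hubDim → k), this, finrank_bot, hj] at h2
    omega
  · have : (⊥ : Submodule k (Fin 1 → k)) = ⊤ := h (.q i)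
    exact bot_ne_top this

/-- A stable representation is stable for a normalised weight. -/
lemma IsStable.exists_normalised {θ : Vertex K n → ℚ} {v : Fin n → Fin 2 → k}
    (h : IsStable θ (repOf K v)) : ∃ θ : WeightSlice K n, IsStable θ.1 (repOf K v) := by
  have hneg := h.sum_hub_neg
  have hsum := h.1.1
  rw [sum_mul_dimVec] at hsum
  suffices ∃ c : ℚ, 0 < c ∧ IsNormalised K (fun q => c * θ q) by
    obtain ⟨c, hc, hn⟩ := this
    exact ⟨⟨_, (h.smul hc).1.1, hn⟩, h.smul hc⟩
  cases K with
  | Q =>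
    have hpos : 0 < ∑ i, θ (.q i) := by linarith
    refine ⟨2 / ∑ i, θ (.q i), by positivity, ?_⟩
    change ∑ i, _ * _ = _
    rw [← Finset.mul_sum]
    field_simp
  | P =>
    have e : ∑ j, θ (.hub j) * ((Kind.P.hubDim : ℕ) : ℚ) = ∑ j : Fin 2, θ (.hub (K := .P) j) :=
      Finset.sum_congr rfl fun j _ => by
        change _ * ((1 : ℕ) : ℚ) = _
        simp
    rw [e] at hneg
    refine ⟨-1 / ∑ j : Fin 2, θ (.hub (K := .P) j), div_pos_of_neg_of_neg (by norm_num) hneg, ?_⟩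
    change ∑ j : Fin 2, _ * _ = _
    rw [← Finset.mul_sum, div_mul_cancel₀ _ hneg.ne]

/-- The normalised weights for which a stable representation is semistable contain a nonempty open
set: stability consists of finitely many strict inequalities, one for each dimension vector of a
proper nonzero subrepresentation. -/
lemma IsStable.interior_nonempty {θ : Vertex K n → ℚ} {v : Fin n → Fin 2 → k}
    (h : IsStable θ (repOf K v)) :
    (interior {θ : WeightSlice K n | IsSemistable θ.1 (repOf K v)}).Nonempty := by
  obtain ⟨θ, h⟩ := h.exists_normalised
  let I := ∀ q : Vertex K n, Fin (dimVec K n q + 1)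
  let P : I → Prop := fun δ => ∃ W, IsSubrep (repOf K v) W ∧ (∀ q, Module.finrank k (W q) = δ q) ∧
    ¬ ((∀ q, W q = ⊥) ∨ ∀ q, W q = ⊤)
  let O : Set (WeightSlice K n) := ⋂ δ : {δ : I // P δ}, {θ | ∑ q, θ.1 q * ((δ.1 q : ℕ) : ℚ) < 0}
  have hO : IsOpen O := isOpen_iInter_of_finite fun δ => isOpen_lt
    (continuous_finsetSum _ fun q _ =>
      ((continuous_apply q).comp continuous_subtype_val).mul continuous_const) continuous_const
  refine ⟨θ, mem_interior.mpr ⟨O, fun η hη => ⟨η.2.1, fun W hW => ?_⟩, hO, ?_⟩⟩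
  · by_cases hb : (∀ q, W q = ⊥) ∨ ∀ q, W q = ⊤
    · rcases hb with hb | hb
      · exact (Finset.sum_eq_zero fun q _ => by
          rw [hb q, finrank_bot, Nat.cast_zero, mul_zero]).le
      · refine (Eq.trans (Finset.sum_congr rfl fun q _ => ?_) η.2.1).le
        rw [hb q, finrank_top, Module.finrank_fin_fun]
    · have hle : ∀ q, Module.finrank k (W q) < dimVec K n q + 1 := fun q => by
        have := Submodule.finrank_le (W q)
        rw [Module.finrank_fin_fun] at this
        omega
      exact (Set.mem_iInter.mp hη ⟨fun q => ⟨_, hle q⟩, W, hW, fun q => rfl, hb⟩).le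
  · refine Set.mem_iInter.mpr fun ⟨δ, W, hW, hδ, hb⟩ => ?_
    have : weightOf θ.1 W < 0 := lt_of_le_of_ne (h.1.2 W hW) fun h0 => hb (h.2 W hW h0)
    simp only [weightOf, hδ] at this
    exact this

/-- A set of normalised weights on which a linear form vanishes that is not constant on the
hyperplane of normalised weights has no interior points. -/
lemma interior_eq_empty_of_linear {S : Set (WeightSlice K n)} (c e : Vertex K n → ℚ)
    (hS : ∀ θ ∈ S, ∑ q, c q * θ.1 q = 0) (he : ∑ q, e q * (dimVec K n q : ℚ) = 0)
    (hn : ∀ θ : WeightSlice K n, ∀ ε : ℚ, IsNormalised K fun q => θ.1 q + ε * e q)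
    (hc : ∑ q, c q * e q ≠ 0) : interior S = ∅ := by
  refine Set.eq_empty_of_forall_notMem fun θ hθ => ?_
  let γ : ℚ → WeightSlice K n := fun ε => ⟨fun q => θ.1 q + ε * e q, by
    simp only [add_mul, Finset.sum_add_distrib, θ.2.1, mul_assoc, ← Finset.mul_sum, he]
    ring, hn θ ε⟩
  have hγ : Continuous γ := Continuous.subtype_mk (continuous_pi fun q =>
    continuous_const.add (continuous_id.mul continuous_const)) _
  have h0 : γ 0 = θ := Subtype.ext (funext fun q => by simp [γ])
  have hmem : γ ⁻¹' interior S ∈ nhds (0 : ℚ) :=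
    (isOpen_interior.preimage hγ).mem_nhds (by rw [Set.mem_preimage, h0]; exact hθ)
  have hmem' : ∀ᶠ ε in nhdsWithin (0 : ℚ) {0}ᶜ, γ ε ∈ interior S := mem_nhdsWithin_of_mem_nhds hmem
  have hne : ∀ᶠ ε in nhdsWithin (0 : ℚ) {0}ᶜ, ε ∈ ({0}ᶜ : Set ℚ) := self_mem_nhdsWithin
  obtain ⟨ε, hε, hne⟩ := (hmem'.and hne).exists
  have h1 := hS _ (interior_subset hε)
  simp only [γ, mul_add, Finset.sum_add_distrib, hS θ (interior_subset hθ), zero_add] at h1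
  rw [Finset.sum_congr rfl fun q _ => mul_left_comm (c q) ε (e q), ← Finset.mul_sum] at h1
  exact (mul_ne_zero hne hc) h1

end

/-! ### Coordinates at field-valued points -/

section
variable {k : Type u} [Field k]

/-- A vector over a field as a vector of functions on the spectrum. -/
def ptCoords (v : Fin 2 → k) : Fin 2 → Γ(Spec (CommRingCat.of k), ⊤) :=
  fun r => (Scheme.ΓSpecIso (CommRingCat.of k)).inv (v r)

lemma ΓSpecIso_inv_injective :
    Function.Injective (Scheme.ΓSpecIso (CommRingCat.of k)).inv :=
  (ConcreteCategory.bijective_of_isIso (Scheme.ΓSpecIso (CommRingCat.of k)).inv).1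

lemma br_ptCoords (v w : Fin 2 → k) :
    br (ptCoords v) (ptCoords w) = (Scheme.ΓSpecIso (CommRingCat.of k)).inv (br v w) := by
  simp only [br, ptCoords, map_sub, map_mul]

lemma exists_ptCoords_eq (a : Fin 2 → Γ(Spec (CommRingCat.of k), ⊤)) :
    ∃ v : Fin 2 → k, ptCoords v = a := by
  choose v hv using fun r =>
    (ConcreteCategory.bijective_of_isIso (Scheme.ΓSpecIso (CommRingCat.of k)).inv).2 (a r)
  exact ⟨v, funext hv⟩

lemma exists_ptCoords (f : Spec (CommRingCat.of k) ⟶ P1.{u}) :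
    ∃ v : Fin 2 → k, HasCoords f (ptCoords v) := by
  let x : Spec (CommRingCat.of k) := IsLocalRing.closedPoint k
  obtain ⟨V, a, hx, ha⟩ := exists_local_coords f x
  have hV : V = ⊤ := TopologicalSpace.Opens.ext (Set.eq_univ_of_forall fun z => by
    rw [Subsingleton.elim z x]; exact hx)
  subst hV
  obtain ⟨v, hv⟩ := exists_ptCoords_eq (pb (Scheme.topIso _).inv a)
  refine ⟨v, ?_⟩
  rw [hv]
  have := ha.comp (Scheme.topIso _).inv
  rwa [← Scheme.topIso_hom, Iso.inv_hom_id_assoc] at this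

lemma HasCoords.ne_zero {f : Spec (CommRingCat.of k) ⟶ P1.{u}} {v : Fin 2 → k}
    (h : HasCoords f (ptCoords v)) : v ≠ 0 := by
  rintro rfl
  obtain ⟨c, hc⟩ := h.exists_combination
  simp only [ptCoords, Pi.zero_apply, map_zero, mul_zero, add_zero] at hc
  exact zero_ne_one hc

lemma HasCoords.eq_iff_br {f g : Spec (CommRingCat.of k) ⟶ P1.{u}} {v w : Fin 2 → k}
    (h : HasCoords f (ptCoords v)) (h' : HasCoords g (ptCoords w)) : f = g ↔ br v w = 0 := by
  rw [h.eq_iff h', ← sub_eq_zero]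
  change br _ _ = 0 ↔ _
  rw [br_ptCoords, map_eq_zero_iff _ ΓSpecIso_inv_injective]

lemma exists_smul_of_hasCoords {f : Spec (CommRingCat.of k) ⟶ P1.{u}} {v w : Fin 2 → k}
    (h : HasCoords f (ptCoords v)) (h' : HasCoords f (ptCoords w)) : ∃ c : kˣ, v = c • w := by
  obtain ⟨c, hc⟩ := exists_smul_eq_of_br_eq_zero h'.ne_zero ((h.eq_iff_br h').mp rfl)
  have : c ≠ 0 := by
    rintro rfl
    exact h.ne_zero (by rw [hc, zero_smul])
  exact ⟨Units.mk0 c this, hc⟩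

variable {Y : Scheme.{u}}

lemma hom_ne_iff_br (s s' : Sec Y) (t : Spec (CommRingCat.of k) ⟶ Y) {v w : Fin 2 → k}
    (hv : HasCoords (t ≫ s.toP1) (ptCoords v)) (hw : HasCoords (t ≫ s'.toP1) (ptCoords w))
    (x : Spec (CommRingCat.of k)) : s.hom (t x) ≠ s'.hom (t x) ↔ br v w ≠ 0 := by
  rw [hom_ne_iff s s' t hv hw, br_ptCoords]
  by_cases h : br v w = 0
  · rw [h, map_zero, Scheme.basicOpen_zero]
    exact ⟨fun h => h.elim, fun h => (h rfl).elim⟩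
  · rw [Scheme.basicOpen_of_isUnit _ ((isUnit_iff_ne_zero.mpr h).map
      (Scheme.ΓSpecIso (CommRingCat.of k)).inv.hom)]
    exact ⟨fun _ => h, fun _ => trivial⟩

lemma exists_geomPoint_eq (y : Y) : ∃ x, geomPoint y x = y := by
  obtain ⟨x⟩ : Nonempty (Spec (CommRingCat.of (AlgebraicClosure (Y.residueField y)))) :=
    inferInstance
  refine ⟨x, ?_⟩
  have : geomPoint y x ∈ Set.range (Y.fromSpecResidueField y) :=
    ⟨Spec.map (CommRingCat.ofHom (algebraMap (Y.residueField y)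
      (AlgebraicClosure (Y.residueField y)))) x, rfl⟩
  rwa [Scheme.range_fromSpecResidueField] at this

end

/-! ### The marked points of a stable family -/

section
variable {Y : Scheme.{u}} {n : ℕ} {s s' : Fin n → Sec Y} {K : Kind}

lemma zero_toP1 (Y : Scheme.{u}) : (Sec.zero Y).toP1 = zeroPt Y := Sec.toP1_ofPoint _

lemma infty_toP1 (Y : Scheme.{u}) : (Sec.infty Y).toP1 = inftyPt Y := Sec.toP1_ofPoint _

lemma hasCoords_comp_zero {k : Type u} [Field k] (t : Spec (CommRingCat.of k) ⟶ Y) :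
    HasCoords (t ≫ (Sec.zero Y).toP1) (ptCoords ![0, 1]) := by
  rw [zero_toP1, comp_zeroPt]
  convert hasCoords_zeroPt _ using 1
  funext r
  fin_cases r <;> simp [ptCoords]

lemma hasCoords_comp_infty {k : Type u} [Field k] (t : Spec (CommRingCat.of k) ⟶ Y) :
    HasCoords (t ≫ (Sec.infty Y).toP1) (ptCoords ![1, 0]) := by
  rw [infty_toP1, comp_inftyPt]
  convert hasCoords_inftyPt _ using 1
  funext r
  fin_cases r <;> simp [ptCoords]

lemma exists_transverse {i j : Mark n K} (hij : Adm i j) (s : Fin n → Sec Y) {k : Type u} [Field k]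
    (t : Spec (CommRingCat.of k) ⟶ Y) : ∃ w w' : Fin 2 → k,
      HasCoords (t ≫ (extend s i).toP1) (ptCoords w) ∧
      HasCoords (t ≫ (extend s j).toP1) (ptCoords w') ∧ AreTransverse K w w' := by
  cases K with
  | Q =>
    obtain ⟨w, hw⟩ := exists_ptCoords (t ≫ (extend s i).toP1)
    obtain ⟨w', hw'⟩ := exists_ptCoords (t ≫ (extend s j).toP1)
    exact ⟨w, w', hw, hw', hw.ne_zero, hw'.ne_zero⟩
  | P =>
    obtain ⟨rfl, rfl⟩ := hij
    exact ⟨![0, 1], ![1, 0], hasCoords_comp_zero t, hasCoords_comp_infty t,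
      Or.inl ⟨rfl, one_ne_zero, one_ne_zero, rfl⟩⟩

/-- Stability provides a third section that is different from two given ones. -/
lemma IsStableFamily.exists_mem_distinctLocus {θ : Vertex K n → ℚ} (hs : IsStableFamily K θ s)
    {i j : Mark n K} (hij : Adm i j) {y : Y} (hy : (extend s i).hom y ≠ (extend s j).hom y) :
    ∃ k, y ∈ distinctLocus (extend s) i j (.pt k) := by
  obtain ⟨v, hv, hst⟩ := hs _ (geomPoint y)
  obtain ⟨x, hx⟩ := exists_geomPoint_eq y
  obtain ⟨w, w', hw, hw', h⟩ := exists_transverse hij s (geomPoint y)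
  obtain ⟨k, h1, h2⟩ := hst.exists_br_ne_zero h
  have h1 := (hom_ne_iff_br (s k) _ (geomPoint y) (hv k) hw x).mpr h1
  have h2 := (hom_ne_iff_br (s k) _ (geomPoint y) (hv k) hw' x).mpr h2
  rw [hx] at h1 h2
  exact ⟨k, hy, h1.symm, h2.symm⟩

lemma zero_ne_infty (y : Y) : (Sec.zero Y).hom y ≠ (Sec.infty Y).hom y := by
  obtain ⟨x, hx⟩ := exists_geomPoint_eq y
  have := (hom_ne_iff_br _ _ (geomPoint y) (hasCoords_comp_zero _) (hasCoords_comp_infty _) x).mpr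
    (by simp [br])
  rwa [hx] at this

lemma IsStableFamily.exists_ne {θ : Vertex .Q n → ℚ} (hs : IsStableFamily .Q θ s) (y : Y) :
    ∃ i j, (s i).hom y ≠ (s j).hom y := by
  obtain ⟨v, hv, hst⟩ := hs _ (geomPoint y)
  obtain ⟨x, hx⟩ := exists_geomPoint_eq y
  obtain ⟨w, w', hw⟩ := exists_areTransverse .Q (AlgebraicClosure (Y.residueField y))
  obtain ⟨i, -⟩ := hst.exists_br_ne_zero hw
  obtain ⟨j, h, -⟩ := hst.exists_br_ne_zero (w := v i) (w' := v i)
    ⟨HasCoords.ne_zero (hv i), HasCoords.ne_zero (hv i)⟩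
  have h := (hom_ne_iff_br _ _ (geomPoint y) (hv j) (hv i) x).mpr h
  rw [hx] at h
  exact ⟨j, i, h⟩

/-- Two maps that are both not constant separate a common pair of points. -/
lemma exists_ne_and_ne {α β β' : Type*} {f : α → β} {f' : α → β'} (h : ∃ i j, f i ≠ f j)
    (h' : ∃ i j, f' i ≠ f' j) : ∃ i j, f i ≠ f j ∧ f' i ≠ f' j := by
  obtain ⟨a, b, hab⟩ := h
  by_cases h0 : f' a = f' b
  · obtain ⟨e, he⟩ : ∃ e, f' a ≠ f' e := by
      by_contra! hc
      obtain ⟨c, d, hcd⟩ := h'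
      exact hcd ((hc c).symm.trans (hc d))
    by_cases h1 : f a = f e
    · exact ⟨b, e, fun h2 => hab (h1.trans h2.symm), h0 ▸ he⟩
    · exact ⟨a, e, h1, he⟩
  · exact ⟨a, b, hab, h0⟩

lemma exists_mem_pairLocus {θ θ' : Vertex K n → ℚ} (hs : IsStableFamily K θ s)
    (hs' : IsStableFamily K θ' s') (y : Y) :
    ∃ i j : Mark n K, Adm i j ∧ y ∈ pairLocus (extend s) (extend s') i j := by
  cases K with
  | Q =>
    obtain ⟨i, j, h, h'⟩ := exists_ne_and_ne (hs.exists_ne y) (hs'.exists_ne y)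
    refine ⟨.pt i, .pt j, ?_, h, h'⟩
    intro e
    cases e
    exact h rfl
  | P => exact ⟨.zero, .infty, ⟨rfl, rfl⟩, zero_ne_infty y, zero_ne_infty y⟩

lemma IsStableFamily.exists_mem_tripleLocus {θ : Vertex K n → ℚ} (hs : IsStableFamily K θ s)
    {i j : Mark n K} (hij : Adm i j) {y : Y} (hy : y ∈ pairLocus (extend s) (extend s') i j) :
    ∃ k, y ∈ tripleLocus (extend s) (extend s') i j (.pt k) := by
  obtain ⟨k, hk⟩ := hs.exists_mem_distinctLocus hij hy.1
  exact ⟨k, Or.inl hk⟩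

/-- Two sections `i, j` that are distinct in both families exist because a stable tuple is not
constant; stability then provides the third section. -/
lemma isCovered {θ θ' : Vertex K n → ℚ} (hs : IsStableFamily K θ s)
    (hs' : IsStableFamily K θ' s') : IsCovered K s s' := fun y => by
  obtain ⟨i, j, hij, hy⟩ := exists_mem_pairLocus hs hs' y
  obtain ⟨k, hk⟩ := hs.exists_mem_tripleLocus hij hy
  exact ⟨i, j, k, hij, hy, hk⟩

end

/-! ### Degenerate and nondegenerate fibres of a correspondence -/

section
variable {Y Z : Scheme.{u}} {G : Correspondence Y} {ζ : Z ⟶ Y}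

/-- The degeneration locus is the zero locus of the parameter of a frame. -/
lemma mem_range_iff_of_frame
    (hζ : ∀ (T : Scheme.{u}) (t : T ⟶ Y), (∃ z, z ≫ ζ = t) ↔ G.Deg t) {T : Scheme.{u}} {t : T ⟶ Y}
    (F : Frame G.rel t) (x : T) : t x ∈ Set.range ζ ↔ x ∉ T.basicOpen F.d := by
  constructor
  · rintro ⟨z, hz⟩ hx
    obtain ⟨w, -, hw⟩ := Scheme.Pullback.exists_preimage_pullback (f := ζ) (g := t) z x hz
    have h0 : G.Deg (pullback.snd ζ t ≫ t) := (hζ _ _).mp ⟨_, pullback.condition⟩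
    rw [Correspondence.deg_iff (F.comp _)] at h0
    have h0 : (pullback.snd ζ t).appTop F.d = 0 := h0
    have h1 : w ∈ (pullback ζ t).basicOpen ((pullback.snd ζ t).appTop F.d) := by
      rw [← Scheme.preimage_basicOpen_top]
      change (pullback.snd ζ t) w ∈ T.basicOpen F.d
      rwa [hw]
    rw [h0, Scheme.basicOpen_zero] at h1
    exact h1
  · intro hx
    obtain ⟨z, hz⟩ := (hζ _ (T.fromSpecResidueField x ≫ t)).mpr
      ((Correspondence.deg_iff (F.comp _)).mpr (fromSpecResidueField_appTop_eq_zero hx))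
    obtain ⟨w⟩ : Nonempty (Spec (T.residueField x)) := inferInstance
    have hw : T.fromSpecResidueField x w = x := by
      have : T.fromSpecResidueField x w ∈ Set.range (T.fromSpecResidueField x) := ⟨w, rfl⟩
      rwa [Scheme.range_fromSpecResidueField] at this
    refine ⟨z w, ?_⟩
    have := congrArg (fun f : Spec (T.residueField x) ⟶ Y => f w) hz
    exact this.trans (congrArg t hw)

lemma exists_frame_of_field {k : Type u} [Field k] (t : Spec (CommRingCat.of k) ⟶ Y) :
    Nonempty (Frame G.rel t) := by
  let x : Spec (CommRingCat.of k) := IsLocalRing.closedPoint k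
  obtain ⟨V, hx, ⟨F⟩⟩ := G.exists_frame t x
  have hV : V = ⊤ := TopologicalSpace.Opens.ext (Set.eq_univ_of_forall fun z => by
    rw [Subsingleton.elim z x]; exact hx)
  subst hV
  have F := F.comp (Scheme.topIso _).inv
  rw [← Scheme.topIso_hom, Iso.inv_hom_id_assoc] at F
  exact ⟨F⟩

/-- Over a field-valued point of the degeneration scheme, the correspondence consists of two
crossing lines. -/
lemma exists_crossing (hζ : ∀ (T : Scheme.{u}) (t : T ⟶ Y), (∃ z, z ≫ ζ = t) ↔ G.Deg t)
    {k : Type u} [Field k] (t : Spec (CommRingCat.of k) ⟶ Y) {x : Spec (CommRingCat.of k)}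
    (hx : t x ∈ Set.range ζ) : ∃ κ κ' : Spec (CommRingCat.of k) ⟶ P1.{u},
      ∀ f f', G.rel t f f' → f = κ ∨ f' = κ' := by
  obtain ⟨F⟩ := exists_frame_of_field (G := G) t
  have hd : F.d = 0 := by
    rw [mem_range_iff_of_frame hζ F] at hx
    refine eq_zero_of_not_isUnit (k := k) fun hu => hx ?_
    rw [Scheme.basicOpen_of_isUnit _ hu]
    trivial
  refine ⟨(actEquiv F.M).symm (zeroPt _), (actEquiv F.M').symm (zeroPt _), fun f f' h => ?_⟩
  rw [Equiv.eq_symm_apply, Equiv.eq_symm_apply]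
  change act F.M f = _ ∨ act F.M' f' = _
  obtain ⟨v, hv⟩ := exists_ptCoords (act F.M f)
  obtain ⟨v', hv'⟩ := exists_ptCoords (act F.M' f')
  rw [F.rel_iff, hd, hv.conic_iff hv', zero_mul] at h
  rw [hv.eq_zeroPt_iff, hv'.eq_zeroPt_iff]
  simp only [ptCoords, ← map_mul] at h ⊢
  rw [map_eq_zero_iff _ ΓSpecIso_inv_injective] at h
  exact (mul_eq_zero.mp h).imp (fun h => by rw [h, map_zero]) fun h => by rw [h, map_zero]

/-- The invertible matrix `(0, d; 1, 0)`. -/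
def antidiagGL {R : Type*} [CommRing R] (d : R) (h : IsUnit d) : GL (Fin 2) R :=
  Matrix.GeneralLinearGroup.mk'' !![0, d; 1, 0] (by
    rw [Matrix.det_fin_two_of]
    simpa using h)

lemma antidiagGL_val {R : Type*} [CommRing R] (d : R) (h : IsUnit d) :
    (antidiagGL d h).val = !![0, d; 1, 0] := rfl

lemma pbGL_antidiagGL {T T' : Scheme.{u}} (g : T' ⟶ T) {d : Γ(T, ⊤)} (h : IsUnit d) :
    pbGL g (antidiagGL d h) = antidiagGL (g.appTop d) (h.map g.appTop.hom) := by
  ext a b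
  fin_cases a <;> fin_cases b <;> simp [antidiagGL_val]

/-- A conic with invertible parameter is the graph of an automorphism. -/
lemma conic_iff_of_isUnit {T : Scheme.{u}} {d : Γ(T, ⊤)} (hd : IsUnit d) {f f' : T ⟶ P1.{u}} :
    Conic d f f' ↔ f' = act (antidiagGL d hd) f := by
  have hval : ∀ {T : Scheme.{u}} (d : Γ(T, ⊤)) (hd : IsUnit d) (x : Fin 2 → Γ(T, ⊤)),
      (antidiagGL d hd).val.mulVec x = ![d * x 1, x 0] := fun d hd x => by
    funext r
    fin_cases r <;> simp [antidiagGL_val, Matrix.mulVec, dotProduct]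
  constructor
  · intro h
    refine hom_ext_of_local fun x => ?_
    obtain ⟨V, a, a', hx, ha, ha'⟩ := exists_local_coords₂ f f' x
    refine ⟨V, hx, ?_⟩
    rw [comp_act, pbGL_antidiagGL]
    have h2 := ha.act (antidiagGL (V.ι.appTop d) (hd.map V.ι.appTop.hom))
    rw [hval] at h2
    rw [ha'.eq_iff h2]
    have := h V V.ι a a' ha ha'
    simp only [Matrix.cons_val_zero, Matrix.cons_val_one]
    linear_combination this
  · rintro rfl T' g x x' hx hx'
    have h2 := hx.act (antidiagGL (g.appTop d) (hd.map g.appTop.hom))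
    rw [hval] at h2
    rw [comp_act, pbGL_antidiagGL] at hx'
    have := (hx'.eq_iff h2).mp rfl
    simp only [Matrix.cons_val_zero, Matrix.cons_val_one] at this
    linear_combination this

/-- Where the parameter of a frame is invertible, the correspondence is the graph of a projective
transformation. -/
lemma Frame.exists_rel_iff {T : Scheme.{u}} {t : T ⟶ Y} (F : Frame G.rel t) (hd : IsUnit F.d) :
    ∃ A : GL (Fin 2) Γ(T, ⊤), ∀ (T' : Scheme.{u}) (g : T' ⟶ T) (f f' : T' ⟶ P1.{u}),
      G.rel (g ≫ t) f f' ↔ f' = act (pbGL g A) f := by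
  refine ⟨F.M'⁻¹ * (antidiagGL F.d hd * F.M), fun T' g f f' => ?_⟩
  rw [F.spec, conic_iff_of_isUnit (hd.map g.appTop.hom)]
  rw [pbGL_mul, pbGL_mul, pbGL_antidiagGL, ← act_act, ← act_act, pbGL_inv]
  exact ((actEquiv (pbGL g F.M')).eq_symm_apply).symm

end

/-! ### Isomorphisms of representations from projective transformations -/

section
variable {K : Kind} {n : ℕ} {R : Type u} [CommRing R]

/-- An invertible matrix, for `P_n` a diagonal one, defines isomorphisms of representations that
are the identity at the sources. -/
lemma exists_repIso (K : Kind) (n : ℕ) (A : GL (Fin 2) R)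
    (hA : K = .P → A.val 0 1 = 0 ∧ A.val 1 0 = 0) :
    ∃ h : ∀ q : Vertex K n, GL (Fin (dimVec K n q)) R, hubMatrix K h = A.val ∧
      ∀ a : Fin n → Fin 2 → R, IsRepIso h (repOf K a) (repOf K fun k => A.val.mulVec (a k)) := by
  cases K with
  | Q =>
    let h : ∀ q : Vertex .Q n, GL (Fin (dimVec .Q n q)) R
      | .inl _ => A
      | .inr _ => (1 : GL (Fin 1) R)
    refine ⟨h, rfl, ?_⟩
    rintro a _ _ ⟨i, j⟩
    change A.val * (Matrix.of fun (r : Fin 2) (_ : Fin 1) => a i r) =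
      (Matrix.of fun (r : Fin 2) (_ : Fin 1) => A.val.mulVec (a i) r) *
        (1 : Matrix (Fin 1) (Fin 1) R)
    exact Eq.trans (by rfl) (Matrix.mul_one _).symm
  | P =>
    obtain ⟨h01, h10⟩ := hA rfl
    have hdet := Matrix.isUnits_det_units A
    rw [Matrix.det_fin_two, h01, zero_mul, sub_zero] at hdet
    have hu : ∀ j : Fin 2, IsUnit (A.val j j) :=
      Fin.forall_fin_two.mpr ⟨isUnit_of_mul_isUnit_left hdet, isUnit_of_mul_isUnit_right hdet⟩
    let g : Fin 2 → GL (Fin 1) R := fun j =>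
      Matrix.GeneralLinearGroup.mk'' (Matrix.of fun _ _ => A.val j j) (by
        rw [Matrix.det_fin_one]
        exact hu j)
    let h : ∀ q : Vertex .P n, GL (Fin (dimVec .P n q)) R
      | .inl j => g j
      | .inr _ => (1 : GL (Fin 1) R)
    refine ⟨h, ?_, ?_⟩
    · change (Matrix.diagonal fun j : Fin 2 => A.val j j) = A.val
      ext a b
      fin_cases a <;> fin_cases b <;> simp [h01, h10]
    · rintro a _ _ ⟨i, j⟩
      change (Matrix.of fun (_ _ : Fin 1) => A.val j j) *
          (Matrix.of fun (_ : Fin 1) (_ : Fin 1) => a i j) =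
        (Matrix.of fun (_ : Fin 1) (_ : Fin 1) => A.val.mulVec (a i) j) *
          (1 : Matrix (Fin 1) (Fin 1) R)
      rw [mul_one]
      ext r c
      rw [Matrix.mul_apply, Fin.sum_univ_one]
      revert j
      refine Fin.forall_fin_two.mpr ⟨?_, ?_⟩ <;>
        simp [Matrix.mulVec, dotProduct, h01, h10]

lemma IsRepIso.map {S : Type u} [CommRing S] (φ : R →+* S)
    {h : ∀ q : Vertex K n, GL (Fin (dimVec K n q)) R} {a a' : Fin n → Fin 2 → R}
    (hh : IsRepIso h (repOf K a) (repOf K a')) :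
    IsRepIso (fun q => Matrix.GeneralLinearGroup.map φ (h q)) (repOf K fun i r => φ (a i r))
      (repOf K fun i r => φ (a' i r)) := by
  rintro _ _ ⟨i, j⟩
  have := congrArg (fun M => M.map φ) (hh (Arrow.mk i j))
  simp only [Matrix.map_mul] at this
  exact this

lemma IsRepIso.smul {h : ∀ q : Vertex K n, GL (Fin (dimVec K n q)) R} {a a' : Fin n → Fin 2 → R}
    (hh : IsRepIso h (repOf K a) (repOf K a')) (c : Fin n → R) :
    IsRepIso h (repOf K fun i => c i • a i) (repOf K fun i => c i • a' i) := by
  rintro _ _ ⟨i, j⟩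
  have := congrArg (fun M => c i • M) (hh (Arrow.mk i j))
  rw [← Matrix.mul_smul, ← Matrix.smul_mul] at this
  exact this

end

/-! ### The overlap of the polytopes -/

section
variable {Y : Scheme.{u}} {n : ℕ} {s s' : Fin n → Sec Y} {K : Kind}

lemma ptCoords_comp {k : Type u} [Field k] {T : Scheme.{u}} (t : Spec (CommRingCat.of k) ⟶ T)
    (a : Fin 2 → Γ(T, ⊤)) :
    ptCoords (fun r => (Scheme.ΓSpecIso (CommRingCat.of k)).hom (t.appTop (a r))) = pb t a := by
  funext r
  simp [ptCoords]

lemma HasCoords.unit_smul {k : Type u} [Field k] {f : Spec (CommRingCat.of k) ⟶ P1.{u}}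
    {v : Fin 2 → k} (h : HasCoords f (ptCoords v)) (c : kˣ) : HasCoords f (ptCoords (c • v)) := by
  have := HasCoords.smul h (Units.map (Scheme.ΓSpecIso (CommRingCat.of k)).inv.hom.toMonoidHom c)
  convert this using 1
  funext r
  exact map_mul (Scheme.ΓSpecIso (CommRingCat.of k)).inv.hom (c : k) (v r)

/-- Where the two families are isomorphic, the two polytopes overlap. -/
lemma mem_overlapLocus_of_repIso {θ : Vertex K n → ℚ} (hs : IsStableFamily K θ s) {y : Y}
    {V : Y.Opens} (hy : y ∈ V) {a a' : Fin n → Fin 2 → Γ(V, ⊤)}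
    {h : ∀ q : Vertex K n, GL (Fin (dimVec K n q)) Γ(V, ⊤)}
    (ha : ∀ k, HasCoords (V.ι ≫ (s k).toP1) (a k)) (ha' : ∀ k, HasCoords (V.ι ≫ (s' k).toP1) (a' k))
    (hh : IsRepIso h (repOf K a) (repOf K a')) : y ∈ overlapLocus K s s' := by
  obtain ⟨v, hv, hst⟩ := hs _ (geomPoint y)
  obtain ⟨x, hx⟩ := exists_geomPoint_eq y
  obtain ⟨t, ht⟩ : ∃ t, t ≫ V.ι = geomPoint y := ⟨_, IsOpenImmersion.lift_fac V.ι _ (by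
    rintro _ ⟨z, rfl⟩
    rw [Subsingleton.elim z x, hx]
    simpa using hy)⟩
  let φ := (Scheme.ΓSpecIso (CommRingCat.of (AlgebraicClosure (Y.residueField y)))).hom.hom.comp
    t.appTop.hom
  have hφ : ∀ i, HasCoords (geomPoint y ≫ (s i).toP1) (ptCoords fun r => φ (a i r)) := fun i => by
    have := (ha i).comp t
    rw [← Category.assoc, ht, ← ptCoords_comp] at this
    exact this
  have hφ' : ∀ i, HasCoords (geomPoint y ≫ (s' i).toP1) (ptCoords fun r => φ (a' i r)) := fun i => by
    have := (ha' i).comp t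
    rw [← Category.assoc, ht, ← ptCoords_comp] at this
    exact this
  choose c hc using fun i => exists_smul_of_hasCoords (hv i) (hφ i)
  have iso := (hh.map φ).smul fun i => (c i : AlgebraicClosure (Y.residueField y))
  have ev : (fun i => (c i : AlgebraicClosure (Y.residueField y)) • fun r => φ (a i r)) = v :=
    funext fun i => (hc i).symm
  rw [ev] at iso
  refine hst.interior_nonempty.mono (interior_mono fun η hη => ⟨⟨v, hv, hη⟩, _, fun i => ?_,
    iso.isSemistable hη⟩)
  exact (hφ' i).unit_smul (c i)

/-- If all marked points lie on two crossing lines, then a hyperplane separates the two polytopes.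
They can meet only in this hyperplane, so their intersection has no interior points. -/
lemma interior_polytope_inter_eq_empty {k : Type u} [Field k] (t : Spec (CommRingCat.of k) ⟶ Y)
    {κ κ' : Spec (CommRingCat.of k) ⟶ P1.{u}}
    (h : ∀ m : Mark n K, t ≫ (extend s m).toP1 = κ ∨ t ≫ (extend s' m).toP1 = κ') :
    interior (polytope K s t ∩ polytope K s' t) = ∅ := by
  classical
  obtain ⟨w, hw⟩ := exists_ptCoords κ
  obtain ⟨w', hw'⟩ := exists_ptCoords κ'
  have htr : AreTransverse K w w' := by
    cases K with
    | Q => exact ⟨hw.ne_zero, hw'.ne_zero⟩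
    | P =>
      have e0 := hasCoords_comp_zero t
      have e1 := hasCoords_comp_infty t
      have key : ∀ {κ : Spec (CommRingCat.of k) ⟶ P1.{u}} {w : Fin 2 → k},
          HasCoords κ (ptCoords w) → (t ≫ (Sec.zero Y).toP1 = κ → w 0 = 0 ∧ w 1 ≠ 0) ∧
            (t ≫ (Sec.infty Y).toP1 = κ → w 0 ≠ 0 ∧ w 1 = 0) := by
        intro κ w hw
        rw [e0.eq_iff_br hw, e1.eq_iff_br hw]
        simp only [br, Matrix.cons_val_zero, Matrix.cons_val_one, zero_mul, one_mul, zero_sub,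
          neg_eq_zero, sub_zero]
        exact ⟨fun h0 => ⟨h0, fun h1 => hw.ne_zero (funext (Fin.forall_fin_two.mpr ⟨h0, h1⟩))⟩,
          fun h1 => ⟨fun h0 => hw.ne_zero (funext (Fin.forall_fin_two.mpr ⟨h0, h1⟩)), h1⟩⟩
      rcases h .zero with h0 | h0 <;> rcases h .infty with h1 | h1
      · exact absurd ((key hw).1 h0).1 ((key hw).2 h1).1
      · exact Or.inl ⟨((key hw).1 h0).1, ((key hw).1 h0).2, ((key hw').2 h1).1, ((key hw').2 h1).2⟩
      · exact Or.inr ⟨((key hw).2 h1).1, ((key hw).2 h1).2, ((key hw').1 h0).1, ((key hw').1 h0).2⟩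
      · exact absurd ((key hw').1 h0).1 ((key hw').2 h1).1
  let I : Finset (Fin n) := Finset.univ.filter fun i => t ≫ (s i).toP1 = κ
  -- the sections `s_i` in `κ` give a subrepresentation of `s`, the remaining sections of `s'` lie
  -- in the point `κ'` and give one of `s'`; their weights add up to zero
  have hS : ∀ θ ∈ polytope K s t ∩ polytope K s' t, weightOf θ.1 (subOf (hubLine K w) I) = 0 := by
    rintro θ ⟨⟨v, hv, hvs⟩, v', hv', hvs'⟩
    have h1 := hvs.2 _ (isSubrep_subOf (H := hubLine K w) (I := I) fun i hi => by
      obtain ⟨c, hc⟩ := exists_smul_eq_of_br_eq_zero hw.ne_zero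
        ((HasCoords.eq_iff_br (hv i) hw).mp (Finset.mem_filter.mp hi).2)
      rw [hc]
      exact memHubs_hubLine_smul c w)
    have h2 := hvs'.2 _ (isSubrep_subOf (H := hubLine K w') (I := Iᶜ) fun i hi => by
      have hi : t ≫ (s' i).toP1 = κ' := (h (.pt i)).resolve_left fun h => by
        rw [Finset.mem_compl] at hi
        exact hi (Finset.mem_filter.mpr ⟨Finset.mem_univ i, h⟩)
      obtain ⟨c, hc⟩ := exists_smul_eq_of_br_eq_zero hw'.ne_zero
        ((HasCoords.eq_iff_br (hv' i) hw').mp hi)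
      rw [hc]
      exact memHubs_hubLine_smul c w')
    have h3 := weight_add_weight θ.2.1 htr.finrank_add I
    linarith
  rcases (polytope K s t ∩ polytope K s' t).eq_empty_or_nonempty with hemp | ⟨θ, hθ⟩
  · rw [hemp, interior_empty]
  let c : Vertex K n → ℚ := Sum.elim (fun j => (Module.finrank k (hubLine K w j) : ℚ))
    fun i => if i ∈ I then 1 else 0
  have hc : ∀ θ : WeightSlice K n, ∑ q, c q * θ.1 q = weightOf θ.1 (subOf (hubLine K w) I) := by
    intro θ
    rw [weightOf_subOf, sum_vertex]
    congr 1
    · exact Finset.sum_congr rfl fun j _ => mul_comm _ _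
    · change ∑ i, (if i ∈ I then (1 : ℚ) else 0) * _ = _
      simp
  have hc0 : ∀ θ ∈ polytope K s t ∩ polytope K s' t, ∑ q, c q * θ.1 q = 0 := fun θ hθ => by
    rw [hc, hS θ hθ]
  cases K with
  | Q =>
    -- the sources on both sides of the hyperplane have total weight one
    have h1 := hS θ hθ
    have h2 := θ.2.1
    have h3 : ∑ i, θ.1 (.q i) = 2 := θ.2.2
    rw [sum_mul_dimVec] at h2
    rw [weightOf_subOf] at h1
    have e1 : ∑ j : Fin Kind.Q.hubs, θ.1 (.hub j) * (Module.finrank k (hubLine .Q w j) : ℚ) =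
        ∑ j : Fin Kind.Q.hubs, θ.1 (.hub j) := Finset.sum_congr rfl fun j _ => by
      rw [finrank_hubLine_Q hw.ne_zero, Nat.cast_one, mul_one]
    have e2 : ∑ j : Fin Kind.Q.hubs, θ.1 (.hub j) * ((Kind.Q.hubDim : ℕ) : ℚ) =
        2 * ∑ j : Fin Kind.Q.hubs, θ.1 (.hub j) := by
      rw [Finset.mul_sum]
      exact Finset.sum_congr rfl fun j _ => mul_comm _ _
    have hI : ∑ i ∈ I, θ.1 (.q i) = 1 := by linarith
    obtain ⟨i, hi⟩ : I.Nonempty := by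
      rw [Finset.nonempty_iff_ne_empty]
      rintro h0
      rw [h0, Finset.sum_empty] at hI
      exact zero_ne_one hI
    obtain ⟨j, hj⟩ : ∃ j, j ∉ I := by
      by_contra! h0
      rw [Finset.eq_univ_of_forall h0, h3] at hI
      norm_num at hI
    have he : ∑ i' : Fin n, ((Pi.single i 1 - Pi.single j 1 : Fin n → ℚ) i') = 0 := by simp
    -- moving weight from a source outside of `I` to a source in `I` changes the linear form
    let e : Vertex .Q n → ℚ := Sum.elim (fun _ => 0) (Pi.single i 1 - Pi.single j 1)
    refine interior_eq_empty_of_linear c e hc0 ?_ ?_ ?_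
    · rw [sum_mul_dimVec]
      change ∑ _, (0 : ℚ) * _ + ∑ i' : Fin n, (Pi.single i 1 - Pi.single j 1 : Fin n → ℚ) i' = 0
      rw [he]
      simp
    · intro θ ε
      change ∑ i' : Fin n, (θ.1 (.q i') + ε * (Pi.single i 1 - Pi.single j 1 : Fin n → ℚ) i') = 2
      rw [Finset.sum_add_distrib, ← Finset.mul_sum, he, mul_zero, add_zero]
      exact θ.2.2
    · rw [sum_vertex]
      change ∑ _, _ * (0 : ℚ) + ∑ i' : Fin n, (if i' ∈ I then (1 : ℚ) else 0) *
        (Pi.single i 1 - Pi.single j 1 : Fin n → ℚ) i' ≠ 0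
      simp [mul_sub, Pi.single_apply, hi, hj]
  | P =>
    -- the subspace spanned by `w` lives at one of the two sinks only, so moving weight from one
    -- sink to the other changes the linear form
    let e : Fin 2 → ℚ := ![1, -1]
    let e' : Vertex .P n → ℚ := Sum.elim e fun _ => 0
    refine interior_eq_empty_of_linear c e' hc0 ?_ ?_ ?_
    · rw [sum_mul_dimVec]
      change ∑ j : Fin 2, e j * ((1 : ℕ) : ℚ) + ∑ _ : Fin n, (0 : ℚ) = 0
      simp [e]
    · intro θ ε
      have := θ.2.2
      change ∑ j : Fin 2, θ.1 (.hub (K := .P) j) = -1 at this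
      change ∑ j : Fin 2, (θ.1 (.hub (K := .P) j) + ε * e j) = -1
      rw [Finset.sum_add_distrib, this, ← Finset.mul_sum]
      simp [e]
    · rw [sum_vertex]
      change ∑ j : Fin 2, (Module.finrank k (hubLine .P w j) : ℚ) * e j + ∑ _, _ * (0 : ℚ) ≠ 0
      rw [Fin.sum_univ_two]
      rcases htr with ⟨h0, h1, -⟩ | ⟨h0, h1, -⟩
      · rw [finrank_hubLine_P_of_eq h0, finrank_hubLine_P_of_ne h1]
        simp [e]
      · rw [finrank_hubLine_P_of_ne h0, finrank_hubLine_P_of_eq h1]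
        simp [e]

end

/-! ### The complement of the degeneration scheme -/

section
variable {Y Z : Scheme.{u}} {n : ℕ} {s s' : Fin n → Sec Y} {K : Kind}

/-- Outside of the degeneration scheme, a correspondence is locally the graph of a projective
transformation. -/
lemma Correspondence.exists_act {G : Correspondence Y} {ζ : Z ⟶ Y}
    (hζ : ∀ (T : Scheme.{u}) (t : T ⟶ Y), (∃ z, z ≫ ζ = t) ↔ G.Deg t) {y : Y}
    (hy : y ∉ Set.range ζ) :
    ∃ (V : Y.Opens) (A : GL (Fin 2) Γ(V, ⊤)), y ∈ V ∧ (∀ z : V, V.ι z ∉ Set.range ζ) ∧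
      ∀ (T : Scheme.{u}) (t : T ⟶ V) (f f' : T ⟶ P1.{u}),
        G.rel (t ≫ V.ι) f f' ↔ f' = act (pbGL t A) f := by
  obtain ⟨V, hV, ⟨F⟩⟩ := G.frame y
  have hyd : (⟨y, hV⟩ : V) ∈ Scheme.basicOpen V F.d := by
    by_contra h
    exact hy ((mem_range_iff_of_frame hζ F ⟨y, hV⟩).mpr h)
  let W : Scheme.Opens V := Scheme.basicOpen V F.d
  obtain ⟨O, hO, e, he⟩ := exists_opens_of_isOpenImmersion (W.ι ≫ V.ι) ⟨⟨y, hV⟩, hyd⟩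
  obtain ⟨F, hF⟩ : ∃ F : Frame G.rel O.ι, IsUnit F.d := by
    rw [← he]
    exact ⟨(F.comp W.ι).comp e, (isUnit_ι_basicOpen F.d).map e.appTop.hom⟩
  obtain ⟨A, hA⟩ := F.exists_rel_iff hF
  refine ⟨O, A, hO, fun z hz => ?_, hA⟩
  refine (mem_range_iff_of_frame hζ F z).mp hz ?_
  rw [Scheme.basicOpen_of_isUnit _ hF]
  trivial

variable {hrel : AreRelated K s s'} {hcov : IsCovered K s s'} {ζ : Z ⟶ Y}

/-- Outside of the degeneration scheme, the two families of representations are locally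
isomorphic. -/
lemma exists_repIso_of_notMem
    (hζ : ∀ (T : Scheme.{u}) (t : T ⟶ Y), (∃ z, z ≫ ζ = t) ↔ (correspondence hrel hcov).Deg t)
    {y : Y} (hy : y ∉ Set.range ζ) :
    ∃ (V : Y.Opens) (a a' : Fin n → Fin 2 → Γ(V, ⊤))
      (h : ∀ q : Vertex K n, GL (Fin (dimVec K n q)) Γ(V, ⊤)), y ∈ V ∧
      (∀ z : V, V.ι z ∉ Set.range ζ) ∧
      (∀ k, HasCoords (V.ι ≫ (s k).toP1) (a k)) ∧ (∀ k, HasCoords (V.ι ≫ (s' k).toP1) (a' k)) ∧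
      IsRepIso h (repOf K a) (repOf K a') ∧
      ∀ (T : Scheme.{u}) (t : T ⟶ V) (f : T ⟶ P1.{u}) (x : Fin 2 → Γ(T, ⊤)), HasCoords f x →
        ∃ f', crossRel s s' K (t ≫ V.ι) f f' ∧
          HasCoords f' (((hubMatrix K h).map t.appTop).mulVec x) := by
  obtain ⟨V, A, hyV, hV, hA⟩ := Correspondence.exists_act hζ hy
  obtain ⟨W, a, hyW, ha⟩ := exists_coords_family (fun k => (s k).toP1) y
  let O : Y.Opens := V ⊓ W
  let j : (O : Scheme.{u}) ⟶ V := Y.homOfLE inf_le_left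
  let j' : (O : Scheme.{u}) ⟶ W := Y.homOfLE inf_le_right
  have hj : j ≫ V.ι = O.ι := Scheme.homOfLE_ι _ _
  have hj' : j' ≫ W.ι = O.ι := Scheme.homOfLE_ι _ _
  let B := pbGL j A
  have hB : ∀ (T : Scheme.{u}) (t : T ⟶ O) (f f' : T ⟶ P1.{u}),
      crossRel s s' K (t ≫ O.ι) f f' ↔ f' = act (pbGL t B) f := fun T t f f' => by
    rw [← pbGL_comp, ← hj, ← Category.assoc]
    exact hA T (t ≫ j) f f'
  have hmark : ∀ m : Mark n K, O.ι ≫ (extend s' m).toP1 = act B (O.ι ≫ (extend s m).toP1) :=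
    fun m => by
    have := (crossRel_mark hrel hcov m).comp O.ι
    rw [Category.comp_id, ← Category.id_comp O.ι, Category.assoc, Category.assoc, hB, pbGL_id] at this
    simpa using this
  have ha : ∀ k, HasCoords (O.ι ≫ (s k).toP1) (pb j' (a k)) := fun k => by
    have := (ha k).comp j'
    rwa [← Category.assoc, hj'] at this
  have hdiag : K = .P → B.val 0 1 = 0 ∧ B.val 1 0 = 0 := by
    rintro rfl
    have h0 := hmark .zero
    have h1 := hmark .infty
    change O.ι ≫ (Sec.zero Y).toP1 = act B (O.ι ≫ (Sec.zero Y).toP1) at h0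
    change O.ι ≫ (Sec.infty Y).toP1 = act B (O.ι ≫ (Sec.infty Y).toP1) at h1
    rw [zero_toP1, comp_zeroPt] at h0
    rw [infty_toP1, comp_inftyPt] at h1
    have h0 := ((hasCoords_zeroPt _).act B).eq_zeroPt_iff.mp h0.symm
    have h1 := ((hasCoords_inftyPt _).act B).eq_inftyPt_iff.mp h1.symm
    simp only [Matrix.mulVec, dotProduct, Fin.sum_univ_two, Matrix.cons_val_zero,
      Matrix.cons_val_one, mul_zero, mul_one, zero_add, add_zero] at h0 h1
    exact ⟨h0, h1⟩
  obtain ⟨h, hh, iso⟩ := exists_repIso K n B hdiag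
  refine ⟨O, _, _, h, ⟨hyV, hyW⟩, fun z => ?_, ha, fun k => ?_, iso _, fun T t f x hx => ?_⟩
  · have := hV (j z)
    rwa [show V.ι (j z) = O.ι z from congrArg (fun f : (O : Scheme.{u}) ⟶ Y => f z) hj] at this
  · have := (ha k).act B
    have e := hmark (.pt k)
    change O.ι ≫ (s' k).toP1 = act B (O.ι ≫ (s k).toP1) at e
    rwa [← e] at this
  · refine ⟨act (pbGL t B) f, (hB T t f _).mpr rfl, ?_⟩
    rw [hh]
    exact hx.act (pbGL t B)

/-- The complement of the degeneration scheme is the set of points where the polytopes overlap. -/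
lemma mem_overlapLocus_iff {θ : Vertex K n → ℚ} (hs : IsStableFamily K θ s)
    (hζ : ∀ (T : Scheme.{u}) (t : T ⟶ Y), (∃ z, z ≫ ζ = t) ↔ (correspondence hrel hcov).Deg t)
    (y : Y) : y ∈ overlapLocus K s s' ↔ y ∉ Set.range ζ := by
  constructor
  · rintro hy hz
    obtain ⟨x, hx⟩ := exists_geomPoint_eq y
    obtain ⟨κ, κ', hκ⟩ := exists_crossing hζ (geomPoint y) (x := x) (by rwa [hx])
    have := interior_polytope_inter_eq_empty (K := K) (s := s) (s' := s') (geomPoint y) fun m =>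
      hκ _ _ (by
        have := (crossRel_mark hrel hcov m).comp (geomPoint y)
        rwa [Category.comp_id] at this)
    exact Set.not_nonempty_iff_eq_empty.mpr this hy
  · intro hy
    obtain ⟨V, a, a', h, hyV, -, ha, ha', iso, -⟩ := exists_repIso_of_notMem hζ hy
    exact mem_overlapLocus_of_repIso hs hyV ha ha' iso

/-- The isomorphism `Φ` is determined by the correspondence, and so is the projective transformation
given by the local isomorphisms of representations. -/
lemma inducesRepIso
    (hζ : ∀ (T : Scheme.{u}) (t : T ⟶ Y), (∃ z, z ≫ ζ = t) ↔ (correspondence hrel hcov).Deg t)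
    {U : Y.Opens} (hU : Set.range ζ = (U : Set Y)ᶜ) {Φ : PLine (U : Scheme.{u}) ⟶ PLine U}
    (hΦ : ∀ (T : Scheme.{u}) (t : T ⟶ U) (f f' : T ⟶ P1.{u}),
      crossRel s s' K (t ≫ U.ι) f f' ↔ PLine.lift t f ≫ Φ = PLine.lift t f') :
    InducesRepIso K s s' U Φ := by
  intro y hy
  obtain ⟨V, a, a', h, hyV, hV, ha, ha', iso, hx⟩ := exists_repIso_of_notMem hζ (y := y) (by
    rw [hU]
    exact fun h => h hy)
  have hVU : V ≤ U := fun z hz => by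
    have := hV ⟨z, hz⟩
    rw [hU] at this
    exact not_not.mp this
  refine ⟨V, hVU, a, a', h, hyV, ha, ha', iso, fun T t f x hf => ?_⟩
  obtain ⟨f', hr, hf'⟩ := hx T t f x hf
  rw [← Scheme.homOfLE_ι Y hVU, ← Category.assoc, hΦ] at hr
  rw [← Category.assoc, hr, PLine.lift_toP1]
  exact hf'

/-- The pairs of sections lie on the correspondence, which is the graph of `Φ` over `U`. -/
lemma baseChange_hom_comp (hrel : AreRelated K s s') (hcov : IsCovered K s s') {U : Y.Opens}
    {Φ : PLine (U : Scheme.{u}) ⟶ PLine U}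
    (hΦ : ∀ (T : Scheme.{u}) (t : T ⟶ U) (f f' : T ⟶ P1.{u}),
      crossRel s s' K (t ≫ U.ι) f f' ↔ PLine.lift t f ≫ Φ = PLine.lift t f') (m : Mark n K) :
    ((extend s m).baseChange U.ι).hom ≫ Φ = ((extend s' m).baseChange U.ι).hom := by
  refine (hΦ _ (𝟙 _) _ _).mp ?_
  have := (crossRel_mark hrel hcov m).comp U.ι
  rwa [Category.comp_id, ← Category.id_comp U.ι, Category.assoc, Category.assoc] at this

/-- The equations of the curve in adapted coordinates. -/
lemma crossRel_iff_forall_curveEq {θ : Vertex K n → ℚ} (hs : IsStableFamily K θ s)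
    (hrel : AreRelated K s s') {i j : Mark n K} (hij : Adm i j) {T : Scheme.{u}} {t : T ⟶ Y}
    (c : AdaptedCoords s t i j) (c' : AdaptedCoords s' t i j) {f f' : T ⟶ P1.{u}}
    {x x' : Fin 2 → Γ(T, ⊤)} (hx : c.Represents f x) (hx' : c'.Represents f' x') :
    crossRel s s' K t f f' ↔ ∀ k, CurveEq c c' k x x' := by
  refine ⟨fun h k => (crossPt_quad_iff c c' k hx hx').mp (h i j hij k), fun h =>
    crossRel_of_mem_tripleLocus hrel hij c c' fun z => ?_⟩
  obtain ⟨k, hk⟩ := hs.exists_mem_tripleLocus (s' := s') hij ⟨c.ne z, c'.ne z⟩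
  exact ⟨k, hk, (crossPt_quad_iff c c' k hx hx').mpr (h k)⟩

/-- Where three of the sections are distinct, a single equation suffices, because it implies all
others. -/
lemma crossRel_iff_curveEq (hrel : AreRelated K s s') {i j : Mark n K} (hij : Adm i j) {k : Fin n}
    {T : Scheme.{u}} {t : T ⟶ Y}
    (ht : ∀ z : T, t z ∈ tripleLocus (extend s) (extend s') i j (.pt k))
    (c : AdaptedCoords s t i j) (c' : AdaptedCoords s' t i j) {f f' : T ⟶ P1.{u}}
    {x x' : Fin 2 → Γ(T, ⊤)} (hx : c.Represents f x) (hx' : c'.Represents f' x') :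
    crossRel s s' K t f f' ↔ CurveEq c c' k x x' :=
  ⟨fun h => (crossPt_quad_iff c c' k hx hx').mp (h i j hij k), fun h =>
    crossRel_of_mem_tripleLocus hrel hij c c' fun z =>
      ⟨k, ht z, (crossPt_quad_iff c c' k hx hx').mpr h⟩⟩

end

end QuiverCurve

end

open QuiverCurve in
theorem mainTheorem8 (K : Kind) (n : ℕ) (Y : Scheme.{u}) (θ θ' : Vertex K n → ℚ)
    (s s' : Fin n → Sec Y) (hs : IsStableFamily K θ s) (hs' : IsStableFamily K θ' s')
    (hrel : AreRelated K s s') :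
    -- the loci are open and cover `Y`, and adapted coordinates exist locally on `U_{i,j}`
    (∀ i j : Mark n K, Adm i j → IsOpen (pairLocus (extend s) (extend s') i j)) ∧
    (∀ (i j : Mark n K) (k : Fin n), Adm i j →
      IsOpen (tripleLocus (extend s) (extend s') i j (.pt k))) ∧
    (∀ y : Y, ∃ (i j : Mark n K) (k : Fin n), Adm i j ∧
      y ∈ pairLocus (extend s) (extend s') i j ∧
      y ∈ tripleLocus (extend s) (extend s') i j (.pt k)) ∧
    (∀ i j : Mark n K, Adm i j → ∀ y ∈ pairLocus (extend s) (extend s') i j,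
      ∃ V : Y.Opens, y ∈ V ∧ Nonempty (AdaptedCoords s V.ι i j) ∧
        Nonempty (AdaptedCoords s' V.ι i j)) ∧
    -- the open subscheme `U`, the closed subscheme `Z` and the curve `C`
    ∃ (U : Y.Opens) (Z : Scheme.{u}) (ζ : Z ⟶ Y) (C : Scheme.{u}) (ι : C ⟶ PSq Y),
      (U : Set Y) = overlapLocus K s s' ∧
      IsDegenerationScheme K s s' ζ ∧ Set.range ζ = (U : Set Y)ᶜ ∧
      IsClosedImmersion ι ∧
      -- over `U_{i,j}` the subscheme `C` is defined by the equations for all `k`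
      (∀ (i j : Mark n K), Adm i j → ∀ (T : Scheme.{u}) (t : T ⟶ Y)
        (c : AdaptedCoords s t i j) (c' : AdaptedCoords s' t i j) (f f' : T ⟶ P1.{u})
        (x x' : Fin 2 → Γ(T, ⊤)), c.Represents f x → c'.Represents f' x' →
        ((∃ γ : T ⟶ C, γ ≫ ι = PSq.lift t f f') ↔ ∀ k, CurveEq c c' k x x')) ∧
      -- over `U_{i,j,k}` it is defined by the single equation for this `k`
      (∀ (i j : Mark n K), Adm i j → ∀ (k : Fin n) (T : Scheme.{u}) (t : T ⟶ Y),
        (∀ y : T, t y ∈ tripleLocus (extend s) (extend s') i j (.pt k)) → ∀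
        (c : AdaptedCoords s t i j) (c' : AdaptedCoords s' t i j) (f f' : T ⟶ P1.{u})
        (x x' : Fin 2 → Γ(T, ⊤)), c.Represents f x → c'.Represents f' x' →
        ((∃ γ : T ⟶ C, γ ≫ ι = PSq.lift t f f') ↔ CurveEq c c' k x x')) ∧
      -- `C` is a flat family of reduced curves, and reduced if `Y` is
      Flat (toBase ι) ∧ GeometricallyReduced (toBase ι) ∧ (IsReduced Y → IsReduced C) ∧
      -- `C` contains all pairs of sections
      (∀ m : Mark n K, ∃ γ : Y ⟶ C,
        γ ≫ ι = PSq.lift (𝟙 Y) (extend s m).toP1 (extend s' m).toP1) ∧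
      -- over `U` both projections are isomorphisms
      IsIso (proj₁ ι U.ι) ∧ IsIso (proj₂ ι U.ι) ∧
      -- `C` becomes a chain exactly over `Z`
      (∀ (T : Scheme.{u}) (t : T ⟶ Y),
        (∃ z : T ⟶ Z, z ≫ ζ = t) ↔ ∃ τ τ' : Sec T, IsChain (proj₁ ι t) (proj₂ ι t) τ τ') ∧
      -- the induced morphisms between the two projective lines
      ∃ (τ τ' : Sec Z) (Φ : PLine (U : Scheme.{u}) ≅ PLine (U : Scheme.{u})),
        IsChain (proj₁ ι ζ) (proj₂ ι ζ) τ τ' ∧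
        Φ.hom ≫ PLine.proj U = PLine.proj U ∧
        proj₁ ι U.ι ≫ Φ.hom = proj₂ ι U.ι ∧
        (∀ m : Mark n K, ((extend s m).baseChange U.ι).hom ≫ Φ.hom =
          ((extend s' m).baseChange U.ι).hom) ∧
        InducesRepIso K s s' U Φ.hom ∧
        InducesMorphism (ι ≫ PSq.fst Y) (ι ≫ PSq.snd Y) ζ τ τ' U Φ.hom ∧
        InducesMorphism (ι ≫ PSq.snd Y) (ι ≫ PSq.fst Y) ζ τ' τ U Φ.inv := by
  have hcov := isCovered hs hs'
  obtain ⟨Z, ζ, C, ι, hζi, hι, hζ, hrelC, hflat, hgr, hred, hchain, hU⟩ :=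
    (correspondence hrel hcov).exists_scheme
  let U : Y.Opens := ⟨(Set.range ζ)ᶜ, ζ.isClosedEmbedding.isClosed_range.isOpen_compl⟩
  have hUc : Set.range ζ = (U : Set Y)ᶜ := (compl_compl _).symm
  obtain ⟨h1, h2, τ, τ', Φ, hch, hΦp, hΦ, hΦrel, hm, hm'⟩ := hU U hUc
  refine ⟨fun i j _ => isOpen_pairLocus _ _ i j, fun i j k _ => isOpen_tripleLocus _ _ i j _,
    hcov, fun i j _ y hy => exists_adaptedCoords₂ s s' hy, U, Z, ζ, C, ι,
    Set.ext fun y => (mem_overlapLocus_iff hs hζ y).symm, isDegenerationScheme ζ hζ, hUc, hι,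
    fun i j hij T t c c' f f' x x' hx hx' =>
      (hrelC T t f f').trans (crossRel_iff_forall_curveEq hs hrel hij c c' hx hx'),
    fun i j hij k T t ht c c' f f' x x' hx hx' =>
      (hrelC T t f f').trans (crossRel_iff_curveEq hrel hij ht c c' hx hx'),
    hflat, hgr, hred, fun m => (hrelC Y (𝟙 Y) _ _).mpr (crossRel_mark hrel hcov m), h1, h2, hchain,
    τ, τ', Φ, hch, hΦp, hΦ, baseChange_hom_comp hrel hcov hΦrel, inducesRepIso hζ hUc hΦrel, hm,
    hm'⟩
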